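/- Let $K$ be a field with $\mathbb{Q}\subseteq K\subseteq\mathbb{R}$, let $n\ge 1$, and let $\Delta\subseteq K^n$ be a compact convex polytope (the convex hull of finitely many points) of dimension $n$. For a fan $\Sigma$ (a finite polyhedral complex of cones with vertex $0$) in a finite-dimensional $K$-vector space $V$, a cohomological system $\mathcal F$ on $\Sigma$ is a covariant functor $\sigma\mapsto\mathcal F(\sigma)$ to $K$-vector spaces on the category of cones of $\Sigma$ with the face relations $\tau\le\sigma$ as morphisms. Fix an orientation of (the span of) every $\sigma\in\Sigma$, and let $\varepsilon(\tau,\sigma)=\pm1$ if $\tau$ is a facet of $\sigma$, according to whether the orientation of $\tau$ agrees with the one inherited from $\sigma$ or not, and $\varepsilon(\tau,\sigma)=0$ otherwise. Then $H^k(\Sigma,\mathcal F)$, $k\in\mathbb Z$, denotes the cohomology of the complex $C^k=\bigoplus_{\dim\sigma=k}\mathcal F(\sigma)$ whose differential $C^k\to C^{k+1}$ has the components $\varepsilon(\tau,\sigma)\cdot(\mathcal F(\tau)\to\mathcal F(\sigma))$. Let $V/\mathrm{span}$ be the system $\sigma\mapsto V/\mathrm{span}(\sigma)$, and define the Hodge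 spaces $$H^{p,q}(\Sigma):=H^{\dim V-p}\big(\Sigma,\Lambda^q(V/\mathrm{span})\big)^*\qquad(p\in\mathbb Z,\ q\ge0).$$ Let $\mathcal N(\Delta)$ be the inner normal fan of $\Delta$ in $(K^n)^*$: its cones are $\{v\in (K^n)^* : v(x)\le v(y)\text{ for all }x\in F,\ y\in\Delta\}$ for the nonempty faces $F$ of $\Delta$ (including $\Delta$ itself). Let $\mathrm{cone}(\Delta)\subseteq K^{n+1}$ be the cone generated by $\Delta\times\{1\}$, regarded as the fan of all its faces, and put, for $k\in\mathbb Z$, $$D^k(\Delta):=H^k\big(\mathrm{cone}(\Delta),K^{n+1}/\mathrm{span}\big).$$ Then, for every choice of the orientations, there is an exact sequence of $K$-vector spaces $$0\to K\longrightarrow H^{1,1}(\mathcal N(\Delta))\longrightarrow D^1(\Delta)\to 0,$$ and for every integer $k\neq1$ there is an isomorphism of $K$-vector spaces $H^{k,1}(\mathcal N(\Delta))\cong D^k(\Delta)$. -/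

import Mathlib

noncomputable section

open Module

/-! ### Fans and cohomological systems -/

section Fans

variable {K : Type*} [Field K] [LinearOrder K] [IsStrictOrderedRing K]
variable {V : Type*} [AddCommGroup V] [Module K V]

/-- A polyhedral cone: an intersection of finitely many linear half-spaces `{x | 0 ≤ f x}`. -/
def IsPolyhedralCone (σ : PointedCone K V) : Prop :=
  PointedCone.DualFG (LinearMap.id : Dual K V →ₗ[K] Dual K V) σ

/-- The linear span of a cone. -/
abbrev coneSpan (σ : PointedCone K V) : Submodule K V := Submodule.span K (σ : Set V)

/-- The dimension of a cone is the dimension of its linear span. -/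
def coneDim (σ : PointedCone K V) : ℕ := finrank K (coneSpan σ)

variable (K V) in
/-- A fan in `V`: a finite set of polyhedral cones with vertex `0`, closed under taking faces, such
that any two of its cones intersect in a common face. -/
structure Fan where
  cones : Set (PointedCone K V)
  finite : cones.Finite
  polyhedral : ∀ σ ∈ cones, IsPolyhedralCone σ
  salient : ∀ σ ∈ cones, ∀ x ∈ σ, -x ∈ σ → x = 0
  face_mem : ∀ σ ∈ cones, ∀ τ : PointedCone K V, τ.IsFaceOf σ → τ ∈ cones
  inter_face : ∀ σ ∈ cones, ∀ τ ∈ cones, (σ ⊓ τ).IsFaceOf σ ∧ (σ ⊓ τ).IsFaceOf τ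

namespace Fan

/-- The type of cones of a fan. -/
abbrev Cone (X : Fan K V) : Type _ := {σ : PointedCone K V // σ ∈ X.cones}

instance (X : Fan K V) : Finite X.Cone := X.finite.to_subtype

/-- A choice of an orientation (of the linear span) of every cone of the fan. -/
abbrev Orientations (X : Fan K V) : Type _ :=
  ∀ σ : X.Cone, Orientation K (coneSpan σ.1) (Fin (coneDim σ.1))

/-- `τ` is a facet of `σ`, i.e. a face of codimension one. -/
def IsFacetOf (τ σ : PointedCone K V) : Prop :=
  τ.IsFaceOf σ ∧ coneDim σ = coneDim τ + 1

/-- For a facet `τ` of `σ`: the given orientation of `τ` agrees with the one inherited from `σ` by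
the rule "outward pointing vector first".
Here `b` is a basis of `span τ`, and `b'` is the basis of `span σ` that consists of an outward
pointing vector `-w` (with `w ∈ σ`) followed by `b`; the orientations agree if `b` and `b'` are
either both positively oriented or both negatively oriented. -/
def OrientationsAgree {τ σ : PointedCone K V}
    (oτ : Orientation K (coneSpan τ) (Fin (coneDim τ)))
    (oσ : Orientation K (coneSpan σ) (Fin (coneDim σ))) : Prop :=
  ∃ (b : Basis (Fin (coneDim τ)) K (coneSpan τ)) (b' : Basis (Fin (coneDim σ)) K (coneSpan σ)),
    ∃ w ∈ σ,
      (∀ j : Fin (coneDim σ), j.val = 0 → (b' j : V) = -w) ∧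
      (∀ (i : Fin (coneDim τ)) (j : Fin (coneDim σ)), j.val = i.val + 1 → (b' j : V) = (b i : V)) ∧
      (b.orientation = oτ ↔ b'.orientation = oσ)

open Classical in
/-- The incidence number `ε(τ, σ)`: it is `±1` if `τ` is a facet of `σ`, depending on whether the
orientation of `τ` agrees with the inherited one, and it is `0` otherwise. -/
def incidence (X : Fan K V) (o : X.Orientations) (τ σ : X.Cone) : ℤ :=
  if IsFacetOf τ.1 σ.1 then (if OrientationsAgree (o τ) (o σ) then 1 else -1) else 0

universe w

/-- A cohomological system (of `K`-vector spaces) on a fan: a covariant functor on the category of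
its cones, with the face relations as morphisms. -/
structure CohomologicalSystem (X : Fan K V) where
  obj : X.Cone → Type w
  [addCommGroup : ∀ σ, AddCommGroup (obj σ)]
  [module : ∀ σ, Module K (obj σ)]
  map : ∀ {τ σ : X.Cone}, τ.1.IsFaceOf σ.1 → (obj τ →ₗ[K] obj σ)
  map_id : ∀ σ : X.Cone, map (PointedCone.IsFaceOf.refl σ.1) = LinearMap.id
  map_comp : ∀ {ρ τ σ : X.Cone} (h : ρ.1.IsFaceOf τ.1) (h' : τ.1.IsFaceOf σ.1),
    map (h.trans h') = map h' ∘ₗ map h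

attribute [instance] CohomologicalSystem.addCommGroup CohomologicalSystem.module

namespace CohomologicalSystem

variable {X : Fan K V}

/-- The cochains of degree `k`: the (finite) direct sum of all `F(σ)` with `dim σ = k`. -/
abbrev Cochain (F : CohomologicalSystem X) (k : ℤ) : Type _ :=
  ∀ σ : {σ : X.Cone // (coneDim σ.1 : ℤ) = k}, F.obj σ.1

open Classical in
/-- The component `F(τ) → F(σ)` of the differential, i.e. `ε(τ, σ)` times the face map. -/
def dComponent (F : CohomologicalSystem X) (o : X.Orientations) (τ σ : X.Cone) :
    F.obj τ →ₗ[K] F.obj σ :=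
  if h : τ.1.IsFaceOf σ.1 then X.incidence o τ σ • F.map h else 0

/-- The differential `d : C^k → C^l`, used for `l = k + 1`. -/
def d (F : CohomologicalSystem X) (o : X.Orientations) (k l : ℤ) :
    F.Cochain k →ₗ[K] F.Cochain l :=
  letI := Fintype.ofFinite {τ : X.Cone // (coneDim τ.1 : ℤ) = k}
  LinearMap.pi fun σ => ∑ τ : {τ : X.Cone // (coneDim τ.1 : ℤ) = k},
    F.dComponent o τ.1 σ.1 ∘ₗ LinearMap.proj τ

/-- The cohomology `H^k(X, F)`: the cocycles in `C^k` modulo the image of `C^(k-1)` (the image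
consists of cocycles, as `d ∘ d = 0` on a fan; it is pulled back to the space of cocycles). -/
abbrev Cohomology (F : CohomologicalSystem X) (o : X.Orientations) (k : ℤ) : Type _ :=
  LinearMap.ker (F.d o k (k + 1)) ⧸
    (LinearMap.range (F.d o (k - 1) k)).comap (LinearMap.ker (F.d o k (k + 1))).subtype

/-- The exterior power `Λ^q F` of a cohomological system. -/
def exteriorPower (F : CohomologicalSystem X) (q : ℕ) : CohomologicalSystem X where
  obj σ := ⋀[K]^q (F.obj σ)
  map h := _root_.exteriorPower.map q (F.map h)
  map_id σ := by rw [F.map_id, _root_.exteriorPower.map_id]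
  map_comp h h' := by rw [F.map_comp h h', _root_.exteriorPower.map_comp]

end CohomologicalSystem

/-- The cohomological system `σ ↦ V / span σ`, with the natural projections as face maps. -/
def quotientSystem (X : Fan K V) : CohomologicalSystem X where
  obj σ := V ⧸ coneSpan σ.1
  map {τ σ} h := Submodule.mapQ (coneSpan τ.1) (coneSpan σ.1) LinearMap.id
    (Submodule.span_mono h.le)
  map_id σ := Submodule.mapQ_id _
  map_comp h h' := by
    ext x
    rfl

/-- The Hodge spaces `H^{p,q}(X) = H^{dim V - p}(X, Λ^q (V / span))^*` of a fan in `V`. -/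
abbrev HodgeSpace (X : Fan K V) (o : X.Orientations) (p : ℤ) (q : ℕ) : Type _ :=
  Dual K ((X.quotientSystem.exteriorPower q).Cohomology o ((finrank K V : ℤ) - p))

end Fan

end Fans

/-! ### Polytopes, the fan spanned by `cone(Δ)`, and the inner normal fan -/

section Polytopes

variable {K : Type*} [Field K] [LinearOrder K] [IsStrictOrderedRing K]
variable {V : Type*} [AddCommGroup V] [Module K V]

variable (K V) in
/-- A compact convex polytope: the convex hull of finitely many points. -/
structure Polytope where
  carrier : Set V
  exists_finset : ∃ S : Finset V, carrier = convexHull K (S : Set V)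

/-- Fourier-Motzkin elimination. -/
theorem IsPolyhedralCone.sup_ray {C : PointedCone K V} (hC : IsPolyhedralCone C) (v : V) :
    IsPolyhedralCone (C ⊔ PointedCone.hull K {v}) := by
  classical
  obtain ⟨S, rfl⟩ := hC
  let P := S.filter fun f => 0 < f v
  let N := S.filter fun f => f v < 0
  refine ⟨(S.filter fun f => 0 ≤ f v) ∪
    (P ×ˢ N).image fun fg => fg.1 v • fg.2 - fg.2 v • fg.1, ?_⟩
  ext x
  simp only [Submodule.mem_sup, Submodule.mem_span_singleton, PointedCone.mem_dual,
    Finset.coe_union, Set.mem_union, Finset.mem_coe, LinearMap.id_apply]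
  constructor
  · intro h
    let A : Finset K := insert 0 (N.image fun g => g x / g v)
    have hA : A.Nonempty := ⟨0, Finset.mem_insert_self _ _⟩
    have hmax := A.max'_mem hA
    set t := A.max' hA with ht
    have ht0 : 0 ≤ t := A.le_max' _ (Finset.mem_insert_self _ _)
    refine ⟨x - t • v, ?_, t • v, ⟨⟨t, ht0⟩, rfl⟩, by simp⟩
    intro f hf
    simp only [map_sub, map_smul, smul_eq_mul]
    rcases lt_trichotomy (f v) 0 with hv | hv | hv
    · have : f x / f v ≤ t := A.le_max' _ (Finset.mem_insert_of_mem
        (Finset.mem_image_of_mem _ (Finset.mem_filter.2 ⟨hf, hv⟩)))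
      rw [div_le_iff_of_neg hv] at this
      linarith
    · have := h (Or.inl (Finset.mem_filter.2 ⟨hf, hv.ge⟩))
      simpa [hv] using this
    · rcases Finset.mem_insert.1 hmax with h0 | h1
      · have := h (Or.inl (Finset.mem_filter.2 ⟨hf, hv.le⟩))
        simpa [h0] using this
      · obtain ⟨g, hg, hgt⟩ := Finset.mem_image.1 h1
        have hgv : g v < 0 := (Finset.mem_filter.1 hg).2
        have := h (Or.inr (Finset.mem_image_of_mem _
          (Finset.mk_mem_product (Finset.mem_filter.2 ⟨hf, hv⟩) hg)))
        simp only [LinearMap.sub_apply, LinearMap.smul_apply, smul_eq_mul] at this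
        rw [← hgt]
        have h2 : f x - g x / g v * f v = -(f v * g x - g v * f x) / g v := by
          have hne := hgv.ne
          field_simp
          ring
        rw [h2]
        exact div_nonneg_of_nonpos (by linarith) hgv.le
  · rintro ⟨y, hy, z, ⟨⟨t, ht⟩, rfl⟩, rfl⟩ f hf
    have hs : (⟨t, ht⟩ : {c : K // 0 ≤ c}) • v = t • v := rfl
    rw [hs]
    rcases hf with hf | hf
    · have hf := Finset.mem_filter.1 hf
      have := hy hf.1
      simp only [map_add, map_smul, smul_eq_mul]
      have := mul_nonneg ht hf.2
      linarith
    · obtain ⟨⟨g, k⟩, hfg, rfl⟩ := Finset.mem_image.1 hf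
      obtain ⟨hg, hk⟩ := Finset.mem_product.1 hfg
      have hg := Finset.mem_filter.1 hg
      have hk := Finset.mem_filter.1 hk
      have h1 := mul_nonneg hg.2.le (hy hk.1)
      have h2 := mul_nonneg (neg_nonneg.2 hk.2.le) (hy hg.1)
      simp only [LinearMap.sub_apply, LinearMap.smul_apply, smul_eq_mul, map_add, map_smul]
      simp only [] at h1 h2
      nlinarith

theorem isPolyhedralCone_hull [FiniteDimensional K V] (S : Finset V) :
    IsPolyhedralCone (PointedCone.hull K (S : Set V)) := by
  classical
  induction S using Finset.induction_on with
  | empty =>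
    let b := Module.finBasis K V
    refine ⟨Finset.univ.image b.coord ∪ Finset.univ.image fun i => -b.coord i, ?_⟩
    ext x
    simp only [PointedCone.mem_dual, Finset.coe_empty, Submodule.span_empty, Submodule.mem_bot]
    constructor
    · intro h
      refine b.ext_elem fun i => ?_
      have h1 := @h (b.coord i) (by simp)
      have h2 := @h (-b.coord i) (by simp)
      simp only [LinearMap.id_apply, LinearMap.neg_apply, Basis.coord_apply] at h1 h2
      simp only [map_zero, Finsupp.coe_zero, Pi.zero_apply]
      linarith
    · rintro rfl f -
      simp
  | insert v S _ ih =>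
    rw [Finset.coe_insert, PointedCone.hull, Submodule.span_insert, sup_comm]
    exact ih.sup_ray v

namespace Polytope

/-- The cone over `Δ`, generated by `Δ × {1}` in `V × K`. -/
def cone (Δ : Polytope K V) : PointedCone K (V × K) :=
  PointedCone.hull K ((fun x : V => (x, (1 : K))) '' Δ.carrier)

theorem exists_cone_eq (Δ : Polytope K V) :
    ∃ S : Finset (V × K), Δ.cone = PointedCone.hull K (S : Set (V × K)) ∧
      ∀ s ∈ S, s.2 = 1 := by
  classical
  obtain ⟨S, hS⟩ := Δ.exists_finset
  refine ⟨S.image fun x => (x, 1), ?_, by simp⟩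
  apply le_antisymm
  · refine Submodule.span_le.2 ?_
    rintro _ ⟨x, hx, rfl⟩
    rw [hS] at hx
    have hconv : Convex K {y : V | ((y, 1) : V × K) ∈
        PointedCone.hull K ((S.image fun x => ((x, 1) : V × K) : Finset (V × K)) :
          Set (V × K))} := by
      intro y hy z hz a b ha hb hab
      have := (PointedCone.hull K ((S.image fun x => ((x, 1) : V × K) : Finset (V × K)) :
          Set (V × K))).convex hy hz ha hb hab
      simpa [hab] using this
    have hmem : ∀ s ∈ S, ((s, 1) : V × K) ∈ S.image fun x => ((x, 1) : V × K) :=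
      fun s hs => Finset.mem_image.2 ⟨s, hs, rfl⟩
    have hgen : (S : Set V) ⊆ {y : V | ((y, 1) : V × K) ∈
        PointedCone.hull K ((S.image fun x => ((x, 1) : V × K) : Finset (V × K)) :
          Set (V × K))} :=
      fun s hs => PointedCone.subset_hull (Finset.mem_coe.2 (hmem s hs))
    exact convexHull_min hgen hconv hx
  · refine Submodule.span_mono ?_
    intro y hy
    obtain ⟨x, hx, rfl⟩ := Finset.mem_image.1 (Finset.mem_coe.1 hy)
    exact ⟨x, by rw [hS]; exact subset_convexHull K _ hx, rfl⟩

theorem face_eq_hull {W : Type*} [AddCommGroup W] [Module K W] {τ : PointedCone K W}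
    {S : Finset W} (h : τ.IsFaceOf (PointedCone.hull K (S : Set W))) :
    τ = PointedCone.hull K ((S : Set W) ∩ τ) := by
  apply le_antisymm
  · intro x hx
    obtain ⟨c, hc, hcx⟩ := Submodule.mem_span_finset.1 (h.le hx)
    rw [← hcx, ← Finset.sum_coe_sort]
    refine Submodule.sum_mem _ fun s _ => ?_
    rcases eq_or_lt_of_le (c s.1).2 with h0 | h0
    · have : c s.1 = 0 := Subtype.ext h0.symm
      rw [this, zero_smul]
      exact Submodule.zero_mem _
    · refine Submodule.smul_mem _ _ (Submodule.subset_span ⟨s.2, ?_⟩)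
      refine h.mem_of_sum_smul_mem (f := fun s : S => s.1) (c := fun s : S => (c s.1 : K))
        (fun s => Submodule.subset_span s.2) (fun s => (c s.1).2) ?_ s h0
      have h3 := hcx
      rw [← Finset.sum_coe_sort] at h3
      rw [← h3] at hx
      exact hx
  · exact Submodule.span_le.2 Set.inter_subset_right

/-- The fan in `V × K` that consists of all faces of `cone(Δ)`. -/
def coneFan [FiniteDimensional K V] (Δ : Polytope K V) : Fan K (V × K) where
  cones := {τ | τ.IsFaceOf Δ.cone}
  finite := by
    obtain ⟨S, hS, -⟩ := Δ.exists_cone_eq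
    rw [hS]
    refine Set.Finite.of_finite_image (f := fun τ => (S : Set (V × K)) ∩ τ) ?_ ?_
    · refine S.finite_toSet.finite_subsets.subset ?_
      rintro _ ⟨τ, -, rfl⟩
      exact Set.inter_subset_left
    · intro τ hτ τ' hτ' h
      rw [face_eq_hull hτ, face_eq_hull hτ']
      exact congrArg _ h
  polyhedral := by
    classical
    obtain ⟨S, hS, -⟩ := Δ.exists_cone_eq
    intro τ hτ
    rw [hS] at hτ
    have := isPolyhedralCone_hull (K := K) (S.filter fun s => s ∈ τ)
    rw [face_eq_hull hτ]
    convert this using 3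
    ext s
    simp
  salient := by
    obtain ⟨S, hS, h1⟩ := Δ.exists_cone_eq
    have key : ∀ x ∈ Δ.cone, 0 ≤ x.2 ∧ (x.2 = 0 → x = 0) := by
      intro x hx
      rw [hS] at hx
      induction hx using Submodule.span_induction with
      | mem y hy =>
        have := h1 y hy
        simp [this]
      | zero => simp
      | add y z _ _ hy hz =>
        refine ⟨add_nonneg hy.1 hz.1, fun h => ?_⟩
        have h2 : y.2 + z.2 = 0 := h
        have hy0 : y.2 = 0 := by linarith [hy.1, hz.1]
        have hz0 : z.2 = 0 := by linarith [hy.1, hz.1]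
        rw [hy.2 hy0, hz.2 hz0, add_zero]
      | smul a y _ hy =>
        refine ⟨mul_nonneg a.2 hy.1, fun h => ?_⟩
        have h2 : (a : K) * y.2 = 0 := h
        rcases mul_eq_zero.1 h2 with h3 | h3
        · rw [show a = 0 from Subtype.ext h3, zero_smul]
        · rw [hy.2 h3, smul_zero]
    intro σ hσ x hx hnx
    have h2 := (key x (hσ.le hx)).1
    have h3 := (key (-x) (hσ.le hnx)).1
    rw [Prod.snd_neg] at h3
    exact (key x (hσ.le hx)).2 (by linarith)
  face_mem σ hσ τ hτ := hτ.trans hσ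
  inter_face σ hσ τ hτ :=
    ⟨((hσ.inf_left hτ).isFaceOf_iff_le hσ).2 inf_le_left,
      ((hσ.inf_left hτ).isFaceOf_iff_le hτ).2 inf_le_right⟩

/-- The invariants `D^k(Δ) = H^k(cone(Δ), (V × K) / span)`. -/
abbrev D [FiniteDimensional K V] (Δ : Polytope K V) (o : Δ.coneFan.Orientations) (k : ℤ) : Type _ :=
  Δ.coneFan.quotientSystem.Cohomology o k

/-- The face of `Δ` on which the linear form `u` attains its minimum. -/
def face (Δ : Polytope K V) (u : Dual K V) : Set V :=
  {x ∈ Δ.carrier | ∀ y ∈ Δ.carrier, u x ≤ u y}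

/-- The inner normal cone of `Δ` along a subset `F`: the linear forms that attain their minimum
over `Δ` at every point of `F`. -/
def normalCone (Δ : Polytope K V) (F : Set V) : PointedCone K (Dual K V) where
  carrier := {v | ∀ x ∈ F, ∀ y ∈ Δ.carrier, v x ≤ v y}
  add_mem' := by
    intro v w hv hw x hx y hy
    exact add_le_add (hv x hx y hy) (hw x hx y hy)
  zero_mem' := by
    intro x _ y _
    exact le_rfl
  smul_mem' := by
    intro c v hv x hx y hy
    exact mul_le_mul_of_nonneg_left (hv x hx y hy) c.2

theorem mem_normalCone {Δ : Polytope K V} {F : Set V} {v : Dual K V} :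
    v ∈ Δ.normalCone F ↔ ∀ x ∈ F, ∀ y ∈ Δ.carrier, v x ≤ v y := Iff.rfl

/-- Membership in a normal cone can be tested on the generators of the polytope. -/
theorem mem_normalCone_face_iff {Δ : Polytope K V} {S : Finset V}
    (hS : Δ.carrier = convexHull K (S : Set V)) {u v : Dual K V} :
    v ∈ Δ.normalCone (Δ.face u) ↔ ∀ s ∈ S, s ∈ Δ.face u → ∀ t ∈ S, v s ≤ v t := by
  have hSΔ : ∀ s ∈ S, s ∈ Δ.carrier := fun s hs => by
    rw [hS]; exact subset_convexHull K _ hs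
  constructor
  · intro h s _ hsu t ht
    exact h s hsu t (hSΔ t ht)
  · intro h x hx
    obtain ⟨w, hw0, hw1, hwx⟩ : ∃ w : V → K, (∀ y ∈ S, 0 ≤ w y) ∧ ∑ y ∈ S, w y = 1 ∧
        ∑ y ∈ S, w y • y = x := Finset.mem_convexHull'.1 (hS ▸ hx.1)
    have hface : ∀ s ∈ S, w s ≠ 0 → s ∈ Δ.face u := by
      have hsum : ∑ s ∈ S, w s * (u s - u x) = 0 := by
        simp only [mul_sub, Finset.sum_sub_distrib, ← Finset.sum_mul, hw1, one_mul]
        have : u (∑ y ∈ S, w y • y) = u x := by rw [hwx]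
        rw [map_sum] at this
        simp only [map_smul, smul_eq_mul] at this
        rw [this, sub_self]
      have hnn : ∀ s ∈ S, 0 ≤ w s * (u s - u x) := fun s hs =>
        mul_nonneg (hw0 s hs) (sub_nonneg.2 (hx.2 s (hSΔ s hs)))
      intro s hs hws
      have h0 := (Finset.sum_eq_zero_iff_of_nonneg hnn).1 hsum s hs
      have h1 : u s - u x = 0 := (mul_eq_zero.1 h0).resolve_left hws
      exact ⟨hSΔ s hs, fun y hy => by linarith [hx.2 y hy]⟩
    have hvt : ∀ t ∈ S, v x ≤ v t := by
      intro t ht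
      have h1 : v x = ∑ s ∈ S, w s * v s := by
        rw [← hwx, map_sum]
        simp
      have h2 : v t = ∑ s ∈ S, w s * v t := by rw [← Finset.sum_mul, hw1, one_mul]
      rw [h1, h2]
      refine Finset.sum_le_sum fun s hs => ?_
      by_cases hws : w s = 0
      · simp [hws]
      · exact mul_le_mul_of_nonneg_left (h s hs (hface s hs hws) t ht) (hw0 s hs)
    intro y hy
    have hconv : Convex K {y : V | v x ≤ v y} := convex_halfSpace_ge v.isLinear _
    rw [hS] at hy
    exact convexHull_min (fun t ht => hvt t ht) hconv hy

theorem face_nonempty {Δ : Polytope K V} (hΔ : affineSpan K Δ.carrier = ⊤) (u : Dual K V) :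
    (Δ.face u).Nonempty := by
  obtain ⟨S, hS⟩ := Δ.exists_finset
  have hne : Δ.carrier.Nonempty := by
    rw [← affineSpan_nonempty (k := K), hΔ]
    exact ⟨0, trivial⟩
  have hSne : S.Nonempty := by
    rw [hS] at hne
    simpa using hne
  obtain ⟨s, hs, hmin⟩ := S.exists_min_image u hSne
  refine ⟨s, by rw [hS]; exact subset_convexHull K _ hs, fun y hy => ?_⟩
  rw [hS] at hy
  exact convexHull_min (fun t ht => hmin t ht) (convex_halfSpace_ge u.isLinear (u s)) hy

/-- A face of a normal cone is again a normal cone. -/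
theorem face_normalCone {Δ : Polytope K V} (hΔ : affineSpan K Δ.carrier = ⊤) (u : Dual K V)
    (τ : PointedCone K (Dual K V)) (hτ : τ.IsFaceOf (Δ.normalCone (Δ.face u))) :
    ∃ w, Δ.normalCone (Δ.face w) = τ := by
  classical
  obtain ⟨S, hS⟩ := Δ.exists_finset
  have hSΔ : ∀ s ∈ S, s ∈ Δ.carrier := fun s hs => by
    rw [hS]; exact subset_convexHull K _ hs
  obtain ⟨x₀, hx₀⟩ := face_nonempty hΔ u
  -- an element of `τ` whose minimal face contains as few generators as possible
  let c : τ → ℕ := fun w => (S.filter fun s => s ∈ Δ.face w.1).card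
  obtain ⟨⟨w, hw⟩, hmin⟩ : ∃ w : τ, ∀ v : τ, c w ≤ c v := by
    obtain ⟨w, hw⟩ := (wellFounded_lt (α := ℕ)).has_min (Set.range c) ⟨_, ⟨0, rfl⟩⟩
    obtain ⟨w, rfl⟩ := hw.1
    exact ⟨w, fun v => not_lt.1 (hw.2 _ ⟨v, rfl⟩)⟩
  refine ⟨w, le_antisymm ?_ ?_⟩
  · intro v hv
    -- `w - a • v` lies in the normal cone for small `a > 0`
    obtain ⟨a, ha, hav⟩ : ∃ a : K, 0 < a ∧
        ∀ t ∈ S, t ∉ Δ.face w → a * (v t - v x₀) ≤ w t - w x₀ := by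
      have hpos : ∀ t ∈ S, t ∉ Δ.face w → 0 < w t - w x₀ := by
        intro t ht htw
        have h1 := hτ.le hw x₀ hx₀
        refine sub_pos.2 (lt_of_le_of_ne (h1 t (hSΔ t ht)) fun h => htw ?_)
        exact ⟨hSΔ t ht, fun y hy => h ▸ h1 y hy⟩
      have key : ∀ T : Finset V, T ⊆ S → ∃ a : K, 0 < a ∧
          ∀ t ∈ T, t ∉ Δ.face w → a * (v t - v x₀) ≤ w t - w x₀ := by
        intro T
        induction T using Finset.induction_on with
        | empty => exact fun _ => ⟨1, one_pos, by simp⟩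
        | insert t T _ ih =>
          intro hT
          obtain ⟨a, ha, h⟩ := ih ((Finset.subset_insert _ _).trans hT)
          have htS := hT (Finset.mem_insert_self _ _)
          by_cases htw : t ∈ Δ.face w
          · refine ⟨a, ha, fun s hs hsw => ?_⟩
            rcases Finset.mem_insert.1 hs with rfl | hs
            · exact absurd htw hsw
            · exact h s hs hsw
          · have hp := hpos t htS htw
            have hden : 0 < |v t - v x₀| + 1 := by positivity
            refine ⟨min a ((w t - w x₀) / (|v t - v x₀| + 1)), lt_min ha (div_pos hp hden), ?_⟩
            intro s hs hsw
            rcases le_or_gt (v s - v x₀) 0 with hle | hgt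
            · refine le_trans (mul_nonpos_of_nonneg_of_nonpos
                (lt_min ha (div_pos hp hden)).le hle) (hpos s (hT hs) hsw).le
            · rcases Finset.mem_insert.1 hs with rfl | hs
              · calc _ ≤ (w s - w x₀) / (|v s - v x₀| + 1) * (v s - v x₀) :=
                      mul_le_mul_of_nonneg_right (min_le_right _ _) hgt.le
                  _ ≤ (w s - w x₀) / (|v s - v x₀| + 1) * (|v s - v x₀| + 1) :=
                      mul_le_mul_of_nonneg_left (by linarith [le_abs_self (v s - v x₀)])
                        (div_pos hp hden).le
                  _ = w s - w x₀ := div_mul_cancel₀ _ hden.ne'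
              · exact (mul_le_mul_of_nonneg_right (min_le_left _ _) hgt.le).trans (h s hs hsw)
      exact key S (Finset.Subset.refl S)
    have hsub : Δ.face u ⊆ Δ.face w := fun x hx => ⟨hx.1, hτ.le hw x hx⟩
    have hvu : v ∈ Δ.normalCone (Δ.face u) := fun x hx => hv x (hsub hx)
    have hdiff : w - a • v ∈ Δ.normalCone (Δ.face u) := by
      rw [mem_normalCone_face_iff hS]
      intro s hs hsu t ht
      have e1 : w s = w x₀ := le_antisymm (hτ.le hw s hsu x₀ hx₀.1) (hτ.le hw x₀ hx₀ s hsu.1)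
      have e2 : v s = v x₀ := le_antisymm (hvu s hsu x₀ hx₀.1) (hvu x₀ hx₀ s hsu.1)
      simp only [LinearMap.sub_apply, LinearMap.smul_apply, smul_eq_mul, e1, e2]
      by_cases htw : t ∈ Δ.face w
      · have e3 : w t = w x₀ := le_antisymm (htw.2 x₀ hx₀.1) ((hsub hx₀).2 t htw.1)
        have e4 : v t = v x₀ := le_antisymm (hv t htw x₀ hx₀.1) (hvu x₀ hx₀ t htw.1)
        rw [e3, e4]
      · have := hav t ht htw
        linarith
    refine hτ.mem_of_smul_add_mem hvu hdiff ha ?_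
    simpa using hw
  · intro v hv
    rw [mem_normalCone_face_iff hS]
    have hsub : (S.filter fun s => s ∈ Δ.face (w + v)) ⊆ S.filter fun s => s ∈ Δ.face w := by
      intro s hs
      obtain ⟨hs, hsF⟩ := Finset.mem_filter.1 hs
      refine Finset.mem_filter.2 ⟨hs, hSΔ s hs, fun y hy => ?_⟩
      have h1 := hsF.2 x₀ hx₀.1
      have h2 := hτ.le hw x₀ hx₀
      have h3 := hτ.le hv x₀ hx₀
      simp only [LinearMap.add_apply] at h1
      linarith [h2 y hy, h2 s (hSΔ s hs), h3 s (hSΔ s hs)]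
    have heq := Finset.eq_of_subset_of_card_le hsub (hmin ⟨w + v, τ.add_mem hw hv⟩)
    intro s hs hsw t ht
    have hsF : s ∈ Δ.face (w + v) := by
      have : s ∈ S.filter fun s => s ∈ Δ.face w := Finset.mem_filter.2 ⟨hs, hsw⟩
      rw [← heq] at this
      exact (Finset.mem_filter.1 this).2
    have h1 := hsF.2 x₀ hx₀.1
    have h2 := hτ.le hw x₀ hx₀ s (hSΔ s hs)
    have h3 := hτ.le hv x₀ hx₀ t (hSΔ t ht)
    simp only [LinearMap.add_apply] at h1
    linarith

/-- The intersection of two normal cones is a face of each of them. -/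
theorem inter_normalCone {Δ : Polytope K V} (hΔ : affineSpan K Δ.carrier = ⊤) (u₁ u₂ : Dual K V) :
    (Δ.normalCone (Δ.face u₁) ⊓ Δ.normalCone (Δ.face u₂)).IsFaceOf
      (Δ.normalCone (Δ.face u₁)) := by
  obtain ⟨x₀, hx₀⟩ := face_nonempty hΔ u₁
  refine PointedCone.IsFaceOf.of_mem_of_add_mem_left inf_le_left ?_
  intro v v' hv hv' hsum
  refine ⟨hv, fun x hx y hy => ?_⟩
  have h1 := hsum.2 x hx x₀ hx₀.1
  simp only [LinearMap.add_apply] at h1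
  linarith [hv x₀ hx₀ y hy, hv' x₀ hx₀ x hx.1]

/-- The inner normal fan of a full-dimensional polytope; its cones are the inner normal cones along
the nonempty faces of `Δ` (including `Δ` itself, which is the face that belongs to `u = 0`). -/
def normalFan (Δ : Polytope K V) (hΔ : affineSpan K Δ.carrier = ⊤) : Fan K (Dual K V) where
  cones := Set.range fun u : Dual K V => Δ.normalCone (Δ.face u)
  finite := by
    obtain ⟨S, hS⟩ := Δ.exists_finset
    have : (Set.range fun u : Dual K V => {s | s ∈ S ∧ s ∈ Δ.face u}).Finite := by
      refine S.finite_toSet.finite_subsets.subset ?_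
      rintro _ ⟨u, rfl⟩
      exact fun s hs => hs.1
    refine (this.image fun A : Set V => ({v | ∀ s ∈ A, ∀ t ∈ S, v s ≤ v t} : Set (Dual K V))
      ).preimage (f := fun σ : PointedCone K (Dual K V) => (σ : Set (Dual K V)))
      SetLike.coe_injective.injOn |>.subset ?_
    rintro _ ⟨u, rfl⟩
    refine ⟨_, ⟨u, rfl⟩, ?_⟩
    ext v
    refine Iff.trans ?_ (mem_normalCone_face_iff hS).symm
    exact ⟨fun h s hs hsu => h s ⟨hs, hsu⟩, fun h s hs => h s hs.1 hs.2⟩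
  polyhedral := by
    classical
    rintro _ ⟨u, rfl⟩
    obtain ⟨S, hS⟩ := Δ.exists_finset
    refine ⟨((S.filter fun s => s ∈ Δ.face u) ×ˢ S).image
      fun st => Dual.eval K V (st.2 - st.1), ?_⟩
    ext v
    rw [mem_normalCone_face_iff hS, PointedCone.mem_dual]
    constructor
    · intro h s hs hsu t ht
      have := h (Finset.mem_coe.2 (Finset.mem_image_of_mem
        (fun st : V × V => Dual.eval K V (st.2 - st.1))
        (Finset.mk_mem_product (Finset.mem_filter.2 ⟨hs, hsu⟩) ht)))
      simpa using this
    · intro h f hf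
      obtain ⟨⟨s, t⟩, hst, rfl⟩ := Finset.mem_image.1 (Finset.mem_coe.1 hf)
      obtain ⟨hs, ht⟩ := Finset.mem_product.1 hst
      obtain ⟨hs, hsu⟩ := Finset.mem_filter.1 hs
      simpa using h s hs hsu t ht
  salient := by
    rintro _ ⟨u, rfl⟩ v hv hnv
    obtain ⟨x₀, hx₀⟩ := face_nonempty hΔ u
    have hconst : ∀ y ∈ Δ.carrier, v y = v x₀ := by
      intro y hy
      have h1 := hv x₀ hx₀ y hy
      have h2 := hnv x₀ hx₀ y hy
      simp only [LinearMap.neg_apply] at h2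
      linarith
    have hall : ∀ y : V, v y = v x₀ := by
      intro y
      have hy : y ∈ affineSpan K Δ.carrier := by rw [hΔ]; trivial
      refine affineSpan_induction hy hconst fun c y z t hy hz ht => ?_
      simp [hy, hz, ht]
    ext y
    rw [hall y, ← hall 0, map_zero, LinearMap.zero_apply]
  face_mem := by
    rintro _ ⟨u, rfl⟩ τ hτ
    exact face_normalCone hΔ u τ hτ
  inter_face := by
    rintro _ ⟨u₁, rfl⟩ _ ⟨u₂, rfl⟩
    refine ⟨inter_normalCone hΔ u₁ u₂, ?_⟩
    rw [inf_comm]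
    exact inter_normalCone hΔ u₂ u₁

end Polytope

end Polytopes

end

section

open Module

/-! ### Faces, spans and dimensions of finitely generated cones -/

section ConeGeometry

variable {K : Type*} [Field K] [LinearOrder K] [IsStrictOrderedRing K]
variable {W : Type*} [AddCommGroup W] [Module K W]
variable {C M F τ σ ρ : PointedCone K W}

/-! Put W = K^n × K and let lin σ be the space of vectors of height zero in the span of a face σ of
cone(Δ). The nonzero faces σ correspond, with order reversed, to the cones ν of the normal fan,
where dim σ + dim ν = n + 1 and span ν is the annihilator of lin σ (`IsNormal.le_iff`,
`IsNormal.coneSpan_eq`). So lin σ is dual to the coefficient space of ν, and the dual of the cochain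
complex of the normal fan is the complex of functions σ ↦ lin σ on the faces of the cone, called
horizontal here. The incidence numbers of the two fans agree up to signs that can be absorbed
(`exists_signs`), whence H^{k,1} is the cohomology of the horizontal complex in degree k + 1.

The face complex of cone(Δ) with constant coefficients is exact (`exists_coboundary_eq`), so the
(k+1)-st cohomology of lin is the k-th cohomology of W/lin. It is compared with D^k by 0 → span/lin
→ W/lin → W/span → 0. The height identifies span/lin with K at every nonzero face, while span/lin
vanishes at the vertex; by exactness of the constant complex, the only cohomology of this system is
K in degree one. Since D^k vanishes for k ≤ 0 (no nonzero vector lies in the spans of all rays), the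
long exact sequence gives the claim.

Instead of long exact sequences, the proof uses the space `horizontalPrimitives` of functions a of
degree k with da horizontal. It maps onto H^{k,1} through da and onto D^k through a modulo spans.
The kernels of these two maps are compared in `toD_eq_zero_iff_exists`; they differ by lifts of
functions dr with r scalar of degree k − 1. For k ≥ 2 such a lift can be made horizontal, for k = 1
it contributes exactly K.

Exactness is proved without topology, for the more general sets of faces between M and N on which a
linear form h is negative off M (`acyclicOn_neg`). These sets are fibred over the maxima of the
ratio h / l, where l exposes M, and the fibres are sets of the same kind with a smaller difference
of dimensions. -/

theorem exists_pos_mul_le {ι : Type*} (T : Finset ι) (a b : ι → K) (ha : ∀ i ∈ T, 0 < a i) :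
    ∃ r : K, 0 < r ∧ ∀ i ∈ T, r * b i ≤ a i := by
  classical
  induction T using Finset.induction_on with
  | empty => exact ⟨1, one_pos, by simp⟩
  | insert i T _ ih =>
    obtain ⟨r, hr, h⟩ := ih fun j hj => ha j (Finset.mem_insert_of_mem hj)
    have hi := ha i (Finset.mem_insert_self _ _)
    have hden : 0 < |b i| + 1 := by positivity
    refine ⟨min r (a i / (|b i| + 1)), lt_min hr (div_pos hi hden), fun j hj => ?_⟩
    have hm : 0 < min r (a i / (|b i| + 1)) := lt_min hr (div_pos hi hden)
    rcases le_or_gt (b j) 0 with hb | hb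
    · exact (mul_nonpos_of_nonneg_of_nonpos hm.le hb).trans (ha j hj).le
    · rcases Finset.mem_insert.1 hj with rfl | hj
      · calc _ ≤ a j / (|b j| + 1) * (|b j| + 1) := by
              refine mul_le_mul (min_le_right _ _) ?_ hb.le (div_pos hi hden).le
              linarith [le_abs_self (b j)]
          _ = a j := div_mul_cancel₀ _ hden.ne'
      · exact (mul_le_mul_of_nonneg_right (min_le_left _ _) hb.le).trans (h j hj)

namespace PointedCone

theorem IsFaceOf.fg (h : τ.IsFaceOf C) (hC : C.FG) : τ.FG := by
  classical
  obtain ⟨S, rfl⟩ := hC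
  refine ⟨S.filter fun s => s ∈ τ, ?_⟩
  have := Polytope.face_eq_hull h
  conv_rhs => rw [this]
  unfold PointedCone.hull
  congr 1
  ext s
  simp

theorem exists_sub_of_mem_coneSpan {x : W} (hx : x ∈ coneSpan τ) :
    ∃ a ∈ τ, ∃ b ∈ τ, x = a - b := by
  induction hx using Submodule.span_induction with
  | mem x hx => exact ⟨x, hx, 0, τ.zero_mem, by simp⟩
  | zero => exact ⟨0, τ.zero_mem, 0, τ.zero_mem, by simp⟩
  | add x y _ _ hx hy =>
    obtain ⟨a, ha, b, hb, rfl⟩ := hx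
    obtain ⟨a', ha', b', hb', rfl⟩ := hy
    exact ⟨a + a', τ.add_mem ha ha', b + b', τ.add_mem hb hb', by abel⟩
  | smul c x _ hx =>
    obtain ⟨a, ha, b, hb, rfl⟩ := hx
    rcases le_total 0 c with hc | hc
    · exact ⟨c • a, PointedCone.smul_mem _ hc ha, c • b, PointedCone.smul_mem _ hc hb, smul_sub _ _ _⟩
    · refine ⟨(-c) • b, PointedCone.smul_mem _ (neg_nonneg.2 hc) hb, (-c) • a,
        PointedCone.smul_mem _ (neg_nonneg.2 hc) ha, ?_⟩
      rw [neg_smul, neg_smul, smul_sub]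
      abel

/-- Write x = a - b with a and b in the face: then x + b lies in the face, hence so does its summand
x. All dimension arguments for faces rest on this. -/
theorem IsFaceOf.mem_of_mem_coneSpan (h : τ.IsFaceOf C) {x : W} (hx : x ∈ C)
    (hxτ : x ∈ coneSpan τ) : x ∈ τ := by
  obtain ⟨a, ha, b, hb, rfl⟩ := exists_sub_of_mem_coneSpan hxτ
  exact h.mem_of_add_mem_left hx (h.le hb) (by simpa using ha)

theorem coneSpan_mono (h : τ ≤ σ) : coneSpan τ ≤ coneSpan σ := Submodule.span_mono h

theorem mem_coneSpan {x : W} (h : x ∈ τ) : x ∈ coneSpan τ := Submodule.subset_span h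

section

variable [FiniteDimensional K W]

theorem coneDim_mono (h : τ ≤ σ) : coneDim τ ≤ coneDim σ :=
  Submodule.finrank_mono (coneSpan_mono h)

theorem IsFaceOf.eq_of_coneDim_le (h : τ.IsFaceOf C) (hd : coneDim C ≤ coneDim τ) : τ = C := by
  refine le_antisymm h.le fun x hx => h.mem_of_mem_coneSpan hx ?_
  rw [Submodule.eq_of_le_of_finrank_le (coneSpan_mono h.le) hd]
  exact mem_coneSpan hx

theorem IsFaceOf.coneDim_lt (h : τ.IsFaceOf C) (hne : τ ≠ C) : coneDim τ < coneDim C :=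
  not_le.1 fun h' => hne (h.eq_of_coneDim_le h')

/-- Every face of a finitely generated cone is exposed. -/
theorem IsFaceOf.exists_exposing (hM : M.IsFaceOf C) (hC : C.FG) :
    ∃ l : Dual K W, (∀ x ∈ C, 0 ≤ l x) ∧ ∀ x ∈ C, l x = 0 ↔ x ∈ M := by
  classical
  obtain ⟨S, rfl⟩ := hC
  obtain ⟨T, hT⟩ := isPolyhedralCone_hull (K := K) S
  have hTC : ∀ x, x ∈ PointedCone.hull K (S : Set W) ↔ ∀ f ∈ T, 0 ≤ f x := by
    intro x
    rw [← hT]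
    simp [PointedCone.mem_dual]
  -- The exposing form is the sum of those defining inequalities of the cone that are equalities on
  -- all of M.
  let P := T.filter fun f => ∀ x ∈ M, f x = 0
  have hP : ∀ f ∈ T \ P, ∃ x ∈ M, 0 < f x := by
    intro f hf
    obtain ⟨hfT, hfP⟩ := Finset.mem_sdiff.1 hf
    by_contra! hcon
    refine hfP (Finset.mem_filter.2 ⟨hfT, fun x hx => ?_⟩)
    exact le_antisymm (hcon x hx) ((hTC x).1 (hM.le hx) f hfT)
  choose! m hmM hm using hP
  have hsum : ∑ f ∈ T \ P, m f ∈ M := Submodule.sum_mem _ hmM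
  have hpos : ∀ f ∈ T \ P, 0 < f (∑ g ∈ T \ P, m g) := by
    intro f hf
    rw [map_sum]
    refine Finset.sum_pos' (fun g hg => ?_) ⟨f, hf, hm f hf⟩
    exact (hTC _).1 (hM.le (hmM g hg)) f (Finset.mem_sdiff.1 hf).1
  refine ⟨∑ f ∈ P, f, fun x hx => ?_, fun x hx => ⟨fun h0 => ?_, fun hxM => ?_⟩⟩
  · rw [LinearMap.sum_apply]
    exact Finset.sum_nonneg fun f hf => (hTC x).1 hx f (Finset.mem_filter.1 hf).1
  · rw [LinearMap.sum_apply, Finset.sum_eq_zero_iff_of_nonneg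
      fun f hf => (hTC x).1 hx f (Finset.mem_filter.1 hf).1] at h0
    -- All other inequalities are strict at the point `∑ m g` of M. Hence it stays in the cone after
    -- subtracting a small multiple of x, and the face property of M applies to this decomposition.
    obtain ⟨r, hr, h⟩ := exists_pos_mul_le (T \ P) (fun f => f (∑ g ∈ T \ P, m g)) (fun f => f x) hpos
    have hy : ∑ g ∈ T \ P, m g - r • x ∈ PointedCone.hull K (S : Set W) := by
      refine (hTC _).2 fun f hf => ?_
      rw [map_sub, map_smul, smul_eq_mul]
      by_cases hfP : f ∈ P
      · rw [h0 f hfP, (Finset.mem_filter.1 hfP).2 _ hsum]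
        simp
      · exact sub_nonneg.2 (h f (Finset.mem_sdiff.2 ⟨hf, hfP⟩))
    exact hM.mem_of_smul_add_mem hx hy hr (by simpa using hsum)
  · rw [LinearMap.sum_apply]
    exact Finset.sum_eq_zero fun f hf => (Finset.mem_filter.1 hf).2 x hxM

end

/-- The ratio h / l is maximal at one of the finitely many generators with l > 0; where l vanishes
so does h, and the inequality h ≤ t l passes to sums and nonnegative multiples. -/
theorem exists_max_ratio (hF : F.FG) (l h : Dual K W) (hl : ∀ x ∈ F, 0 ≤ l x)
    (hlh : ∀ x ∈ F, l x = 0 → h x = 0) (hne : ∃ x ∈ F, 0 < l x) :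
    ∃ t : K, (∀ x ∈ F, h x ≤ t * l x) ∧ ∃ x ∈ F, 0 < l x ∧ h x = t * l x := by
  classical
  obtain ⟨S, rfl⟩ := hF
  have hSF : ∀ s ∈ S, s ∈ Submodule.span {c : K // 0 ≤ c} (S : Set W) := fun s hs =>
    Submodule.subset_span hs
  have hne' : (S.filter fun s => 0 < l s).Nonempty := by
    by_contra hcon
    obtain ⟨x, hx, hlx⟩ := hne
    refine hlx.ne' ?_
    clear hlx
    induction hx using Submodule.span_induction with
    | mem s hs =>
      refine le_antisymm (not_lt.1 fun h' => hcon ⟨s, Finset.mem_filter.2 ⟨hs, h'⟩⟩) (hl s (hSF s hs))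
    | zero => simp
    | add x y _ _ hx hy => rw [map_add, hx, hy, add_zero]
    | smul c x _ hx =>
      change l ((c : K) • x) = 0
      rw [map_smul, hx, smul_zero]
  obtain ⟨s, hs, hmax⟩ := (S.filter fun s => 0 < l s).exists_max_image (fun s => h s / l s) hne'
  obtain ⟨hsS, hls⟩ := Finset.mem_filter.1 hs
  refine ⟨h s / l s, fun x hx => ?_, s, hSF s hsS, hls, (div_mul_cancel₀ _ hls.ne').symm⟩
  induction hx using Submodule.span_induction with
  | mem y hy =>
    rcases (hl y (hSF y hy)).eq_or_lt with h0 | h0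
    · rw [hlh y (hSF y hy) h0.symm, ← h0, mul_zero]
    · exact (div_le_iff₀ h0).1 (hmax y (Finset.mem_filter.2 ⟨hy, h0⟩))
  | zero => simp
  | add x y _ _ hx hy => rw [map_add, map_add, mul_add]; exact add_le_add hx hy
  | smul c x _ hx =>
    change h ((c : K) • x) ≤ _ * l ((c : K) • x)
    rw [map_smul, map_smul, smul_eq_mul, smul_eq_mul, mul_left_comm]
    exact mul_le_mul_of_nonneg_left hx c.2

/-- The set of zeros of a linear form in a cone. -/
def zeros (F : PointedCone K W) (f : Dual K W) : PointedCone K W :=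
  F ⊓ PointedCone.ofSubmodule (LinearMap.ker f)

theorem mem_zeros {f : Dual K W} {x : W} : x ∈ F.zeros f ↔ x ∈ F ∧ f x = 0 := Iff.rfl

theorem zeros_isFaceOf {f : Dual K W} (hf : ∀ x ∈ F, 0 ≤ f x) : (F.zeros f).IsFaceOf F := by
  refine IsFaceOf.of_mem_of_add_mem_left (fun x hx => hx.1) fun {x y} hx hy hxy => ⟨hx, ?_⟩
  have h1 : f (x + y) = 0 := hxy.2
  rw [map_add] at h1
  exact le_antisymm (by linarith [hf y hy]) (hf x hx)

variable [FiniteDimensional K W]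

/-- A linear form that vanishes on a face of codimension at least two but is not a multiple of a
given exposing form. -/
theorem exists_not_proportional {l : Dual K W} 
    (hl : ∀ x ∈ C, l x = 0 ↔ x ∈ M) (hdim : coneDim M + 2 ≤ coneDim C) :
    ∃ g : Dual K W, (∀ x ∈ M, g x = 0) ∧ ∀ c : K, ∃ x ∈ C, g x ≠ c * l x := by
  have key : ∀ U : Submodule K W, finrank K U < coneDim C → ∃ x ∈ C, x ∉ U := by
    intro U hU
    by_contra! hcon
    exact absurd (Submodule.finrank_mono (Submodule.span_le.2 hcon : coneSpan C ≤ U)) (not_le.2 hU)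
  obtain ⟨x, hxC, hx⟩ := key (coneSpan M) (by unfold coneDim at *; omega)
  have hfr : finrank K (coneSpan M ⊔ K ∙ x : Submodule K W) < coneDim C := by
    have h1 := Submodule.finrank_add_le_finrank_add_finrank (coneSpan M) (K ∙ x)
    have h2 : finrank K (K ∙ x) ≤ 1 := by
      simpa using finrank_span_le_card (R := K) ({x} : Set W)
    unfold coneDim at *
    omega
  obtain ⟨y, hyC, hy⟩ := key _ hfr
  -- The form g vanishes at x, where l does not, so g = c l forces c = 0, which fails at y.
  obtain ⟨g, hgy, hg⟩ := Submodule.exists_le_ker_of_notMem hy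
  refine ⟨g, fun z hz => hg (Submodule.mem_sup_left (mem_coneSpan hz)), fun c => ?_⟩
  by_contra! hcon
  have hgx : g x = 0 := hg (Submodule.mem_sup_right (Submodule.mem_span_singleton_self x))
  have hlx : l x ≠ 0 := fun h0 => hx (mem_coneSpan ((hl x hxC).1 h0))
  have hc : c = 0 := by
    have := hcon x hxC
    rw [hgx] at this
    exact (mul_eq_zero.1 this.symm).resolve_right hlx
  exact hgy (by rw [hcon y hyC, hc, zero_mul])

/-- Between a face of codimension two and the cone, there are exactly two further faces. -/
theorem IsFaceOf.diamond (hC : C.FG) (hM : M.IsFaceOf C) (hdim : coneDim C = coneDim M + 2) :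
    ∃ T₁ T₂ : PointedCone K W, T₁ ≠ T₂ ∧ T₁.IsFaceOf C ∧ T₂.IsFaceOf C ∧
      M ≤ T₁ ∧ M ≤ T₂ ∧ coneDim T₁ = coneDim M + 1 ∧ coneDim T₂ = coneDim M + 1 ∧
      ∀ F : PointedCone K W, F.IsFaceOf C → M ≤ F → coneDim F = coneDim M + 1 → F = T₁ ∨ F = T₂ := by
  obtain ⟨l, hl0, hl⟩ := hM.exists_exposing hC
  -- The two faces are the loci in C where the ratio g / l is maximal and minimal.
  obtain ⟨g, hgM, hg⟩ := exists_not_proportional hl hdim.ge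
  have hlM : ∀ x ∈ M, l x = 0 := fun x hx => (hl x (hM.le hx)).2 hx
  have hne : ∃ x ∈ C, 0 < l x := by
    obtain ⟨x, hx, hgx⟩ := hg 0
    refine ⟨x, hx, lt_of_le_of_ne (hl0 x hx) fun h => hgx ?_⟩
    rw [hgM x ((hl x hx).1 h.symm), zero_mul]
  have main : ∀ g : Dual K W, (∀ x ∈ M, g x = 0) → (∀ c : K, ∃ x ∈ C, g x ≠ c * l x) →
      ∃ (t : K) (T : PointedCone K W), (∀ x ∈ C, g x ≤ t * l x) ∧
        (∀ x, x ∈ T ↔ x ∈ C ∧ g x = t * l x) ∧ T.IsFaceOf C ∧ M ≤ T ∧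
        coneDim T = coneDim M + 1 := by
    intro g hgM hg
    obtain ⟨t, ht, x, hxC, hlx, hgx⟩ := exists_max_ratio hC l g hl0
      (fun x hx h => hgM x ((hl x hx).1 h)) hne
    have hT : (C.zeros (t • l - g)).IsFaceOf C := zeros_isFaceOf fun x hx => by
      simpa using ht x hx
    have hmem : ∀ x, x ∈ C.zeros (t • l - g) ↔ x ∈ C ∧ g x = t * l x := by
      intro x
      rw [mem_zeros]
      rw [LinearMap.sub_apply, LinearMap.smul_apply, smul_eq_mul, sub_eq_zero,
        eq_comm (a := t * l x)]
    have hMT : M ≤ C.zeros (t • l - g) := fun x hx =>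
      (hmem x).2 ⟨hM.le hx, by rw [hgM x hx, hlM x hx, mul_zero]⟩
    have h1 : coneDim M < coneDim (C.zeros (t • l - g)) := by
      refine ((hM.isFaceOf_iff_le hT).2 hMT).coneDim_lt ?_
      rintro h
      exact hlx.ne' (hlM x (h ▸ (hmem x).2 ⟨hxC, hgx⟩))
    have h2 : coneDim (C.zeros (t • l - g)) < coneDim C := by
      refine hT.coneDim_lt fun h => ?_
      obtain ⟨y, hy, hgy⟩ := hg t
      exact hgy ((hmem y).1 (by rw [h]; exact hy : y ∈ C.zeros (t • l - g))).2
    exact ⟨t, _, ht, hmem, hT, hMT, by omega⟩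
  obtain ⟨t₁, T₁, ht₁, hmem₁, hT₁, hMT₁, hd₁⟩ := main g hgM hg
  -- Applied to -g, so that the minimum of g / l is -t₂.
  obtain ⟨t₂, T₂, ht₂, hmem₂, hT₂, hMT₂, hd₂⟩ := main (-g) (fun x hx => by simp [hgM x hx]) fun c => by
    obtain ⟨x, hx, h⟩ := hg (-c)
    refine ⟨x, hx, fun h' => h ?_⟩
    rw [LinearMap.neg_apply] at h'
    linarith
  have hex : ∀ T : PointedCone K W, M ≤ T → coneDim T = coneDim M + 1 → ∃ w ∈ T, w ∉ M := by
    intro T _ hd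
    by_contra! hcon
    have := coneDim_mono hcon
    omega
  obtain ⟨w₁, hw₁, hw₁M⟩ := hex T₁ hMT₁ hd₁
  obtain ⟨w₂, hw₂, hw₂M⟩ := hex T₂ hMT₂ hd₂
  have hlw : ∀ w ∈ C, w ∉ M → 0 < l w := fun w hw hwM =>
    lt_of_le_of_ne (hl0 w hw) fun h => hwM ((hl w hw).1 h.symm)
  have hlw₁ := hlw w₁ (hT₁.le hw₁) hw₁M
  have hlw₂ := hlw w₂ (hT₂.le hw₂) hw₂M
  have hg₁ := ((hmem₁ w₁).1 hw₁).2
  have hg₂ := ((hmem₂ w₂).1 hw₂).2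
  rw [LinearMap.neg_apply] at hg₂
  -- the minimum and the maximum differ
  have ht : -t₂ < t₁ := by
    have h3 := ht₁ w₂ (hT₂.le hw₂)
    have h4 : -t₂ ≤ t₁ := by
      by_contra! hcon
      have := mul_lt_mul_of_pos_right hcon hlw₂
      linarith
    refine lt_of_le_of_ne h4 fun heq => ?_
    obtain ⟨x, hx, hgx⟩ := hg t₁
    have h5 := ht₁ x hx
    have h6 := ht₂ x hx
    rw [LinearMap.neg_apply] at h6
    refine hgx (le_antisymm h5 ?_)
    rw [← heq]
    linarith
  have hT : T₁ ≠ T₂ := by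
    rintro rfl
    have := ((hmem₂ w₁).1 hw₁).2
    rw [LinearMap.neg_apply] at this
    nlinarith
  refine ⟨T₁, T₂, hT, hT₁, hT₂, hMT₁, hMT₂, hd₁, hd₂, fun F hF hMF hdF => ?_⟩
  -- Two faces of dimension dim M + 1 that share a vector outside M coincide: their intersection is
  -- strictly larger than M, so it has the dimension of both.
  have hface : ∀ T : PointedCone K W, T.IsFaceOf C → coneDim T = coneDim M + 1 → ∀ w ∈ T, w ∉ M →
      w ∈ F → M ≤ T → F = T := by
    intro T hT hd w hw hwM hwF hMT
    have hin := hF.inf_left hT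
    have hlt : coneDim M < coneDim (F ⊓ T) := by
      refine ((hM.isFaceOf_iff_le hin).2 (le_inf hMF hMT)).coneDim_lt ?_
      intro h
      exact hwM (h ▸ ⟨hwF, hw⟩ : w ∈ M)
    have e1 := ((hin.isFaceOf_iff_le hF).2 inf_le_left).eq_of_coneDim_le (by omega)
    have e2 := ((hin.isFaceOf_iff_le hT).2 inf_le_right).eq_of_coneDim_le (by omega)
    rw [← e1, e2]
  obtain ⟨w, hw, hwM⟩ := hex F hMF hdF
  -- The vectors w₁ and w₂ complete span M to span C: w₁ is not in span M, and g - t₁ l kills span M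
  -- and w₁ but not w₂.
  have hspan : coneSpan C ≤ coneSpan M ⊔ (K ∙ w₁) ⊔ (K ∙ w₂) := by
    have hle : coneSpan M ⊔ (K ∙ w₁) ⊔ (K ∙ w₂) ≤ coneSpan C := by
      refine sup_le (sup_le (coneSpan_mono hM.le) ?_) ?_
      · rw [Submodule.span_singleton_le_iff_mem]; exact mem_coneSpan (hT₁.le hw₁)
      · rw [Submodule.span_singleton_le_iff_mem]; exact mem_coneSpan (hT₂.le hw₂)
    have l1 : coneSpan M < coneSpan M ⊔ (K ∙ w₁) := by
      refine lt_of_le_of_ne le_sup_left fun h => hw₁M ?_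
      refine hM.mem_of_mem_coneSpan (hT₁.le hw₁) ?_
      rw [h]
      exact Submodule.mem_sup_right (Submodule.mem_span_singleton_self _)
    have l2 : coneSpan M ⊔ (K ∙ w₁) < coneSpan M ⊔ (K ∙ w₁) ⊔ (K ∙ w₂) := by
      refine lt_of_le_of_ne le_sup_left fun h => ?_
      have hmem : w₂ ∈ coneSpan M ⊔ (K ∙ w₁) := by
        rw [h]
        exact Submodule.mem_sup_right (Submodule.mem_span_singleton_self _)
      have hker : coneSpan M ⊔ (K ∙ w₁) ≤ LinearMap.ker (g - t₁ • l) := by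
        refine sup_le (Submodule.span_le.2 fun x hx => ?_) ?_
        · simp [hgM x hx, hlM x hx]
        · rw [Submodule.span_singleton_le_iff_mem]
          simp [hg₁]
      have := hker hmem
      rw [LinearMap.mem_ker, LinearMap.sub_apply, LinearMap.smul_apply, smul_eq_mul] at this
      nlinarith
    have f1 := Submodule.finrank_lt_finrank_of_lt l1
    have f2 := Submodule.finrank_lt_finrank_of_lt l2
    refine (Submodule.eq_of_le_of_finrank_le hle ?_).ge
    unfold coneDim at hdim
    omega
  obtain ⟨y, hy, z, hz, hyz⟩ := Submodule.mem_sup.1 (hspan (mem_coneSpan (hF.le hw)))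
  obtain ⟨r, hr, z', hz', rfl⟩ := Submodule.mem_sup.1 hy
  obtain ⟨a, rfl⟩ := Submodule.mem_span_singleton.1 hz'
  obtain ⟨b, rfl⟩ := Submodule.mem_span_singleton.1 hz
  obtain ⟨r₁, hr₁, r₂, hr₂, rfl⟩ := exists_sub_of_mem_coneSpan hr
  have hlsum : l w = a * l w₁ + b * l w₂ := by
    rw [← hyz]; simp [hlM r₁ hr₁, hlM r₂ hr₂]
  have hgsum : g w = a * (t₁ * l w₁) - b * (t₂ * l w₂) := by
    have : g w₂ = - (t₂ * l w₂) := by linarith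
    rw [← hyz]; simp [hgM r₁ hr₁, hgM r₂ hr₂, hg₁, this, sub_eq_add_neg]
  -- The ratio at w lies between -t₂ and t₁; this forces both coefficients to be nonnegative.
  have ha : 0 ≤ a := by
    have h6 := ht₂ w (hF.le hw)
    rw [LinearMap.neg_apply, hgsum, hlsum] at h6
    by_contra! hcon
    have := mul_pos (neg_pos.2 hcon) (mul_pos (by linarith : 0 < t₁ + t₂) hlw₁)
    nlinarith
  have hb : 0 ≤ b := by
    have h6 := ht₁ w (hF.le hw)
    rw [hgsum, hlsum] at h6
    by_contra! hcon
    have := mul_pos (neg_pos.2 hcon) (mul_pos (by linarith : 0 < t₁ + t₂) hlw₂)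
    nlinarith
  -- Adding r₂ turns w into a sum of elements of C, so a summand with positive coefficient, w₁ or
  -- w₂, belongs to F.
  have hin : a • w₁ + b • w₂ + r₁ ∈ F := by
    have : a • w₁ + b • w₂ + r₁ = w + r₂ := by rw [← hyz]; abel
    rw [this]
    exact F.add_mem hw (hMF hr₂)
  have hwl := hlw w (hF.le hw) hwM
  have hw₁C := hT₁.le hw₁
  have hw₂C := hT₂.le hw₂
  rcases ha.eq_or_lt with ha | ha
  · have hb : 0 < b := by
      refine lt_of_le_of_ne hb fun h => ?_
      rw [hlsum, ← ha, ← h] at hwl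
      simp at hwl
    right
    refine hface T₂ hT₂ hd₂ w₂ hw₂ hw₂M ?_ hMT₂
    refine hF.mem_of_smul_add_mem hw₂C (hM.le hr₁) hb ?_
    simpa [← ha] using hin
  · left
    refine hface T₁ hT₁ hd₁ w₁ hw₁ hw₁M ?_ hMT₁
    refine hF.mem_of_smul_add_mem hw₁C (y := b • w₂ + r₁)
      (C.add_mem (PointedCone.smul_mem _ hb hw₂C) (hM.le hr₁)) ha ?_
    rw [← add_assoc]
    exact hin

end PointedCone

end ConeGeometry


/-! ### Acyclic sets of indices and fibrations -/

section Coboundary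

variable {K : Type*} [Field K] {I : Type*} [Fintype I]
variable {E : Type*} [AddCommGroup E] [Module K E]

/-- The differential on `E`-valued functions that is given by the matrix `e`. -/
def coboundary (e : I → I → K) : (I → E) →ₗ[K] (I → E) :=
  LinearMap.pi fun σ => ∑ τ, e τ σ • LinearMap.proj τ

theorem coboundary_apply (e : I → I → K) (x : I → E) (σ : I) :
    coboundary e x σ = ∑ τ, e τ σ • x τ := by
  simp [coboundary]

theorem coboundary_congr {e : I → I → K} {x y : I → E} {σ : I}
    (h : ∀ τ, e τ σ ≠ 0 → x τ = y τ) : coboundary e x σ = coboundary e y σ := by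
  rw [coboundary_apply, coboundary_apply]
  refine Finset.sum_congr rfl fun τ _ => ?_
  by_cases h0 : e τ σ = 0
  · rw [h0, zero_smul, zero_smul]
  · rw [h τ h0]

theorem coboundary_eq_zero {e : I → I → K} {x : I → E} {σ : I}
    (h : ∀ τ, e τ σ ≠ 0 → x τ = 0) : coboundary e x σ = 0 :=
  (coboundary_congr (y := 0) h).trans (by rw [map_zero]; rfl)

theorem coboundary_comp_map {E' : Type*} [AddCommGroup E'] [Module K E'] (e : I → I → K)
    (f : E →ₗ[K] E') (x : I → E) (σ : I) :
    f (coboundary e x σ) = coboundary e (fun τ => f (x τ)) σ := by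
  simp [coboundary_apply, map_sum]

variable (E) in
/-- The complex of functions supported in `S` is exact. -/
def AcyclicOn (e : I → I → K) (S : Set I) : Prop :=
  ∀ x : I → E, (∀ σ, σ ∉ S → x σ = 0) → (∀ σ ∈ S, coboundary e x σ = 0) →
    ∃ y : I → E, (∀ σ, σ ∉ S → y σ = 0) ∧ ∀ σ ∈ S, coboundary e y σ = x σ

/-- If the fibres of an order preserving map are acyclic, then so is its domain. -/
theorem AcyclicOn.of_fibres [PartialOrder I] {Q : Type*} [PartialOrder Q] {e : I → I → K}
    (hle : ∀ τ σ, e τ σ ≠ 0 → τ ≤ σ)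
    (hdd : ∀ (x : I → E), coboundary e (coboundary e x) = 0) (π : I → Q) (S : Set I)
    (hS : S.OrdConnected) (hπ : ∀ τ ∈ S, ∀ σ ∈ S, τ ≤ σ → π τ ≤ π σ)
    (hfib : ∀ q ∈ π '' S, AcyclicOn E e {σ | σ ∈ S ∧ π σ = q}) : AcyclicOn E e S := by
  classical
  induction hn : S.ncard using Nat.strong_induction_on generalizing S with
  | _ n ih =>
  subst hn
  rcases S.eq_empty_or_nonempty with rfl | hne
  · exact fun x hx _ => ⟨0, fun _ _ => rfl, fun σ hσ => absurd hσ (Set.notMem_empty σ)⟩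
  -- Split off the fibre over a maximal value q; the rest A is acyclic by induction on the number of
  -- elements.
  obtain ⟨q, hq⟩ := (S.toFinite.image π).exists_maximal (hne.image π)
  have hmax : ∀ σ ∈ S, q ≤ π σ → π σ = q := fun σ hσ h =>
    le_antisymm (hq.2 ⟨σ, hσ, rfl⟩ h) h
  set A : Set I := {σ | σ ∈ S ∧ π σ ≠ q} with hA
  have hAS : A ⊆ S := fun σ hσ => hσ.1
  have hacA : AcyclicOn E e A := by
    refine ih A.ncard ?_ A ?_ (fun τ hτ σ hσ => hπ τ (hAS hτ) σ (hAS hσ)) ?_ rfl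
    · refine Set.ncard_lt_ncard (hAS.ssubset_of_ne fun h => ?_) S.toFinite
      obtain ⟨σ, hσ, hσq⟩ := hq.1
      exact (h ▸ hσ : σ ∈ A).2 hσq
    · refine ⟨fun τ hτ σ hσ ρ hρ => ?_⟩
      have hρS := hS.out (hAS hτ) (hAS hσ) hρ
      exact ⟨hρS, fun h => hσ.2 (hmax σ hσ.1 (h ▸ hπ ρ hρS σ hσ.1 hρ.2))⟩
    · rintro _ ⟨σ₀, hσ₀, rfl⟩
      have : {σ | σ ∈ A ∧ π σ = π σ₀} = {σ | σ ∈ S ∧ π σ = π σ₀} := by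
        ext σ
        refine ⟨fun h => ⟨h.1.1, h.2⟩, fun h => ⟨⟨h.1, ?_⟩, h.2⟩⟩
        rw [h.2]
        exact hσ₀.2
      rw [this]
      exact hfib _ ⟨σ₀, hσ₀.1, rfl⟩
  have hacB := hfib q hq.1
  -- By maximality of q, no incidence leads from the fibre over q into A: functions on the fibre
  -- form a subcomplex with quotient A. So the equation is solved on A first and the error is then
  -- corrected on the fibre.
  have hBA : ∀ τ σ, τ ∈ S → π τ = q → σ ∈ A → e τ σ = 0 := by
    intro τ σ hτ hτq hσ
    by_contra hne
    exact hσ.2 (hmax σ hσ.1 (hτq ▸ hπ τ hτ σ hσ.1 (hle _ _ hne)))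
  intro x hx hdx
  obtain ⟨a, ha, hda⟩ := hacA (fun σ => if σ ∈ A then x σ else 0)
    (fun σ hσ => if_neg hσ) (fun σ hσ => by
      refine (coboundary_congr fun τ hτ => ?_).trans (hdx σ hσ.1)
      by_cases hτA : τ ∈ A
      · exact if_pos hτA
      · rw [if_neg hτA]
        by_cases hτS : τ ∈ S
        · exact absurd (hBA τ σ hτS (not_not.1 fun h => hτA ⟨hτS, h⟩) hσ) hτ
        · exact (hx τ hτS).symm)
  have hda' : ∀ σ ∈ A, coboundary e a σ = x σ := fun σ hσ => (hda σ hσ).trans (if_pos hσ)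
  obtain ⟨b, hb, hdb⟩ := hacB
    (fun σ => if σ ∈ S ∧ π σ = q then x σ - coboundary e a σ else 0)
    (fun σ hσ => if_neg hσ) (fun σ hσ => by
      have h1 : coboundary e (x - coboundary e a) σ = 0 := by
        rw [map_sub, hdd, sub_zero]
        exact hdx σ hσ.1
      refine (coboundary_congr fun ρ hρ => ?_).trans h1
      split_ifs with h
      · rfl
      · rw [Pi.sub_apply]
        by_cases hρS : ρ ∈ S
        · rw [hda' ρ ⟨hρS, fun h' => h ⟨hρS, h'⟩⟩, sub_self]
        -- A nonzero contribution to da at ρ would place ρ between two elements of S, hence in S.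
        · rw [hx ρ hρS, coboundary_eq_zero, sub_self]
          intro τ hτ
          by_contra hne
          have hτA : τ ∈ A := by
            by_contra h'
            exact hne (ha τ h')
          exact hρS (hS.out hτA.1 hσ.1 ⟨hle _ _ hτ, hle _ _ hρ⟩))
  refine ⟨a + b, fun σ hσ => ?_, fun σ hσ => ?_⟩
  · rw [Pi.add_apply, ha σ fun h => hσ h.1, hb σ fun h => hσ h.1, add_zero]
  · rw [map_add, Pi.add_apply]
    by_cases hσq : π σ = q
    · rw [hdb σ ⟨hσ, hσq⟩, if_pos ⟨hσ, hσq⟩]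
      abel
    · rw [hda' σ ⟨hσ, hσq⟩, coboundary_eq_zero, add_zero]
      intro τ hτ
      by_contra hne
      have hτB : τ ∈ S ∧ π τ = q := by
        by_contra h'
        exact hne (hb τ h')
      exact hτ (hBA τ σ hτB.1 hτB.2 ⟨hσ, hσq⟩)

end Coboundary

/-! ### Acyclicity of complexes of faces -/

section FaceComplex

variable {K : Type*} [Field K] [LinearOrder K] [IsStrictOrderedRing K]
variable {W : Type*} [AddCommGroup W] [Module K W]
variable {C : PointedCone K W}

/-- A matrix of incidence numbers on the faces of a cone. -/
structure IsIncidenceMatrix [Fintype {F : PointedCone K W // F.IsFaceOf C}]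
    (e : {F : PointedCone K W // F.IsFaceOf C} → {F : PointedCone K W // F.IsFaceOf C} → K) :
    Prop where
  le : ∀ τ σ, e τ σ ≠ 0 → τ ≤ σ
  coneDim_eq : ∀ τ σ, e τ σ ≠ 0 → coneDim σ.1 = coneDim τ.1 + 1
  ne_zero : ∀ τ σ, τ ≤ σ → coneDim σ.1 = coneDim τ.1 + 1 → e τ σ ≠ 0
  sum_mul : ∀ τ σ, ∑ ρ, e τ ρ * e ρ σ = 0

namespace IsIncidenceMatrix

variable [Fintype {F : PointedCone K W // F.IsFaceOf C}]
variable {e : {F : PointedCone K W // F.IsFaceOf C} → {F : PointedCone K W // F.IsFaceOf C} → K}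
variable {E : Type*} [AddCommGroup E] [Module K E]

theorem coboundary_coboundary (he : IsIncidenceMatrix e)
    (x : {F : PointedCone K W // F.IsFaceOf C} → E) : coboundary e (coboundary e x) = 0 := by
  funext σ
  simp only [coboundary_apply, Finset.smul_sum, smul_smul]
  rw [Finset.sum_comm]
  refine Finset.sum_eq_zero fun τ _ => ?_
  rw [← Finset.sum_smul]
  simp_rw [mul_comm (e _ σ)]
  rw [he.sum_mul, zero_smul]

/-- An interval that consists of two faces is acyclic. -/
theorem acyclicOn_pair (he : IsIncidenceMatrix e) {M N : {F : PointedCone K W // F.IsFaceOf C}}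
    (hMN : M ≤ N) (hd : coneDim N.1 = coneDim M.1 + 1) : AcyclicOn E e {M, N} := by
  classical
  have hne : M ≠ N := by
    rintro rfl
    omega
  have h0 : ∀ τ, e τ τ = 0 := by
    intro τ
    by_contra h
    have := he.coneDim_eq τ τ h
    omega
  have hu := he.ne_zero M N hMN hd
  intro x hx hdx
  have hxM : x M = 0 := by
    have h1 := hdx N (by simp)
    rw [coboundary_apply, Finset.sum_eq_single M] at h1
    · exact (smul_eq_zero.1 h1).resolve_left hu
    · intro τ _ hτ
      by_cases hτN : τ = N
      · rw [hτN, h0, zero_smul]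
      · rw [hx τ (by simp [hτ, hτN]), smul_zero]
    · simp
  refine ⟨fun τ => if τ = M then (e M N)⁻¹ • x N else 0, fun σ hσ => ?_, fun σ hσ => ?_⟩
  · exact if_neg fun h => hσ (by simp [h])
  · rw [coboundary_apply, Finset.sum_eq_single M]
    · rw [if_pos rfl]
      rcases hσ with rfl | rfl
      · rw [h0, zero_smul, hxM]
      · rw [smul_smul, mul_inv_cancel₀ hu, one_smul]
    · intro τ _ hτ
      rw [if_neg hτ, smul_zero]
    · simp

variable [FiniteDimensional K W]

/-- The inductive step when h is not proportional on N to the form l that exposes M. A face F is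
sorted by the maximum t of h / l on F and by the face T of F where it is attained. Let b be the
minimum of h / l on N. The faces with t = b form, together with M, the interval from M to the face B
of N given by h = b l. For t > b, the fibre consists of the faces from T to N on which h - t l is
negative off T. Both are of the same shape with a smaller difference of dimensions, because B ≠ N
and T ≠ M. -/
theorem acyclicOn_neg_aux (he : IsIncidenceMatrix e) (hC : C.FG) (n : ℕ)
    (ih : ∀ m < n, ∀ (M N : {F : PointedCone K W // F.IsFaceOf C}) (h : Dual K W), M ≤ N →
      (∀ x ∈ M.1, h x = 0) → (∃ x ∈ N.1, h x < 0) → coneDim N.1 = coneDim M.1 + m →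
      AcyclicOn E e {F | M ≤ F ∧ F ≤ N ∧ ∀ x ∈ F.1, x ∉ M.1 → h x < 0})
    (M N : {F : PointedCone K W // F.IsFaceOf C}) (l h : Dual K W)
    (hl0 : ∀ x ∈ C, 0 ≤ l x) (hl : ∀ x ∈ C, l x = 0 ↔ x ∈ M.1) (hMN : M ≤ N)
    (hM : ∀ x ∈ M.1, h x = 0) (hneg : ∃ x ∈ N.1, h x < 0) (hd : coneDim N.1 = coneDim M.1 + n)
    (hprop : ∀ c : K, ∃ x ∈ N.1, h x ≠ c * l x) :
    AcyclicOn E e {F | M ≤ F ∧ F ≤ N ∧ ∀ x ∈ F.1, x ∉ M.1 → h x < 0} := by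
  classical
  set S : Set {F : PointedCone K W // F.IsFaceOf C} :=
    {F | M ≤ F ∧ F ≤ N ∧ ∀ x ∈ F.1, x ∉ M.1 → h x < 0} with hS
  have hlM : ∀ x ∈ M.1, l x = 0 := fun x hx => (hl x (M.2.le hx)).2 hx
  have hlpos : ∀ x ∈ C, x ∉ M.1 → 0 < l x := fun x hx hxM =>
    lt_of_le_of_ne (hl0 x hx) fun h' => hxM ((hl x hx).1 h'.symm)
  have hnotM : ∀ x, 0 < l x → x ∉ M.1 := fun x hx hxM => hx.ne' (hlM x hxM)
  have hlh : ∀ F : {F : PointedCone K W // F.IsFaceOf C}, ∀ x ∈ F.1, l x = 0 → h x = 0 :=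
    fun F x hx h0 => hM x ((hl x (F.2.le hx)).1 h0)
  have ht : ∀ F : {F : PointedCone K W // F.IsFaceOf C}, ∃ t : K, M ≤ F → F ≠ M →
      (∀ x ∈ F.1, h x ≤ t * l x) ∧ ∃ x ∈ F.1, 0 < l x ∧ h x = t * l x := by
    intro F
    by_cases hF : M ≤ F ∧ F ≠ M
    · have hex : ∃ x ∈ F.1, 0 < l x := by
        by_contra! hcon
        refine hF.2 (le_antisymm (fun x hx => ?_) hF.1)
        exact (hl x (F.2.le hx)).1 (le_antisymm (hcon x hx) (hl0 x (F.2.le hx)))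
      obtain ⟨t, ht⟩ := PointedCone.exists_max_ratio (F.2.fg hC) l h (fun x hx => hl0 x (F.2.le hx))
        (hlh F) hex
      exact ⟨t, fun _ _ => ht⟩
    · exact ⟨0, fun h1 h2 => absurd ⟨h1, h2⟩ hF⟩
  choose t ht using ht
  -- the minimum
  obtain ⟨x₀, hx₀N, hx₀⟩ := hneg
  have hlx₀ : 0 < l x₀ := hlpos x₀ (N.2.le hx₀N) fun h' => hx₀.ne (hM x₀ h')
  obtain ⟨s, hs, xb, hxbN, hlxb, hxb⟩ := PointedCone.exists_max_ratio (N.2.fg hC) l (-h)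
    (fun x hx => hl0 x (N.2.le hx)) (fun x hx h0 => by simp [hlh N x hx h0]) ⟨x₀, hx₀N, hlx₀⟩
  obtain ⟨b, rfl⟩ : ∃ b : K, s = -b := ⟨-s, by simp⟩
  have hb : ∀ x ∈ N.1, b * l x ≤ h x := fun x hx => by
    have := hs x hx
    rw [LinearMap.neg_apply] at this
    linarith
  have hxb : h xb = b * l xb := by
    rw [LinearMap.neg_apply] at hxb
    linarith
  have hb0 : b < 0 := by
    by_contra! hcon
    have := hb x₀ hx₀N
    have := mul_nonneg hcon hlx₀.le
    linarith
  have hBface : (N.1.zeros (h - b • l)).IsFaceOf N.1 := PointedCone.zeros_isFaceOf fun x hx => by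
    simpa using hb x hx
  have hBmem : ∀ x, x ∈ N.1.zeros (h - b • l) ↔ x ∈ N.1 ∧ h x = b * l x := fun x => by
    rw [PointedCone.mem_zeros, LinearMap.sub_apply, LinearMap.smul_apply, smul_eq_mul, sub_eq_zero]
  have hMB : M.1 ≤ N.1.zeros (h - b • l) := fun x hx =>
    (hBmem x).2 ⟨hMN hx, by rw [hM x hx, hlM x hx, mul_zero]⟩
  have hBN : coneDim (N.1.zeros (h - b • l)) < coneDim N.1 := hBface.coneDim_lt fun heq => by
    obtain ⟨x, hx, hne⟩ := hprop b
    have hx' : x ∈ N.1.zeros (h - b • l) := by rw [heq]; exact hx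
    exact hne ((hBmem x).1 hx').2
  -- the top faces
  have htop : ∀ F : {F : PointedCone K W // F.IsFaceOf C}, ∀ x,
      x ∈ F.1.zeros (t F • l - h) ↔ x ∈ F.1 ∧ h x = t F * l x := fun F x => by
    rw [PointedCone.mem_zeros, LinearMap.sub_apply, LinearMap.smul_apply, smul_eq_mul, sub_eq_zero,
      eq_comm (a := t F * l x)]
  have htb : ∀ F ∈ S, F ≠ M → b ≤ t F := by
    intro F hF hFM
    obtain ⟨-, x, hx, hlx, hhx⟩ := ht F hF.1 hFM
    have := hb x (hF.2.1 hx)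
    rw [hhx] at this
    exact le_of_mul_le_mul_right this hlx
  -- The face M has no ratio; it joins the faces on which the ratio is constantly b. The
  -- lexicographic order makes π monotone: at equal maxima, a larger face has a larger top face.
  let π : {F : PointedCone K W // F.IsFaceOf C} → K ×ₗ PointedCone K W := fun F =>
    if F = M ∨ t F = b then toLex (b, ⊥) else toLex (t F, F.1.zeros (t F • l - h))
  have hπ1 : ∀ F, (F = M ∨ t F = b) → π F = toLex (b, ⊥) := fun F hF => if_pos hF
  have hπ2 : ∀ F, ¬ (F = M ∨ t F = b) → π F = toLex (t F, F.1.zeros (t F • l - h)) :=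
    fun F hF => if_neg hF
  refine AcyclicOn.of_fibres he.le he.coboundary_coboundary π S ?_ ?_ ?_
  · refine ⟨fun τ hτ σ hσ ρ hρ => ⟨hτ.1.trans hρ.1, hρ.2.trans hσ.2.1, fun x hx => ?_⟩⟩
    exact hσ.2.2 x (hρ.2 hx)
  · intro τ hτ σ hσ hle
    by_cases h1 : τ = M ∨ t τ = b
    · rw [hπ1 τ h1]
      by_cases h2 : σ = M ∨ t σ = b
      · rw [hπ1 σ h2]
      · rw [hπ2 σ h2, Prod.Lex.toLex_le_toLex]
        rw [not_or] at h2
        exact Or.inl (lt_of_le_of_ne (htb σ hσ h2.1) (Ne.symm h2.2))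
    · have h1' := not_or.1 h1
      have hσM : σ ≠ M := by
        rintro rfl
        exact h1'.1 (le_antisymm hle hτ.1)
      obtain ⟨-, x, hx, hlx, hhx⟩ := ht τ hτ.1 h1'.1
      have hts : t τ ≤ t σ := by
        have := (ht σ hσ.1 hσM).1 x (hle hx)
        rw [hhx] at this
        exact le_of_mul_le_mul_right this hlx
      have h2 : ¬ (σ = M ∨ t σ = b) := by
        rintro (h | h)
        · exact hσM h
        · exact h1'.2 (le_antisymm (h ▸ hts) (htb τ hτ h1'.1))
      rw [hπ2 τ h1, hπ2 σ h2, Prod.Lex.toLex_le_toLex]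
      rcases hts.lt_or_eq with h3 | h3
      · exact Or.inl h3
      · refine Or.inr ⟨h3, fun y hy => ?_⟩
        obtain ⟨hy1, hy2⟩ := (htop τ y).1 hy
        exact (htop σ y).2 ⟨hle hy1, h3 ▸ hy2⟩
  · rintro _ ⟨F₀, hF₀, rfl⟩
    by_cases h0 : F₀ = M ∨ t F₀ = b
    · have hset : {σ | σ ∈ S ∧ π σ = π F₀} = {F | M ≤ F ∧
          F ≤ (⟨_, hBface.trans N.2⟩ : {F : PointedCone K W // F.IsFaceOf C}) ∧
          ∀ x ∈ F.1, x ∉ M.1 → (-l) x < 0} := by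
        ext F
        rw [hπ1 F₀ h0]
        constructor
        · rintro ⟨hF, hFq⟩
          have hFb : F = M ∨ t F = b := by
            by_contra hcon
            rw [hπ2 F hcon] at hFq
            exact (not_or.1 hcon).2 (congrArg (fun p => (ofLex p).1) hFq)
          refine ⟨hF.1, ?_, fun x hx hxM => ?_⟩
          · by_cases hFM : F = M
            · rw [hFM]
              exact hMB
            · intro x hx
              refine (hBmem x).2 ⟨hF.2.1 hx, le_antisymm ?_ (hb x (hF.2.1 hx))⟩
              have := (ht F hF.1 hFM).1 x hx
              rwa [hFb.resolve_left hFM] at this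
          · simpa using hlpos x (F.2.le hx) hxM
        · rintro ⟨hMF, hFB, -⟩
          have hFN : F ≤ N := fun x hx => ((hBmem x).1 (hFB hx)).1
          refine ⟨⟨hMF, hFN, fun x hx hxM => ?_⟩, ?_⟩
          · rw [((hBmem x).1 (hFB hx)).2]
            exact mul_neg_of_neg_of_pos hb0 (hlpos x (F.2.le hx) hxM)
          · refine hπ1 F ?_
            by_cases hFM : F = M
            · exact Or.inl hFM
            · obtain ⟨-, x, hx, hlx, hhx⟩ := ht F hMF hFM
              rw [((hBmem x).1 (hFB hx)).2] at hhx
              exact Or.inr (mul_right_cancel₀ hlx.ne' hhx).symm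
      rw [hset]
      have hdB := PointedCone.coneDim_mono hMB
      refine ih (coneDim (N.1.zeros (h - b • l)) - coneDim M.1) (by omega) M _ (-l) hMB
        (fun x hx => by simp [hlM x hx]) ⟨xb, (hBmem xb).2 ⟨hxbN, hxb⟩, by simpa using hlxb⟩ ?_
      simp only
      omega
    · have h0' := not_or.1 h0
      obtain ⟨hmaxF₀, y, hyF₀, hly, hhy⟩ := ht F₀ hF₀.1 h0'.1
      have htF₀ : t F₀ < 0 := by
        have := hF₀.2.2 y hyF₀ (hnotM y hly)
        rw [hhy] at this
        by_contra! hcon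
        exact absurd this (not_lt.2 (mul_nonneg hcon hly.le))
      have hTface : (F₀.1.zeros (t F₀ • l - h)).IsFaceOf F₀.1 :=
        PointedCone.zeros_isFaceOf fun x hx => by simpa using hmaxF₀ x hx
      have hyT : y ∈ F₀.1.zeros (t F₀ • l - h) := (htop F₀ y).2 ⟨hyF₀, hhy⟩
      have hMT : M.1 ≤ F₀.1.zeros (t F₀ • l - h) := fun x hx =>
        (htop F₀ x).2 ⟨hF₀.1 hx, by rw [hM x hx, hlM x hx, mul_zero]⟩
      have hTN : F₀.1.zeros (t F₀ • l - h) ≤ N.1 := hTface.le.trans hF₀.2.1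
      have hset : {σ | σ ∈ S ∧ π σ = π F₀} = {F |
          (⟨_, hTface.trans F₀.2⟩ : {F : PointedCone K W // F.IsFaceOf C}) ≤ F ∧ F ≤ N ∧
          ∀ x ∈ F.1, x ∉ F₀.1.zeros (t F₀ • l - h) → (h - t F₀ • l) x < 0} := by
        ext F
        rw [hπ2 F₀ h0]
        constructor
        · rintro ⟨hF, hFq⟩
          have hFb : ¬ (F = M ∨ t F = b) := by
            intro hcon
            rw [hπ1 F hcon] at hFq
            exact h0'.2 (congrArg (fun p => (ofLex p).1) hFq).symm
          rw [hπ2 F hFb] at hFq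
          have e1 : t F = t F₀ := congrArg (fun p => (ofLex p).1) hFq
          have e2 : F.1.zeros (t F • l - h) = F₀.1.zeros (t F₀ • l - h) :=
            congrArg (fun p => (ofLex p).2) hFq
          refine ⟨?_, hF.2.1, fun x hx hxT => ?_⟩
          · change F₀.1.zeros (t F₀ • l - h) ≤ F.1
            rw [← e2]
            exact fun x hx => hx.1
          · have h3 := (ht F hF.1 (not_or.1 hFb).1).1 x hx
            rw [LinearMap.sub_apply, LinearMap.smul_apply, smul_eq_mul, sub_neg, ← e1]
            refine lt_of_le_of_ne h3 fun h4 => hxT ?_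
            rw [← e2]
            exact (htop F x).2 ⟨hx, h4⟩
        · rintro ⟨hTF, hFN, hlt⟩
          have hTF : F₀.1.zeros (t F₀ • l - h) ≤ F.1 := hTF
          have hMF : M ≤ F := hMT.trans hTF
          have hlt' : ∀ x ∈ F.1, x ∉ F₀.1.zeros (t F₀ • l - h) → h x < t F₀ * l x := by
            intro x hx hxT
            have := hlt x hx hxT
            rwa [LinearMap.sub_apply, LinearMap.smul_apply, smul_eq_mul, sub_neg] at this
          have hle' : ∀ x ∈ F.1, h x ≤ t F₀ * l x := by
            intro x hx
            by_cases hxT : x ∈ F₀.1.zeros (t F₀ • l - h)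
            · exact ((htop F₀ x).1 hxT).2.le
            · exact (hlt' x hx hxT).le
          have hFM : F ≠ M := by
            rintro rfl
            exact hnotM y hly (hTF hyT)
          have e1 : t F = t F₀ := by
            obtain ⟨h1, x, hx, hlx, hhx⟩ := ht F hMF hFM
            refine le_antisymm ?_ ?_
            · have := hle' x hx
              rw [hhx] at this
              exact le_of_mul_le_mul_right this hlx
            · have := h1 y (hTF hyT)
              rw [hhy] at this
              exact le_of_mul_le_mul_right this hly
          refine ⟨⟨hMF, hFN, fun x hx hxM => ?_⟩, ?_⟩
          · have hlx := hlpos x (F.2.le hx) hxM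
            exact (hle' x hx).trans_lt (mul_neg_of_neg_of_pos htF₀ hlx)
          · rw [hπ2 F (not_or.2 ⟨hFM, e1 ▸ h0'.2⟩)]
            congr 2
            ext x
            rw [htop F x, e1]
            constructor
            · rintro ⟨hx, hhx⟩
              by_contra hxT
              exact (hlt' x hx hxT).ne hhx
            · intro hxT
              exact ⟨hTF hxT, ((htop F₀ x).1 hxT).2⟩
      rw [hset]
      have hTlt : coneDim M.1 < coneDim (F₀.1.zeros (t F₀ • l - h)) := by
        refine ((M.2.isFaceOf_iff_le (hTface.trans F₀.2)).2 hMT).coneDim_lt fun heq => ?_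
        exact hnotM y hly (heq ▸ hyT)
      have hTN' := PointedCone.coneDim_mono hTN
      refine ih (coneDim N.1 - coneDim (F₀.1.zeros (t F₀ • l - h))) (by omega) ⟨_, hTface.trans F₀.2⟩
        N (h - t F₀ • l) hTN (fun x hx => ?_) ⟨xb, hxbN, ?_⟩ ?_
      · rw [LinearMap.sub_apply, LinearMap.smul_apply, smul_eq_mul, ((htop F₀ x).1 hx).2, sub_self]
      -- The point where the ratio takes its minimum b < t F₀ shows that the new form is negative
      -- somewhere on N.
      · rw [LinearMap.sub_apply, LinearMap.smul_apply, smul_eq_mul, hxb, ← sub_mul]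
        refine mul_neg_of_neg_of_pos (sub_neg.2 ?_) hlxb
        exact lt_of_le_of_ne (htb F₀ hF₀ h0'.1) (Ne.symm h0'.2)
      · simp only
        omega

/-- The complex of the faces between `M` and `N` on which a linear form is negative off `M`. -/
theorem acyclicOn_neg (he : IsIncidenceMatrix e) (hC : C.FG)
    (M N : {F : PointedCone K W // F.IsFaceOf C}) (h : Dual K W) (hMN : M ≤ N)
    (hM : ∀ x ∈ M.1, h x = 0) (hneg : ∃ x ∈ N.1, h x < 0) :
    AcyclicOn E e {F | M ≤ F ∧ F ≤ N ∧ ∀ x ∈ F.1, x ∉ M.1 → h x < 0} := by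
  have hd : coneDim N.1 = coneDim M.1 + (coneDim N.1 - coneDim M.1) := by
    have := PointedCone.coneDim_mono (show M.1 ≤ N.1 from hMN)
    omega
  generalize coneDim N.1 - coneDim M.1 = n at hd
  induction n using Nat.strong_induction_on generalizing M N h with
  | _ n ih =>
  obtain ⟨x₀, hx₀N, hx₀⟩ := hneg
  have hx₀M : x₀ ∉ M.1 := fun h' => hx₀.ne (hM x₀ h')
  have hMNf : M.1.IsFaceOf N.1 := (M.2.isFaceOf_iff_le N.2).2 hMN
  have hn : 0 < n := by
    have := hMNf.coneDim_lt fun heq => hx₀M (heq ▸ hx₀N)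
    omega
  obtain ⟨l, hl0, hl⟩ := M.2.exists_exposing hC
  have hlM : ∀ x ∈ M.1, l x = 0 := fun x hx => (hl x (M.2.le hx)).2 hx
  have hlpos : ∀ x ∈ C, x ∉ M.1 → 0 < l x := fun x hx hxM =>
    lt_of_le_of_ne (hl0 x hx) fun h' => hxM ((hl x hx).1 h'.symm)
  have hlx₀ := hlpos x₀ (N.2.le hx₀N) hx₀M
  by_cases hprop : ∀ c : K, ∃ x ∈ N.1, h x ≠ c * l x
  · exact he.acyclicOn_neg_aux hC n (fun m hm M N h hMN hM hneg hd => ih m hm M N h hMN hM hneg hd)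
      M N l h hl0 hl hMN hM ⟨x₀, hx₀N, hx₀⟩ hd hprop
  -- Here h = c l on N with c < 0, so the set in question is the whole interval from M to N and does
  -- not depend on h.
  push Not at hprop
  obtain ⟨c, hc⟩ := hprop
  have hc0 : c < 0 := by
    rw [hc x₀ hx₀N] at hx₀
    by_contra! hcon
    exact absurd hx₀ (not_lt.2 (mul_nonneg hcon hlx₀.le))
  have hhneg : ∀ x ∈ N.1, x ∉ M.1 → h x < 0 := fun x hx hxM => by
    rw [hc x hx]
    exact mul_neg_of_neg_of_pos hc0 (hlpos x (N.2.le hx) hxM)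
  rcases (show n = 1 ∨ 2 ≤ n by omega) with rfl | hn2
  · have hset : {F : {F : PointedCone K W // F.IsFaceOf C} | M ≤ F ∧ F ≤ N ∧
        ∀ x ∈ F.1, x ∉ M.1 → h x < 0} = {M, N} := by
      ext F
      constructor
      · rintro ⟨hMF, hFN, -⟩
        have h1 := PointedCone.coneDim_mono (show M.1 ≤ F.1 from hMF)
        by_cases hdF : coneDim F.1 ≤ coneDim M.1
        · left
          exact Subtype.ext (((M.2.isFaceOf_iff_le F.2).2 hMF).eq_of_coneDim_le hdF).symm
        · right
          exact Subtype.ext (((F.2.isFaceOf_iff_le N.2).2 hFN).eq_of_coneDim_le (by omega))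
      · rintro (rfl | rfl)
        · exact ⟨le_rfl, hMN, fun x hx hx' => absurd hx hx'⟩
        · exact ⟨hMN, le_rfl, hhneg⟩
    rw [hset]
    exact he.acyclicOn_pair hMN hd
  -- Replace h by another form that is negative off M but not proportional to l: subtract from g
  -- more than its maximal ratio times l.
  · obtain ⟨g, hgM, hg⟩ := PointedCone.exists_not_proportional (C := N.1) (M := M.1) (l := l)
      (fun x hx => hl x (N.2.le hx)) (by omega)
    obtain ⟨t, ht, -⟩ := PointedCone.exists_max_ratio (N.2.fg hC) l g
      (fun x hx => hl0 x (N.2.le hx)) (fun x hx h0 => hgM x ((hl x (N.2.le hx)).1 h0))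
      ⟨x₀, hx₀N, hlx₀⟩
    have hg'neg : ∀ x ∈ N.1, x ∉ M.1 → (g - (t + 1) • l) x < 0 := fun x hx hxM => by
      have h1 := ht x hx
      have h2 := hlpos x (N.2.le hx) hxM
      rw [LinearMap.sub_apply, LinearMap.smul_apply, smul_eq_mul, add_mul]
      linarith
    have hset : {F : {F : PointedCone K W // F.IsFaceOf C} | M ≤ F ∧ F ≤ N ∧
        ∀ x ∈ F.1, x ∉ M.1 → h x < 0} = {F | M ≤ F ∧ F ≤ N ∧
        ∀ x ∈ F.1, x ∉ M.1 → (g - (t + 1) • l) x < 0} := by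
      ext F
      exact ⟨fun hF => ⟨hF.1, hF.2.1, fun x hx => hg'neg x (hF.2.1 hx)⟩,
        fun hF => ⟨hF.1, hF.2.1, fun x hx => hhneg x (hF.2.1 hx)⟩⟩
    rw [hset]
    refine he.acyclicOn_neg_aux hC n (fun m hm M N h hMN hM hneg hd => ih m hm M N h hMN hM hneg hd)
      M N l _ hl0 hl hMN (fun x hx => by simp [hgM x hx, hlM x hx]) ⟨x₀, hx₀N, hg'neg x₀ hx₀N hx₀M⟩
      hd fun c => ?_
    obtain ⟨x, hx, hne⟩ := hg (c + (t + 1))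
    refine ⟨x, hx, fun heq => hne ?_⟩
    rw [LinearMap.sub_apply, LinearMap.smul_apply, smul_eq_mul] at heq
    linarith

end IsIncidenceMatrix

end FaceComplex


/-! ### Volume forms expanded along a hyperplane -/

section Forms

variable {V : Type*}

/-- Adjoining a vector in front of a family of vectors. -/
def consCast {p q : ℕ} (h : p = q + 1) (w : V) (v : Fin q → V) : Fin p → V :=
  fun j => (Fin.cons w v : Fin (q + 1) → V) (Fin.cast h j)

theorem consCast_zero {p q : ℕ} (h : p = q + 1) (w : V) (v : Fin q → V) (j : Fin p)
    (hj : j.val = 0) : consCast h w v j = w := by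
  subst h
  obtain rfl : j = 0 := Fin.ext hj
  rfl

theorem consCast_succ {p q : ℕ} (h : p = q + 1) (w : V) (v : Fin q → V) (i : Fin q) (j : Fin p)
    (hj : j.val = i.val + 1) : consCast h w v j = v i := by
  subst h
  obtain rfl : j = i.succ := Fin.ext hj
  rfl

/-- Turns the indexwise conditions of `OrientationsAgree` into one equation. The relation p = q + 1
is a hypothesis because dimensions of cones satisfy it only propositionally. -/
theorem eq_consCast {p q : ℕ} (h : p = q + 1) {w : V} {v : Fin q → V} {v' : Fin p → V}
    (h0 : ∀ j : Fin p, j.val = 0 → v' j = w)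
    (h1 : ∀ (i : Fin q) (j : Fin p), j.val = i.val + 1 → v' j = v i) : v' = consCast h w v := by
  subst h
  funext j
  refine Fin.cases ?_ (fun i => ?_) j
  · exact h0 0 rfl
  · exact h1 i i.succ rfl

variable {K : Type*} [Field K] [AddCommGroup V] [Module K V]

theorem map_consCast_swap {p q r : ℕ} (h : p = q + 1) (h' : q = r + 1)
    (g : V [⋀^Fin p]→ₗ[K] K) (x y : V) (v : Fin r → V) :
    g (consCast h x (consCast h' y v)) = - g (consCast h y (consCast h' x v)) := by
  subst h' h
  have hne : (0 : Fin (r + 1 + 1)) ≠ 1 := by simp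
  rw [← g.map_swap _ hne]
  congr 1
  funext j
  refine Fin.cases ?_ (fun i => Fin.cases ?_ (fun k => ?_) i) j
  · simp [consCast, Equiv.swap_apply_left]
  · simp [consCast, Equiv.swap_apply_right]
  · have h1 : (k.succ.succ : Fin (r + 1 + 1)) ≠ 0 := by simp
    have h2 : (k.succ.succ : Fin (r + 1 + 1)) ≠ 1 := by
      rw [← Fin.succ_zero_eq_one, Ne, Fin.succ_inj]
      exact Fin.succ_ne_zero k
    simp [consCast, Equiv.swap_apply_of_ne_of_ne h1 h2]

/-- Expanding a volume form of `B` along a hyperplane `A` of `B`. -/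
theorem exists_facetFunctional [FiniteDimensional K V] {A B : Submodule K V} (hAB : A ≤ B)
    {p q : ℕ} (h : p = q + 1) (hA : finrank K A = q) (hB : finrank K B = p)
    {g : A [⋀^Fin q]→ₗ[K] K} (hg : g ≠ 0) {g' : B [⋀^Fin p]→ₗ[K] K} (hg' : g' ≠ 0) :
    ∃ l : B →ₗ[K] K,
      (∀ w v, g' (consCast h w (Submodule.inclusion hAB ∘ v)) = l w * g v) ∧
      ∀ w : B, l w = 0 ↔ (w : V) ∈ A := by
  subst h
  let b : Basis (Fin q) K A := finBasisOfFinrankEq K A hA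
  have hgb : g b ≠ 0 := (AlternatingMap.map_basis_ne_zero_iff b g).2 hg
  -- Contract g' with a fixed basis of A and normalise by g. For another family in A, both g and the
  -- contraction change by the same determinant.
  let l : B →ₗ[K] K :=
    { toFun := fun w => g'.curryLeft w (Submodule.inclusion hAB ∘ b) * (g b)⁻¹
      map_add' := fun x y => by simp [add_mul]
      map_smul' := fun c x => by simp [mul_assoc] }
  have hl : ∀ w v, g' (consCast rfl w (Submodule.inclusion hAB ∘ v)) = l w * g v := by
    intro w v
    have h1 : (g'.curryLeft w).compLinearMap (Submodule.inclusion hAB) v =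
        ((g'.curryLeft w).compLinearMap (Submodule.inclusion hAB) b) * b.det v := by
      conv_lhs => rw [AlternatingMap.eq_smul_basis_det b
        ((g'.curryLeft w).compLinearMap (Submodule.inclusion hAB))]
      rfl
    have h2 : g v = g b * b.det v := by
      conv_lhs => rw [AlternatingMap.eq_smul_basis_det b g]
      rfl
    change (g'.curryLeft w).compLinearMap (Submodule.inclusion hAB) v =
      g'.curryLeft w (Submodule.inclusion hAB ∘ b) * (g b)⁻¹ * g v
    rw [h1, h2]
    change g'.curryLeft w (Submodule.inclusion hAB ∘ b) * _ = _
    field_simp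
  refine ⟨l, hl, fun w => ?_⟩
  -- Both l w ≠ 0 and w ∉ A say that w together with a basis of A is independent.
  have hiff : LinearIndependent K (Fin.cons w (Submodule.inclusion hAB ∘ b) : Fin (q + 1) → B) ↔
      (w : V) ∉ A := by
    rw [linearIndependent_finCons]
    have h1 : LinearIndependent K (Submodule.inclusion hAB ∘ b) :=
      b.linearIndependent.map' _ (Submodule.ker_inclusion _ _ hAB)
    have h2 : Submodule.span K (Set.range (Submodule.inclusion hAB ∘ b)) = A.comap B.subtype := by
      rw [Set.range_comp, ← Submodule.map_span, b.span_eq, Submodule.map_top,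
        Submodule.range_inclusion]
    rw [h2]
    exact ⟨fun h => h.2, fun h => ⟨h1, h⟩⟩
  have hval : l w * g b = g' (Fin.cons w (Submodule.inclusion hAB ∘ b)) := (hl w b).symm
  constructor
  · intro h0
    by_contra hw
    have hli := hiff.2 hw
    let b' := basisOfLinearIndependentOfCardEqFinrank hli (by rw [hB, Fintype.card_fin])
    have : g' b' ≠ 0 := (AlternatingMap.map_basis_ne_zero_iff b' g').2 hg'
    rw [coe_basisOfLinearIndependentOfCardEqFinrank, ← hval, h0, zero_mul] at this
    exact this rfl
  · intro hw
    have := g'.map_linearDependent _ (fun h => hiff.1 h hw)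
    rw [← hval] at this
    exact (mul_eq_zero.1 this).resolve_right hgb

end Forms

/-! ### Incidence numbers in terms of volume forms -/

namespace Fan

variable {K : Type*} [Field K] [LinearOrder K] [IsStrictOrderedRing K]
variable {V : Type*} [AddCommGroup V] [Module K V]

theorem isFacetOf_of_incidence_ne_zero {X : Fan K V} {o : X.Orientations} {τ σ : X.Cone}
    (h : X.incidence o τ σ ≠ 0) : IsFacetOf τ.1 σ.1 := by
  by_contra hf
  exact h (by rw [incidence, if_neg hf])

noncomputable instance (X : Fan K V) : Fintype X.Cone := Fintype.ofFinite _

/-- A volume form that represents the orientation of a cone. -/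
noncomputable def form (X : Fan K V) (o : X.Orientations) (σ : X.Cone) :
    coneSpan σ.1 [⋀^Fin (coneDim σ.1)]→ₗ[K] K :=
  (o σ).someVector

theorem form_ne_zero (X : Fan K V) (o : X.Orientations) (σ : X.Cone) : X.form o σ ≠ 0 :=
  (o σ).someVector_ne_zero

/-- The form is its value at b times `b.det`, so it lies on the ray of `b.det` exactly when this
value is positive. -/
theorem orientation_eq_iff (X : Fan K V) (o : X.Orientations) (σ : X.Cone)
    (b : Basis (Fin (coneDim σ.1)) K (coneSpan σ.1)) :
    b.orientation = o σ ↔ 0 < X.form o σ b := by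
  have h1 : rayOfNeZero K (X.form o σ) (X.form_ne_zero o σ) = o σ := (o σ).someVector_ray
  have h2 := AlternatingMap.eq_smul_basis_det b (X.form o σ)
  have h3 : X.form o σ b ≠ 0 := (AlternatingMap.map_basis_ne_zero_iff b _).2 (X.form_ne_zero o σ)
  rw [← h1, Basis.orientation, ray_eq_iff, h2, sameRay_smul_right_iff]
  have h4 : b.det ≠ 0 := b.det_ne_zero
  rw [AlternatingMap.smul_apply, b.det_self, smul_eq_mul, mul_one]
  constructor
  · rintro (h | h)
    · exact lt_of_le_of_ne h h3.symm
    · exact absurd h h4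
  · exact fun h => Or.inl h.le

variable [FiniteDimensional K V]

/-- The incidence number of a facet has the opposite sign of the values on the larger cone of the
linear form that expands the volume form of the larger cone along the facet. -/
theorem exists_incidence_eq (X : Fan K V) (o : X.Orientations) {τ σ : X.Cone}
    (hf : IsFacetOf τ.1 σ.1) :
    ∃ l : coneSpan σ.1 →ₗ[K] K,
      (∀ w v, X.form o σ (consCast hf.2 w
        (Submodule.inclusion (PointedCone.coneSpan_mono hf.1.le) ∘ v)) = l w * X.form o τ v) ∧
      (∀ x y : coneSpan σ.1, (x : V) - y ∈ coneSpan τ.1 → l x = l y) ∧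
      (X.incidence o τ σ = 1 ∨ X.incidence o τ σ = -1) ∧
      ∀ (w : V) (hw : w ∈ σ.1), w ∉ τ.1 →
        (X.incidence o τ σ : K) * l ⟨w, PointedCone.mem_coneSpan hw⟩ < 0 := by
  classical
  have hAB := PointedCone.coneSpan_mono hf.1.le
  obtain ⟨l, hl, hl0⟩ := exists_facetFunctional hAB hf.2 rfl rfl (X.form_ne_zero o τ)
    (X.form_ne_zero o σ)
  have hlne : ∀ (w : V) (hw : w ∈ σ.1), w ∉ τ.1 → l ⟨w, PointedCone.mem_coneSpan hw⟩ ≠ 0 :=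
    fun w hw hwτ h0 => hwτ (hf.1.mem_of_mem_coneSpan hw ((hl0 _).1 h0))
  have hmul : ∀ x y : K, x ≠ 0 → y ≠ 0 → ((0 < x ↔ 0 < y) ↔ 0 < x * y) := by
    intro x y hx hy
    rcases lt_or_gt_of_ne hx with hx | hx <;> rcases lt_or_gt_of_ne hy with hy | hy
    · simp [hx.not_gt, hy.not_gt, mul_pos_of_neg_of_neg hx hy]
    · simp [hx.not_gt, hy, (mul_neg_of_neg_of_pos hx hy).not_gt]
    · simp [hx, hy.not_gt, (mul_neg_of_pos_of_neg hx hy).not_gt]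
    · simp [hx, hy]
  -- The bases are both positive or both negative exactly when the product of the two values is
  -- positive; expanding along the facet, this product is -l w times a square.
  have hagree : ∀ (b : Basis (Fin (coneDim τ.1)) K (coneSpan τ.1))
      (b' : Basis (Fin (coneDim σ.1)) K (coneSpan σ.1)) (w : V) (hw : w ∈ σ.1),
      (b' : Fin (coneDim σ.1) → coneSpan σ.1) = consCast hf.2 (-⟨w, PointedCone.mem_coneSpan hw⟩)
        (Submodule.inclusion hAB ∘ b) →
      ((b.orientation = o τ ↔ b'.orientation = o σ) ↔ l ⟨w, PointedCone.mem_coneSpan hw⟩ < 0) := by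
    intro b b' w hw hb'
    have h1 : X.form o τ b ≠ 0 := (AlternatingMap.map_basis_ne_zero_iff b _).2 (X.form_ne_zero o τ)
    have h2 : X.form o σ b' ≠ 0 :=
      (AlternatingMap.map_basis_ne_zero_iff b' _).2 (X.form_ne_zero o σ)
    rw [X.orientation_eq_iff, X.orientation_eq_iff, hmul _ _ h1 h2, hb', hl, map_neg]
    have h3 : X.form o τ b * (-l ⟨w, PointedCone.mem_coneSpan hw⟩ * X.form o τ b) =
        -l ⟨w, PointedCone.mem_coneSpan hw⟩ * (X.form o τ b) ^ 2 := by ring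
    rw [h3, mul_pos_iff_of_pos_right (by positivity), neg_pos]
  refine ⟨l, hl, fun x y hxy => sub_eq_zero.1 (by rw [← map_sub, hl0]; exact hxy), ?_, ?_⟩
  · rw [incidence, if_pos hf]
    split_ifs
    · exact Or.inl rfl
    · exact Or.inr rfl
  · intro w hw hwτ
    rw [incidence, if_pos hf]
    split_ifs with hag
    · obtain ⟨b, b', w₀, hw₀, h0, h1, hiff⟩ := hag
      have hb' : (b' : Fin (coneDim σ.1) → coneSpan σ.1) =
          consCast hf.2 (-⟨w₀, PointedCone.mem_coneSpan hw₀⟩) (Submodule.inclusion hAB ∘ b) :=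
        eq_consCast hf.2 (fun j hj => Subtype.ext (h0 j hj))
          (fun i j hij => Subtype.ext (h1 i j hij))
      have hlw₀ := (hagree b b' w₀ hw₀ hb').1 hiff
      rw [Int.cast_one, one_mul]
      by_contra hcon
      have hlw : 0 < l ⟨w, PointedCone.mem_coneSpan hw⟩ :=
        lt_of_le_of_ne (not_lt.1 hcon) (hlne w hw hwτ).symm
      -- a positive combination of `w` and `w₀` lies in the facet
      have hmem : -(l ⟨w₀, PointedCone.mem_coneSpan hw₀⟩) • w +
          (l ⟨w, PointedCone.mem_coneSpan hw⟩) • w₀ ∈ σ.1 :=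
        σ.1.add_mem (PointedCone.smul_mem _ (neg_pos.2 hlw₀).le hw)
          (PointedCone.smul_mem _ hlw.le hw₀)
      refine hwτ (hf.1.mem_of_smul_add_mem hw (PointedCone.smul_mem _ hlw.le hw₀)
        (neg_pos.2 hlw₀) (hf.1.mem_of_mem_coneSpan hmem ?_))
      have := hl0 (-(l ⟨w₀, PointedCone.mem_coneSpan hw₀⟩) • ⟨w, PointedCone.mem_coneSpan hw⟩ +
          (l ⟨w, PointedCone.mem_coneSpan hw⟩) • ⟨w₀, PointedCone.mem_coneSpan hw₀⟩)
      refine this.1 ?_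
      rw [map_add, map_smul, map_smul, smul_eq_mul, smul_eq_mul]
      ring
    · rw [Int.cast_neg, Int.cast_one, neg_one_mul, neg_lt_zero]
      by_contra hcon
      have hlw : l ⟨w, PointedCone.mem_coneSpan hw⟩ < 0 :=
        lt_of_le_of_ne (not_lt.1 hcon) (hlne w hw hwτ)
      -- If l w were negative, -w followed by any basis of span τ would witness agreement of the
      -- orientations.
      let b : Basis (Fin (coneDim τ.1)) K (coneSpan τ.1) := finBasis K (coneSpan τ.1)
      let v' := consCast hf.2 (-⟨w, PointedCone.mem_coneSpan hw⟩) (Submodule.inclusion hAB ∘ b)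
      have hv' : LinearIndependent K v' := by
        by_contra hdep
        have h1 := (X.form o σ).map_linearDependent v' hdep
        simp only [v'] at h1
        rw [hl, map_neg] at h1
        have h2 : X.form o τ b ≠ 0 :=
          (AlternatingMap.map_basis_ne_zero_iff b _).2 (X.form_ne_zero o τ)
        exact (mul_ne_zero (neg_ne_zero.2 hlw.ne) h2) h1
      have : Nonempty (Fin (coneDim σ.1)) := ⟨⟨0, by rw [hf.2]; omega⟩⟩
      let b' := basisOfLinearIndependentOfCardEqFinrank hv' (by rw [Fintype.card_fin]; rfl)
      have hb' : (b' : Fin (coneDim σ.1) → coneSpan σ.1) = v' :=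
        coe_basisOfLinearIndependentOfCardEqFinrank _ _
      refine hag ⟨b, b', w, hw, fun j hj => ?_, fun i j hij => ?_,
        (hagree b b' w hw hb').2 hlw⟩
      · rw [hb']
        exact congrArg Subtype.val (consCast_zero hf.2 _ _ j hj)
      · rw [hb']
        exact congrArg Subtype.val (consCast_succ hf.2 _ _ i j hij)

theorem incidence_ne_zero {X : Fan K V} {o : X.Orientations} {τ σ : X.Cone}
    (hf : IsFacetOf τ.1 σ.1) : X.incidence o τ σ ≠ 0 := by
  obtain ⟨-, -, -, h | h, -⟩ := X.exists_incidence_eq o hf <;> rw [h] <;> simp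

/-- The incidence numbers of a fan define a differential. -/
theorem sum_incidence_mul (X : Fan K V) (hX : ∀ σ ∈ X.cones, σ.FG)
    (o : X.Orientations) (τ σ : X.Cone) :
    ∑ ρ, (X.incidence o τ ρ : K) * (X.incidence o ρ σ : K) = 0 := by
  classical
  have hfac : ∀ ρ, (X.incidence o τ ρ : K) * (X.incidence o ρ σ : K) ≠ 0 →
      IsFacetOf τ.1 ρ.1 ∧ IsFacetOf ρ.1 σ.1 := by
    intro ρ h
    rw [mul_ne_zero_iff, Int.cast_ne_zero, Int.cast_ne_zero] at h
    exact ⟨isFacetOf_of_incidence_ne_zero h.1, isFacetOf_of_incidence_ne_zero h.2⟩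
  by_cases hex : ∃ ρ : X.Cone, IsFacetOf τ.1 ρ.1 ∧ IsFacetOf ρ.1 σ.1
  · obtain ⟨ρ, hρ₁, hρ₂⟩ := hex
    have hdim : coneDim σ.1 = coneDim τ.1 + 2 := by
      have := hρ₁.2
      have := hρ₂.2
      omega
    -- Only the two faces of the diamond contribute to the sum; their contributions have to cancel.
    obtain ⟨T₁, T₂, hne, hT₁, hT₂, hτ₁, hτ₂, hd₁, hd₂, huniq⟩ :=
      (hρ₁.1.trans hρ₂.1).diamond (hX _ σ.2) hdim
    let t₁ : X.Cone := ⟨T₁, X.face_mem _ σ.2 _ hT₁⟩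
    let t₂ : X.Cone := ⟨T₂, X.face_mem _ σ.2 _ hT₂⟩
    have hτσ := hρ₁.1.trans hρ₂.1
    have f₁ : IsFacetOf τ.1 t₁.1 := ⟨(hτσ.isFaceOf_iff_le hT₁).2 hτ₁, hd₁⟩
    have f₂ : IsFacetOf τ.1 t₂.1 := ⟨(hτσ.isFaceOf_iff_le hT₂).2 hτ₂, hd₂⟩
    have f₁' : IsFacetOf t₁.1 σ.1 := ⟨hT₁, by change coneDim σ.1 = coneDim T₁ + 1; omega⟩
    have f₂' : IsFacetOf t₂.1 σ.1 := ⟨hT₂, by change coneDim σ.1 = coneDim T₂ + 1; omega⟩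
    have ht : t₁ ≠ t₂ := fun h => hne (congrArg Subtype.val h)
    rw [← Finset.sum_subset (Finset.subset_univ {t₁, t₂}), Finset.sum_pair ht]
    swap
    · intro ρ _ hρ
      by_contra h0
      obtain ⟨h1, h2⟩ := hfac ρ h0
      rcases huniq ρ.1 h2.1 h1.1.le h1.2 with h | h
      · exact hρ (by simp [t₁, t₂, Subtype.ext_iff, h])
      · exact hρ (by simp [t₁, t₂, Subtype.ext_iff, h])
    have hmem : ∀ T : PointedCone K V, coneDim T = coneDim τ.1 + 1 → ∃ w ∈ T, w ∉ τ.1 := by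
      intro T hd
      by_contra! hcon
      have := PointedCone.coneDim_mono hcon
      omega
    obtain ⟨w₁, hw₁, hw₁τ⟩ := hmem T₁ hd₁
    obtain ⟨w₂, hw₂, hw₂τ⟩ := hmem T₂ hd₂
    have hnot : ∀ T T' : PointedCone K V, T.IsFaceOf σ.1 → T'.IsFaceOf σ.1 → T ≠ T' → τ.1 ≤ T →
        τ.1 ≤ T' → coneDim T = coneDim τ.1 + 1 → coneDim T' = coneDim τ.1 + 1 → ∀ w ∈ T, w ∉ τ.1 →
        w ∉ T' := by
      intro T T' hT hT' hne hτ hτ' hd hd' w hw hwτ hwT'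
      have hin := hT.inf_left hT'
      have hlt := ((hτσ.isFaceOf_iff_le hin).2 (le_inf hτ hτ')).coneDim_lt
        fun h => hwτ (h ▸ ⟨hw, hwT'⟩ : w ∈ τ.1)
      have e1 := ((hin.isFaceOf_iff_le hT).2 inf_le_left).eq_of_coneDim_le (by omega)
      have e2 := ((hin.isFaceOf_iff_le hT').2 inf_le_right).eq_of_coneDim_le (by omega)
      exact hne (e1.symm.trans e2)
    have hw₁' := hnot T₁ T₂ hT₁ hT₂ hne hτ₁ hτ₂ hd₁ hd₂ w₁ hw₁ hw₁τ
    have hw₂' := hnot T₂ T₁ hT₂ hT₁ hne.symm hτ₂ hτ₁ hd₂ hd₁ w₂ hw₂ hw₂τ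
    obtain ⟨l₁, hl₁, -, he₁, hs₁⟩ := X.exists_incidence_eq o f₁
    obtain ⟨l₂, hl₂, -, he₂, hs₂⟩ := X.exists_incidence_eq o f₂
    obtain ⟨m₁, hm₁, -, he₁', hs₁'⟩ := X.exists_incidence_eq o f₁'
    obtain ⟨m₂, hm₂, -, he₂', hs₂'⟩ := X.exists_incidence_eq o f₂'
    have a₁ := hs₁ w₁ hw₁ hw₁τ
    have a₂ := hs₂ w₂ hw₂ hw₂τ
    have a₁' := hs₁' w₂ (hT₂.le hw₂) hw₂'
    have a₂' := hs₂' w₁ (hT₁.le hw₁) hw₁'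
    let b : Basis (Fin (coneDim τ.1)) K (coneSpan τ.1) := finBasis K (coneSpan τ.1)
    have hb : X.form o τ b ≠ 0 := (AlternatingMap.map_basis_ne_zero_iff b _).2 (X.form_ne_zero o τ)
    -- The volume form of σ at w₂, w₁ and a basis of span τ expands through the first face, and with
    -- w₁ and w₂ swapped through the second one; alternation yields the sign.
    have key : m₁ ⟨w₂, PointedCone.mem_coneSpan (hT₂.le hw₂)⟩ *
        l₁ ⟨w₁, PointedCone.mem_coneSpan hw₁⟩ =
        - (m₂ ⟨w₁, PointedCone.mem_coneSpan (hT₁.le hw₁)⟩ *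
          l₂ ⟨w₂, PointedCone.mem_coneSpan hw₂⟩) := by
      refine mul_right_cancel₀ hb ?_
      rw [mul_assoc, ← hl₁, ← hm₁, neg_mul, mul_assoc, ← hl₂, ← hm₂]
      have hcomp : ∀ (t : X.Cone) (f : IsFacetOf τ.1 t.1) (f' : IsFacetOf t.1 σ.1)
          (w : coneSpan t.1), (Submodule.inclusion (PointedCone.coneSpan_mono f'.1.le)) ∘
            consCast f.2 w (Submodule.inclusion (PointedCone.coneSpan_mono f.1.le) ∘ b) =
          consCast (f.2.symm ▸ rfl : coneDim t.1 = coneDim τ.1 + 1)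
            (Submodule.inclusion (PointedCone.coneSpan_mono f'.1.le) w)
            (Submodule.inclusion (PointedCone.coneSpan_mono hτσ.le) ∘ b) := by
        intro t f f' w
        refine eq_consCast _ (fun j hj => ?_) fun i j hij => ?_
        · rw [Function.comp_apply, consCast_zero _ _ _ j hj]
        · rw [Function.comp_apply, consCast_succ _ _ _ i j hij]
          rfl
      rw [hcomp t₁ f₁ f₁', hcomp t₂ f₂ f₂']
      have hcast : ∀ (q : ℕ) (h : coneDim σ.1 = q + 1) (h' : q = coneDim τ.1 + 1)
          (x y : coneSpan σ.1), consCast h x (consCast h' y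
            (Submodule.inclusion (PointedCone.coneSpan_mono hτσ.le) ∘ b)) =
          consCast hdim x (consCast rfl y
            (Submodule.inclusion (PointedCone.coneSpan_mono hτσ.le) ∘ b)) := by
        rintro q h rfl x y
        rfl
      rw [hcast _ f₁'.2 _ _ _, hcast _ f₂'.2 _ _ _, map_consCast_swap]
      rfl
    have hp := mul_pos_of_neg_of_neg a₁ a₁'
    have hq := mul_pos_of_neg_of_neg a₂ a₂'
    have hp' : 0 < ((X.incidence o τ t₁ : K) * (X.incidence o t₁ σ : K)) *
      (m₁ ⟨w₂, PointedCone.mem_coneSpan (hT₂.le hw₂)⟩ * l₁ ⟨w₁, PointedCone.mem_coneSpan hw₁⟩) := by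
      convert hp using 1
      ring
    have hq' : 0 < ((X.incidence o τ t₂ : K) * (X.incidence o t₂ σ : K)) *
      (m₂ ⟨w₁, PointedCone.mem_coneSpan (hT₁.le hw₁)⟩ * l₂ ⟨w₂, PointedCone.mem_coneSpan hw₂⟩) := by
      convert hq using 1
      ring
    rw [key] at hp'
    -- Each product of incidence numbers has the sign of its product of form values, and by `key`
    -- these have opposite signs. As all incidence numbers are ±1, the two products cancel.
    rcases he₁ with h1 | h1 <;> rcases he₂ with h2 | h2 <;> rcases he₁' with h3 | h3 <;>
      rcases he₂' with h4 | h4 <;> rw [h1, h3] at hp' ⊢ <;> rw [h2, h4] at hq' ⊢ <;>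
      push_cast at hp' hq' ⊢ <;> first | (exfalso; linarith) | norm_num
  · refine Finset.sum_eq_zero fun ρ _ => ?_
    by_contra h0
    exact hex ⟨ρ, hfac ρ h0⟩

end Fan

/-! ### The incidence matrix of the cone over a polytope -/

namespace Polytope

variable {K : Type*} [Field K] [LinearOrder K] [IsStrictOrderedRing K]
variable {V : Type*} [AddCommGroup V] [Module K V]

theorem cone_fg (Δ : Polytope K V) : Δ.cone.FG := by
  obtain ⟨S, hS, -⟩ := Δ.exists_cone_eq
  exact ⟨S, hS.symm⟩

variable [FiniteDimensional K V]

noncomputable instance (Δ : Polytope K V) :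
    Fintype {F : PointedCone K (V × K) // F.IsFaceOf Δ.cone} :=
  inferInstanceAs (Fintype Δ.coneFan.Cone)

theorem isIncidenceMatrix (Δ : Polytope K V) (o : Δ.coneFan.Orientations) :
    IsIncidenceMatrix (C := Δ.cone) (K := K) fun τ σ => (Δ.coneFan.incidence o τ σ : K) where
  le _ _ h := (Fan.isFacetOf_of_incidence_ne_zero (Int.cast_ne_zero.1 h)).1.le
  coneDim_eq _ _ h := (Fan.isFacetOf_of_incidence_ne_zero (Int.cast_ne_zero.1 h)).2
  ne_zero τ σ h h' := Int.cast_ne_zero.2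
    (Fan.incidence_ne_zero ⟨(τ.2.isFaceOf_iff_le σ.2).2 h, h'⟩)
  sum_mul τ σ := Δ.coneFan.sum_incidence_mul (fun _ hσ => PointedCone.IsFaceOf.fg hσ Δ.cone_fg) o τ σ

end Polytope


/-! ### The correspondence between faces of the cone and normal cones -/

theorem dual_prod_apply {K V : Type*} [Field K] [AddCommGroup V] [Module K V]
    (f : Dual K (V × K)) (x : V × K) :
    f x = f (x.1, 0) + x.2 * f (0, 1) := by
  have : x = (x.1, 0) + x.2 • ((0, 1) : V × K) := by ext <;> simp
  conv_lhs => rw [this]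
  rw [map_add, map_smul, smul_eq_mul]

namespace Polytope

variable {K : Type*} [Field K] [LinearOrder K] [IsStrictOrderedRing K]
variable {V : Type*} [AddCommGroup V] [Module K V]
variable {Δ : Polytope K V} {σ σ' : PointedCone K (V × K)} {ν ν' : PointedCone K (Dual K V)}

theorem cone_induction (Δ : Polytope K V) {p : V × K → Prop}
    (mem : ∀ y ∈ Δ.carrier, p (y, 1)) (zero : p 0)
    (add : ∀ x ∈ Δ.cone, ∀ y ∈ Δ.cone, p x → p y → p (x + y))
    (smul : ∀ c : K, 0 ≤ c → ∀ x ∈ Δ.cone, p x → p (c • x)) : ∀ x ∈ Δ.cone, p x := by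
  intro x hx
  induction hx using Submodule.span_induction with
  | mem x hx =>
    obtain ⟨y, hy, rfl⟩ := hx
    exact mem y hy
  | zero => exact zero
  | add x y hx hy hpx hpy => exact add x hx y hy hpx hpy
  | smul c x hx hpx => exact smul c.1 c.2 x hx hpx

theorem mem_cone {y : V} (hy : y ∈ Δ.carrier) : (y, (1 : K)) ∈ Δ.cone :=
  PointedCone.subset_hull ⟨y, hy, rfl⟩

/-- A linear form that is nonnegative on the polytope and only has trivial zeros there. -/
theorem eq_zero_of_pos {f : Dual K (V × K)} (hf : ∀ y ∈ Δ.carrier, 0 < f (y, 1)) {x : V × K}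
    (hx : x ∈ Δ.cone) (h0 : f x = 0) : x = 0 := by
  have key : ∀ x ∈ Δ.cone, 0 ≤ f x ∧ (f x = 0 → x = 0) := by
    refine Δ.cone_induction (fun y hy => ⟨(hf y hy).le, fun h => absurd h (hf y hy).ne'⟩) (by simp)
      ?_ ?_
    · intro x _ y _ hx hy
      rw [map_add]
      refine ⟨add_nonneg hx.1 hy.1, fun h => ?_⟩
      rw [hx.2 (by linarith [hx.1, hy.1]), hy.2 (by linarith [hx.1, hy.1]), add_zero]
    · intro c hc x _ hx
      rw [map_smul, smul_eq_mul]
      refine ⟨mul_nonneg hc hx.1, fun h => ?_⟩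
      rcases mul_eq_zero.1 h with h | h
      · rw [h, zero_smul]
      · rw [hx.2 h, smul_zero]
  exact (key x hx).2 h0

theorem snd_pos {x : V × K} (hx : x ∈ Δ.cone) (hx0 : x ≠ 0) : 0 < x.2 := by
  have h1 : ∀ x ∈ Δ.cone, 0 ≤ x.2 :=
    Δ.cone_induction (fun _ _ => zero_le_one) le_rfl
      (fun _ _ _ _ hx hy => add_nonneg hx hy) fun _ hc _ _ hx => mul_nonneg hc hx
  refine lt_of_le_of_ne (h1 x hx) fun h => hx0 ?_
  exact eq_zero_of_pos (f := LinearMap.snd K V K) (fun _ _ => one_pos) hx h.symm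

theorem exists_snd_pos (hσ : σ.IsFaceOf Δ.cone) (h0 : σ ≠ ⊥) : ∃ x ∈ σ, 0 < x.2 := by
  obtain ⟨x, hx, hx0⟩ := (Submodule.ne_bot_iff σ).1 h0
  exact ⟨x, hx, snd_pos (hσ.le hx) hx0⟩

theorem exists_mem_coneSpan_snd_eq_one (hσ : σ.IsFaceOf Δ.cone) (h0 : σ ≠ ⊥) :
    ∃ x ∈ coneSpan σ, x.2 = 1 := by
  obtain ⟨x, hx, hx2⟩ := exists_snd_pos hσ h0
  exact ⟨x.2⁻¹ • x, Submodule.smul_mem _ _ (PointedCone.mem_coneSpan hx),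
    inv_mul_cancel₀ hx2.ne'⟩

/-- The vectors of height zero in the span of a cone over a face. -/
def lin (σ : PointedCone K (V × K)) : Submodule K V := (coneSpan σ).comap (LinearMap.inl K V K)

theorem mem_lin {x : V} : x ∈ lin σ ↔ (x, (0 : K)) ∈ coneSpan σ := Iff.rfl

variable (Δ) in
/-- The cone `ν` consists of the linear parts of the affine functions that are nonnegative on the
polytope and vanish on the face `σ`. -/
def IsNormal (σ : PointedCone K (V × K)) (ν : PointedCone K (Dual K V)) : Prop :=
  ∀ u : Dual K V, u ∈ ν ↔ ∃ f : Dual K (V × K), (∀ y, f (y, 0) = u y) ∧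
    (∀ x ∈ Δ.cone, 0 ≤ f x) ∧ ∀ x ∈ σ, f x = 0

/-- As f is nonnegative on the cone and vanishes at (y₀, 1), its linear part is minimal over the
polytope exactly at the zeros of f. A form v in the normal cone is completed to the affine function
v - v(y₀). -/
theorem isNormal_zeros {f : Dual K (V × K)} (hf : ∀ x ∈ Δ.cone, 0 ≤ f x) {y₀ : V}
    (hy₀ : y₀ ∈ Δ.carrier) (h0 : f (y₀, 1) = 0) :
    Δ.IsNormal (Δ.cone.zeros f) (Δ.normalCone (Δ.face (f ∘ₗ LinearMap.inl K V K))) := by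
  have hfy : ∀ y : V, f (y, 0) = f (y, 1) - f (0, 1) := fun y => by
    rw [dual_prod_apply f (y, 1)]
    simp
  have hface : ∀ y, y ∈ Δ.face (f ∘ₗ LinearMap.inl K V K) ↔ y ∈ Δ.carrier ∧ f (y, 1) = 0 := by
    intro y
    refine and_congr_right fun hy => ?_
    simp only [LinearMap.comp_apply, LinearMap.inl_apply, hfy]
    constructor
    · intro h
      have := h y₀ hy₀
      exact le_antisymm (by linarith) (hf _ (mem_cone hy))
    · intro h z hz
      have := hf _ (mem_cone hz)
      linarith
  intro v
  constructor
  · intro hv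
    let g : Dual K (V × K) := v ∘ₗ LinearMap.fst K V K - v y₀ • LinearMap.snd K V K
    have hg : ∀ x : V × K, g x = v x.1 - v y₀ * x.2 := fun x => rfl
    have hy₀F := (hface y₀).2 ⟨hy₀, h0⟩
    refine ⟨g, fun y => by simp [hg], ?_, ?_⟩
    · refine Δ.cone_induction (fun y hy => ?_) (by simp) ?_ ?_
      · rw [hg]
        have := hv y₀ hy₀F y hy
        simpa using this
      · intro x _ y _ hx hy
        rw [map_add]
        exact add_nonneg hx hy
      · intro c hc x _ hx
        rw [map_smul]
        exact mul_nonneg hc hx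
    · have key : ∀ x ∈ Δ.cone, f x = 0 → g x = 0 := by
        refine Δ.cone_induction (fun y hy h => ?_) (by simp) ?_ ?_
        · have h1 := hv y₀ hy₀F y hy
          have h2 := hv y ((hface y).2 ⟨hy, h⟩) y₀ hy₀
          rw [hg]
          simp only [mul_one]
          linarith
        · intro x hx y hy h1 h2 h
          rw [map_add] at h ⊢
          rw [h1 (by linarith [hf x hx, hf y hy]), h2 (by linarith [hf x hx, hf y hy]), add_zero]
        · intro c _ x _ hx h
          rw [map_smul, smul_eq_mul] at h ⊢
          rcases mul_eq_zero.1 h with h | h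
          · rw [h, zero_mul]
          · rw [hx h, mul_zero]
      exact fun x hx => key x hx.1 hx.2
  · rintro ⟨g, hgv, hg, hg0⟩ x hx y hy
    obtain ⟨hxΔ, hfx⟩ := (hface x).1 hx
    have h1 := hg0 (x, 1) ⟨mem_cone hxΔ, hfx⟩
    have h2 := hg (y, 1) (mem_cone hy)
    rw [dual_prod_apply] at h1 h2
    simp only [hgv] at h1 h2
    linarith

theorem exists_face_isNormal (hΔ : affineSpan K Δ.carrier = ⊤) (hν : ν ∈ (Δ.normalFan hΔ).cones) :
    ∃ σ : PointedCone K (V × K), σ.IsFaceOf Δ.cone ∧ σ ≠ ⊥ ∧ Δ.IsNormal σ ν := by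
  obtain ⟨u, rfl⟩ := hν
  obtain ⟨y₀, hy₀, hmin⟩ := face_nonempty hΔ u
  let f : Dual K (V × K) := u ∘ₗ LinearMap.fst K V K - u y₀ • LinearMap.snd K V K
  have hf : ∀ x : V × K, f x = u x.1 - u y₀ * x.2 := fun x => rfl
  have hpos : ∀ x ∈ Δ.cone, 0 ≤ f x := by
    refine Δ.cone_induction (fun y hy => ?_) (by simp) ?_ ?_
    · simpa [hf] using hmin y hy
    · intro x _ y _ hx hy
      rw [map_add]
      exact add_nonneg hx hy
    · intro c hc x _ hx
      rw [map_smul]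
      exact mul_nonneg hc hx
  have h0 : f (y₀, 1) = 0 := by simp [hf]
  refine ⟨Δ.cone.zeros f, PointedCone.zeros_isFaceOf hpos, fun hbot => ?_, ?_⟩
  · have : (y₀, (1 : K)) ∈ Δ.cone.zeros f := ⟨mem_cone hy₀, h0⟩
    rw [hbot, Submodule.mem_bot] at this
    exact one_ne_zero (congrArg Prod.snd this)
  · have hu : f ∘ₗ LinearMap.inl K V K = u := by
      ext y
      simp [hf]
    have := isNormal_zeros hpos hy₀ h0
    rwa [hu] at this

/-- A linear form that vanishes on `lin σ` extends to a form that vanishes on `σ`. -/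
theorem exists_extension (hσ : σ.IsFaceOf Δ.cone) (h0 : σ ≠ ⊥) {v : Dual K V}
    (hv : v ∈ (lin σ).dualAnnihilator) :
    ∃ f : Dual K (V × K), (∀ y, f (y, 0) = v y) ∧ ∀ x ∈ coneSpan σ, f x = 0 := by
  obtain ⟨e, he, he2⟩ := exists_mem_coneSpan_snd_eq_one hσ h0
  refine ⟨v ∘ₗ LinearMap.fst K V K - v e.1 • LinearMap.snd K V K, fun y => by simp, fun x hx => ?_⟩
  have hmem : x.1 - x.2 • e.1 ∈ lin σ := by
    rw [mem_lin]
    have : (x.1 - x.2 • e.1, (0 : K)) = x - x.2 • e := by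
      ext <;> simp [he2]
    rw [this]
    exact Submodule.sub_mem _ hx (Submodule.smul_mem _ _ he)
  have := (Submodule.mem_dualAnnihilator v).1 hv _ hmem
  rw [map_sub, map_smul, smul_eq_mul] at this
  simpa [mul_comm] using this

section

variable [FiniteDimensional K V]

/-- An exposing form of σ has a zero on the polytope, since otherwise it would vanish only at the
vertex; `isNormal_zeros` then applies to it. -/
theorem exists_normalFan_isNormal (hΔ : affineSpan K Δ.carrier = ⊤) (hσ : σ.IsFaceOf Δ.cone)
    (hσ0 : σ ≠ ⊥) : ∃ ν ∈ (Δ.normalFan hΔ).cones, Δ.IsNormal σ ν := by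
  obtain ⟨l, hl0, hl⟩ := hσ.exists_exposing Δ.cone_fg
  obtain ⟨x, hx, hx0⟩ := (Submodule.ne_bot_iff σ).1 hσ0
  obtain ⟨y₀, hy₀, h0⟩ : ∃ y ∈ Δ.carrier, l (y, 1) = 0 := by
    by_contra! hcon
    refine hx0 (eq_zero_of_pos (f := l) (fun y hy => ?_) (hσ.le hx) ((hl x (hσ.le hx)).2 hx))
    exact lt_of_le_of_ne (hl0 _ (mem_cone hy)) (hcon y hy).symm
  have hσl : Δ.cone.zeros l = σ := by
    ext z
    exact ⟨fun hz => (hl z hz.1).1 hz.2, fun hz => ⟨hσ.le hz, (hl z (hσ.le hz)).2 hz⟩⟩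
  exact ⟨_, ⟨_, rfl⟩, hσl ▸ isNormal_zeros hl0 hy₀ h0⟩

/-- If ν ≤ ν', the linear part of a form l exposing σ extends to a form f that is nonnegative on the
cone and zero on σ'. The difference f - l is a multiple of the height, nonnegative as seen on σ;
hence l ≤ f on the cone, and l vanishes on σ'. -/
theorem IsNormal.le_iff (h : Δ.IsNormal σ ν) (h' : Δ.IsNormal σ' ν') (hσ : σ.IsFaceOf Δ.cone)
    (hσ' : σ'.IsFaceOf Δ.cone) (h0 : σ ≠ ⊥) (h0' : σ' ≠ ⊥) : ν ≤ ν' ↔ σ' ≤ σ := by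
  constructor
  · intro hle
    obtain ⟨l, hl0, hl⟩ := hσ.exists_exposing Δ.cone_fg
    have hlν : l ∘ₗ LinearMap.inl K V K ∈ ν :=
      (h _).2 ⟨l, fun y => rfl, hl0, fun x hx => (hl x (hσ.le hx)).2 hx⟩
    obtain ⟨f, hfy, hf0, hf⟩ := (h' _).1 (hle hlν)
    obtain ⟨x, hx, hx2⟩ := exists_snd_pos hσ h0
    obtain ⟨x', hx', hx2'⟩ := exists_snd_pos hσ' h0'
    have hd : ∀ z : V × K, f z - l z = z.2 * (f (0, 1) - l (0, 1)) := fun z => by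
      rw [dual_prod_apply f, dual_prod_apply l, hfy]
      simp only [LinearMap.comp_apply, LinearMap.inl_apply]
      ring
    have e1 : 0 ≤ f (0, 1) - l (0, 1) := by
      have h1 := hd x
      rw [(hl x (hσ.le hx)).2 hx, sub_zero] at h1
      have h2 := hf0 x (hσ.le hx)
      rw [h1] at h2
      exact (mul_nonneg_iff_of_pos_left hx2).1 h2
    intro z hz
    refine (hl z (hσ'.le hz)).1 (le_antisymm ?_ (hl0 z (hσ'.le hz)))
    have h1 := hd z
    rw [hf z hz] at h1
    have h2 : 0 ≤ z.2 := by
      by_cases hz0 : z = 0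
      · rw [hz0]
        exact le_rfl
      · exact (snd_pos (hσ'.le hz) hz0).le
    have h3 : 0 ≤ 0 - l z := h1 ▸ mul_nonneg h2 e1
    linarith
  · intro hle u hu
    obtain ⟨f, hfy, hf0, hf⟩ := (h u).1 hu
    exact (h' u).2 ⟨f, hfy, hf0, fun x hx => hf x (hle hx)⟩

/-- For the harder inclusion, a form in the annihilator extends to f vanishing on σ. If l exposes σ,
then l + r f is still nonnegative on the cone for small r > 0, and f is a multiple of the difference
of l + r f and l, whose linear parts are in ν. -/
theorem IsNormal.coneSpan_eq (h : Δ.IsNormal σ ν) (hσ : σ.IsFaceOf Δ.cone) (h0 : σ ≠ ⊥) :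
    coneSpan ν = (lin σ).dualAnnihilator := by
  apply le_antisymm
  · refine Submodule.span_le.2 fun u hu => ?_
    obtain ⟨f, hfy, -, hf⟩ := (h u).1 hu
    refine (Submodule.mem_dualAnnihilator u).2 fun x hx => ?_
    have hle : coneSpan σ ≤ LinearMap.ker f := Submodule.span_le.2 hf
    rw [← hfy]
    exact hle hx
  · intro v hv
    obtain ⟨f, hfy, hf⟩ := exists_extension hσ h0 hv
    obtain ⟨l, hl0, hl⟩ := hσ.exists_exposing Δ.cone_fg
    obtain ⟨S, hS, -⟩ := Δ.exists_cone_eq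
    have hSΔ : ∀ s ∈ S, s ∈ Δ.cone := fun s hs => by
      rw [hS]
      exact PointedCone.subset_hull hs
    classical
    obtain ⟨r, hr, hrS⟩ := exists_pos_mul_le (S.filter fun s => 0 < l s) (fun s => l s)
      (fun s => - f s) fun s hs => (Finset.mem_filter.1 hs).2
    have hpos : ∀ x ∈ Δ.cone, 0 ≤ (l + r • f) x := by
      intro x hx
      rw [hS] at hx
      induction hx using Submodule.span_induction with
      | mem s hs =>
        rw [LinearMap.add_apply, LinearMap.smul_apply, smul_eq_mul]
        rcases (hl0 s (hSΔ s hs)).eq_or_lt with h' | h'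
        · rw [← h', hf s (PointedCone.mem_coneSpan ((hl s (hSΔ s hs)).1 h'.symm)), mul_zero, add_zero]
        · have := hrS s (Finset.mem_filter.2 ⟨hs, h'⟩)
          linarith
      | zero => simp
      | add x y _ _ hx hy =>
        rw [map_add]
        exact add_nonneg hx hy
      | smul c x _ hx =>
        change 0 ≤ (l + r • f) ((c : K) • x)
        rw [map_smul]
        exact mul_nonneg c.2 hx
    have h1 : l ∘ₗ LinearMap.inl K V K ∈ ν :=
      (h _).2 ⟨l, fun y => rfl, hl0, fun x hx => (hl x (hσ.le hx)).2 hx⟩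
    have h2 : l ∘ₗ LinearMap.inl K V K + r • v ∈ ν := by
      refine (h _).2 ⟨l + r • f, fun y => by simp [hfy], hpos, fun x hx => ?_⟩
      rw [LinearMap.add_apply, LinearMap.smul_apply, hf x (PointedCone.mem_coneSpan hx),
        (hl x (hσ.le hx)).2 hx, smul_zero, add_zero]
    have h3 : v = r⁻¹ • ((l ∘ₗ LinearMap.inl K V K + r • v) - l ∘ₗ LinearMap.inl K V K) := by
      rw [add_sub_cancel_left, smul_smul, inv_mul_cancel₀ hr.ne', one_smul]
    rw [h3]
    exact Submodule.smul_mem _ _ (Submodule.sub_mem _ (PointedCone.mem_coneSpan h2)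
      (PointedCone.mem_coneSpan h1))

/-- The height maps the span of a nonzero face onto K, with kernel `lin σ`. -/
theorem finrank_lin (hσ : σ.IsFaceOf Δ.cone) (h0 : σ ≠ ⊥) :
    finrank K (lin σ) + 1 = coneDim σ := by
  obtain ⟨e, he, he2⟩ := exists_mem_coneSpan_snd_eq_one hσ h0
  let f : coneSpan σ →ₗ[K] K := LinearMap.snd K V K ∘ₗ (coneSpan σ).subtype
  have hsurj : LinearMap.range f = ⊤ := by
    refine LinearMap.range_eq_top.2 fun c => ⟨c • ⟨e, he⟩, ?_⟩
    simp [f, he2]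
  have h1 := LinearMap.finrank_range_add_finrank_ker f
  rw [hsurj, finrank_top, finrank_self] at h1
  have hmap : (lin σ).map (LinearMap.inl K V K) = (LinearMap.ker f).map (coneSpan σ).subtype := by
    ext x
    constructor
    · rintro ⟨y, hy, rfl⟩
      exact ⟨⟨(y, 0), hy⟩, by simp [f], rfl⟩
    · rintro ⟨⟨x, hx⟩, hx0, rfl⟩
      have hx2 : x.2 = 0 := hx0
      have : x = (x.1, 0) := Prod.ext rfl hx2
      exact ⟨x.1, by rw [SetLike.mem_coe, mem_lin, ← this]; exact hx, this.symm⟩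
  have h2 : finrank K ((lin σ).map (LinearMap.inl K V K)) = finrank K (lin σ) :=
    (Submodule.equivMapOfInjective _ LinearMap.inl_injective _).finrank_eq.symm
  have h3 : finrank K ((LinearMap.ker f).map (coneSpan σ).subtype) = finrank K (LinearMap.ker f) :=
    (Submodule.equivMapOfInjective _ (Submodule.injective_subtype _) _).finrank_eq.symm
  unfold coneDim
  rw [← h1, ← h3, ← hmap, h2, add_comm]

theorem IsNormal.coneDim_add (h : Δ.IsNormal σ ν) (hσ : σ.IsFaceOf Δ.cone) (h0 : σ ≠ ⊥) :
    coneDim σ + coneDim ν = finrank K V + 1 := by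
  have h1 := Subspace.finrank_add_finrank_dualAnnihilator_eq (lin σ)
  have h2 := finrank_lin hσ h0
  have h3 : coneDim ν = finrank K (lin σ).dualAnnihilator := by
    rw [coneDim, h.coneSpan_eq hσ h0]
  omega

end

section FaceOfNormal

variable [FiniteDimensional K V] (hΔ : affineSpan K Δ.carrier = ⊤)

/-- The cone over the face of the polytope that corresponds to a normal cone. -/
noncomputable def faceOfNormal (ν : (Δ.normalFan hΔ).Cone) : Δ.coneFan.Cone :=
  ⟨(exists_face_isNormal hΔ ν.2).choose, (exists_face_isNormal hΔ ν.2).choose_spec.1⟩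

theorem faceOfNormal_isFaceOf (ν : (Δ.normalFan hΔ).Cone) :
    (faceOfNormal hΔ ν).1.IsFaceOf Δ.cone := (faceOfNormal hΔ ν).2

theorem faceOfNormal_ne_bot (ν : (Δ.normalFan hΔ).Cone) : (faceOfNormal hΔ ν).1 ≠ ⊥ :=
  (exists_face_isNormal hΔ ν.2).choose_spec.2.1

theorem faceOfNormal_isNormal (ν : (Δ.normalFan hΔ).Cone) :
    Δ.IsNormal (faceOfNormal hΔ ν).1 ν.1 :=
  (exists_face_isNormal hΔ ν.2).choose_spec.2.2

theorem faceOfNormal_le_iff (ν ν' : (Δ.normalFan hΔ).Cone) :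
    (faceOfNormal hΔ ν').1 ≤ (faceOfNormal hΔ ν).1 ↔ ν.1 ≤ ν'.1 :=
  ((faceOfNormal_isNormal hΔ ν).le_iff (faceOfNormal_isNormal hΔ ν') (faceOfNormal_isFaceOf hΔ ν)
    (faceOfNormal_isFaceOf hΔ ν') (faceOfNormal_ne_bot hΔ ν) (faceOfNormal_ne_bot hΔ ν')).symm

theorem faceOfNormal_injective : Function.Injective (faceOfNormal hΔ) := by
  intro ν ν' h
  exact Subtype.ext (le_antisymm ((faceOfNormal_le_iff hΔ _ _).1 (h ▸ le_rfl))
    ((faceOfNormal_le_iff hΔ _ _).1 (h ▸ le_rfl)))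

theorem exists_faceOfNormal_eq (σ : Δ.coneFan.Cone) (h0 : σ.1 ≠ ⊥) :
    ∃ ν, faceOfNormal hΔ ν = σ := by
  have hσ : σ.1.IsFaceOf Δ.cone := σ.2
  obtain ⟨ν, hν, hn⟩ := exists_normalFan_isNormal hΔ hσ h0
  refine ⟨⟨ν, hν⟩, Subtype.ext ?_⟩
  have hn' := faceOfNormal_isNormal hΔ ⟨ν, hν⟩
  have hf := faceOfNormal_isFaceOf hΔ ⟨ν, hν⟩
  have hb := faceOfNormal_ne_bot hΔ ⟨ν, hν⟩
  exact le_antisymm ((hn.le_iff hn' hσ hf h0 hb).1 le_rfl) ((hn'.le_iff hn hf hσ hb h0).1 le_rfl)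

theorem coneDim_faceOfNormal (ν : (Δ.normalFan hΔ).Cone) :
    coneDim (faceOfNormal hΔ ν).1 + coneDim ν.1 = finrank K V + 1 :=
  (faceOfNormal_isNormal hΔ ν).coneDim_add (faceOfNormal_isFaceOf hΔ ν) (faceOfNormal_ne_bot hΔ ν)

theorem coneSpan_normal (ν : (Δ.normalFan hΔ).Cone) :
    coneSpan ν.1 = (lin (faceOfNormal hΔ ν).1).dualAnnihilator :=
  (faceOfNormal_isNormal hΔ ν).coneSpan_eq (faceOfNormal_isFaceOf hΔ ν) (faceOfNormal_ne_bot hΔ ν)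

theorem isFacetOf_faceOfNormal_iff (ν ν' : (Δ.normalFan hΔ).Cone) :
    Fan.IsFacetOf (faceOfNormal hΔ ν).1 (faceOfNormal hΔ ν').1 ↔ Fan.IsFacetOf ν'.1 ν.1 := by
  have h1 := coneDim_faceOfNormal hΔ ν
  have h2 := coneDim_faceOfNormal hΔ ν'
  refine and_congr ?_ (by omega)
  rw [(faceOfNormal_isFaceOf hΔ ν).isFaceOf_iff_le (faceOfNormal_isFaceOf hΔ ν'),
    faceOfNormal_le_iff]
  constructor
  · intro h
    -- Inside a fan, an inclusion of cones is a face relation.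
    have := ((Δ.normalFan hΔ).inter_face _ ν'.2 _ ν.2).2
    rwa [inf_eq_left.2 h] at this
  · exact fun h => h.le

end FaceOfNormal

end Polytope


/-! ### Alternating maps with two blocks of arguments -/

section Blocks

variable {K : Type*} [Field K] {W : Type*} [AddCommGroup W] [Module K W]
variable {α β : Type*}

/-- An alternating map as a function of its first block of arguments. -/
def AlternatingMap.leftBlock (f : W [⋀^α ⊕ β]→ₗ[K] K) (y : β → W) : W [⋀^α]→ₗ[K] K where
  toFun v := f (Sum.elim v y)
  map_update_add' v i a b := by
    classical
    have := f.map_update_add (Sum.elim v y) (Sum.inl i) a b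
    rw [← Sum.elim_update_left, ← Sum.elim_update_left, ← Sum.elim_update_left] at this
    convert this
  map_update_smul' v i c a := by
    classical
    have := f.map_update_smul (Sum.elim v y) (Sum.inl i) c a
    rw [← Sum.elim_update_left, ← Sum.elim_update_left] at this
    convert this
  map_eq_zero_of_eq' v i j h hij :=
    f.map_eq_zero_of_eq (Sum.elim v y) (i := Sum.inl i) (j := Sum.inl j) h (by simpa using hij)

/-- An alternating map as a function of its second block of arguments. -/
def AlternatingMap.rightBlock (f : W [⋀^α ⊕ β]→ₗ[K] K) (x : α → W) : W [⋀^β]→ₗ[K] K where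
  toFun v := f (Sum.elim x v)
  map_update_add' v i a b := by
    classical
    have := f.map_update_add (Sum.elim x v) (Sum.inr i) a b
    rw [← Sum.elim_update_right, ← Sum.elim_update_right, ← Sum.elim_update_right] at this
    convert this
  map_update_smul' v i c a := by
    classical
    have := f.map_update_smul (Sum.elim x v) (Sum.inr i) c a
    rw [← Sum.elim_update_right, ← Sum.elim_update_right] at this
    convert this
  map_eq_zero_of_eq' v i j h hij :=
    f.map_eq_zero_of_eq (Sum.elim x v) (i := Sum.inr i) (j := Sum.inr j) h (by simpa using hij)

/-- Two volume forms are proportional. -/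
theorem AlternatingMap.map_mul_map_basis [Fintype α] (f g : W [⋀^α]→ₗ[K] K) (b : Basis α K W)
    (v : α → W) : f v * g b = f b * g v := by
  classical
  rw [AlternatingMap.eq_smul_basis_det b f, AlternatingMap.eq_smul_basis_det b g]
  simp only [AlternatingMap.smul_apply, smul_eq_mul, b.det_self]
  ring

/-- Fixing one block leaves a top-degree form on the space of the other one, so the blocks can be
moved to their reference bases one at a time. -/
theorem AlternatingMap.map_blocks_mul [Fintype α] [Fintype β] {U : Type*} [AddCommGroup U]
    [Module K U] {A : Submodule K W} {B : Submodule K U} (R : U →ₗ[K] W)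
    (f : W [⋀^α ⊕ β]→ₗ[K] K) (g : A [⋀^α]→ₗ[K] K) (g' : B [⋀^β]→ₗ[K] K) (b₀ : Basis α K A)
    (c₀ : Basis β K B) (b : α → A) (c : β → B) :
    f (Sum.elim (fun i => (b i : W)) fun i => R (c i)) * (g b₀ * g' c₀) =
      f (Sum.elim (fun i => (b₀ i : W)) fun i => R (c₀ i)) * (g b * g' c) := by
  have h1 : f (Sum.elim (fun i => (b i : W)) fun i => R (c i)) * g b₀ =
      f (Sum.elim (fun i => (b₀ i : W)) fun i => R (c i)) * g b :=
    AlternatingMap.map_mul_map_basis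
      ((f.leftBlock fun i => R (c i)).compLinearMap A.subtype) g b₀ b
  have h2 : f (Sum.elim (fun i => (b₀ i : W)) fun i => R (c i)) * g' c₀ =
      f (Sum.elim (fun i => (b₀ i : W)) fun i => R (c₀ i)) * g' c :=
    AlternatingMap.map_mul_map_basis
      ((f.rightBlock fun i => (b₀ i : W)).compLinearMap (R ∘ₗ B.subtype)) g' c₀ c
  calc _ = f (Sum.elim (fun i => (b i : W)) fun i => R (c i)) * g b₀ * g' c₀ := by ring
    _ = f (Sum.elim (fun i => (b₀ i : W)) fun i => R (c i)) * g' c₀ * g b := by rw [h1]; ring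
    _ = _ := by rw [h2]; ring

/-- By the dimension count, A and the image of B are complementary. Bases of both combine to a basis
of W, at which f does not vanish and from which the constant is read off. -/
theorem AlternatingMap.exists_map_blocks_eq [FiniteDimensional K W] {U : Type*} [AddCommGroup U]
    [Module K U] [FiniteDimensional K U] {A : Submodule K W} {B : Submodule K U} (R : U →ₗ[K] W)
    (hR : Function.Injective R) (hdisj : Disjoint A (B.map R)) {p q : ℕ} (hA : finrank K A = p)
    (hB : finrank K B = q) (hpq : p + q = finrank K W) {f : W [⋀^Fin p ⊕ Fin q]→ₗ[K] K} (hf : f ≠ 0)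
    {g : A [⋀^Fin p]→ₗ[K] K} (hg : g ≠ 0) {g' : B [⋀^Fin q]→ₗ[K] K} (hg' : g' ≠ 0) :
    ∃ c : K, c ≠ 0 ∧ ∀ (b : Fin p → A) (v : Fin q → B),
      f (Sum.elim (fun i => (b i : W)) fun i => R (v i)) = c * (g b * g' v) := by
  let b₀ : Basis (Fin p) K A := finBasisOfFinrankEq K A hA
  let v₀ : Basis (Fin q) K B := finBasisOfFinrankEq K B hB
  have hb₀ : g b₀ ≠ 0 := (AlternatingMap.map_basis_ne_zero_iff b₀ _).2 hg
  have hv₀ : g' v₀ ≠ 0 := (AlternatingMap.map_basis_ne_zero_iff v₀ _).2 hg'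
  have hli : LinearIndependent K (Sum.elim (fun i => (b₀ i : W)) fun i => R (v₀ i)) := by
    refine LinearIndependent.sum_type ?_ ?_ ?_
    · exact b₀.linearIndependent.map' A.subtype (Submodule.ker_subtype _)
    · exact v₀.linearIndependent.map' (R ∘ₗ B.subtype)
        (LinearMap.ker_eq_bot.2 (hR.comp (Submodule.injective_subtype _)))
    · refine Disjoint.mono ?_ ?_ hdisj
      · rw [Submodule.span_le]
        rintro _ ⟨i, rfl⟩
        exact (b₀ i).2
      · rw [Submodule.span_le]
        rintro _ ⟨i, rfl⟩
        exact ⟨_, (v₀ i).2, rfl⟩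
  have hf₀ : f (Sum.elim (fun i => (b₀ i : W)) fun i => R (v₀ i)) ≠ 0 := by
    have hcard : Fintype.card (Fin p ⊕ Fin q) = finrank K W := by simpa using hpq
    let B := basisOfTopLeSpanOfCardEqFinrank _ (hli.span_eq_top_of_card_eq_finrank' hcard).ge hcard
    have := (AlternatingMap.map_basis_ne_zero_iff B f).2 hf
    rwa [coe_basisOfTopLeSpanOfCardEqFinrank] at this
  refine ⟨f (Sum.elim (fun i => (b₀ i : W)) fun i => R (v₀ i)) * (g b₀ * g' v₀)⁻¹,
    mul_ne_zero hf₀ (inv_ne_zero (mul_ne_zero hb₀ hv₀)), fun b v => ?_⟩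
  rw [mul_right_comm, ← AlternatingMap.map_blocks_mul R f g g' b₀ v₀ b v, mul_assoc,
    mul_inv_cancel₀ (mul_ne_zero hb₀ hv₀), mul_one]

theorem AlternatingMap.eq_zero_of_ker [FiniteDimensional K W] [Fintype α]
    (hα : Fintype.card α = finrank K W) (f : W [⋀^α]→ₗ[K] K) (v : α → W) {l : Dual K W} (hl : l ≠ 0)
    (hv : ∀ i, l (v i) = 0) : f v = 0 := by
  refine f.map_linearDependent v fun hli => hl ?_
  have hspan := hli.span_eq_top_of_card_eq_finrank' hα
  have hle : Submodule.span K (Set.range v) ≤ LinearMap.ker l := by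
    rw [Submodule.span_le]
    rintro _ ⟨i, rfl⟩
    exact hv i
  rw [hspan, top_le_iff] at hle
  exact LinearMap.ker_eq_top.1 hle

/-- Moving the first vector of the second block to the front of the first block. -/
def blockShift (j m : ℕ) : Fin j ⊕ Fin (m + 1) ≃ Fin (j + 1) ⊕ Fin m where
  toFun := Sum.elim (fun i => Sum.inl i.succ) (Fin.cases (Sum.inl 0) fun i => Sum.inr i)
  invFun := Sum.elim (Fin.cases (Sum.inr 0) fun i => Sum.inl i) fun i => Sum.inr i.succ
  left_inv := by
    rintro (i | i)
    · simp
    · refine Fin.cases ?_ (fun k => ?_) i <;> simp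
  right_inv := by
    rintro (i | i)
    · refine Fin.cases ?_ (fun k => ?_) i <;> simp
    · simp

/-- Up to reindexing, f and f' are two volume forms of W, hence proportional. The factor depends on
the forms alone and not on the vectors, which later makes it common to all faces of one dimension.
-/
theorem exists_blockShift [FiniteDimensional K W] {j j' m m' : ℕ} (hj : j' = j + 1)
    (hm : m' = m + 1) (hdim : j' + m = finrank K W) {f : W [⋀^Fin j ⊕ Fin m']→ₗ[K] K} (hf : f ≠ 0)
    {f' : W [⋀^Fin j' ⊕ Fin m]→ₗ[K] K} (hf' : f' ≠ 0) :
    ∃ k : K, k ≠ 0 ∧ ∀ (b : Fin j → W) (y : W) (x : Fin m → W),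
      f (Sum.elim b (consCast hm y x)) = k * f' (Sum.elim (consCast hj y b) x) := by
  subst hj hm
  have hcard : Fintype.card (Fin (j + 1) ⊕ Fin m) = finrank K W := by simpa using hdim
  let b₀ : Basis (Fin (j + 1) ⊕ Fin m) K W :=
    (finBasisOfFinrankEq K W hdim.symm).reindex finSumFinEquiv.symm
  have h0 : f' b₀ ≠ 0 := (AlternatingMap.map_basis_ne_zero_iff b₀ f').2 hf'
  have h1 : f.domDomCongr (blockShift j m) ≠ 0 := fun h => hf (by
    rwa [AlternatingMap.domDomCongr_eq_zero_iff] at h)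
  refine ⟨f.domDomCongr (blockShift j m) b₀ * (f' b₀)⁻¹, mul_ne_zero
    ((AlternatingMap.map_basis_ne_zero_iff b₀ _).2 h1) (inv_ne_zero h0), fun b y x => ?_⟩
  have h2 := AlternatingMap.map_mul_map_basis (f.domDomCongr (blockShift j m)) f' b₀
    (Sum.elim (consCast rfl y b) x)
  have h3 : f.domDomCongr (blockShift j m) (Sum.elim (consCast rfl y b) x) =
      f (Sum.elim b (consCast rfl y x)) := by
    rw [AlternatingMap.domDomCongr_apply]
    congr 1
    funext i
    rcases i with i | i
    · rfl
    · refine Fin.cases ?_ (fun k => ?_) i <;> rfl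
  rw [h3] at h2
  field_simp
  exact h2

/-- An alternating map as a function of the first vector of the second block. -/
theorem exists_linear_consCast {m m' : ℕ} (hm : m' = m + 1) (f : W [⋀^α ⊕ Fin m']→ₗ[K] K)
    (b : α → W) (x : Fin m → W) :
    ∃ φ : W →ₗ[K] K, ∀ y, φ y = f (Sum.elim b (consCast hm y x)) := by
  classical
  subst hm
  refine ⟨f.toMultilinearMap.toLinearMap (Sum.elim b (consCast rfl 0 x)) (Sum.inr 0), fun y => ?_⟩
  rw [MultilinearMap.toLinearMap_apply, ← Sum.elim_update_right]
  change f _ = f _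
  congr 2
  funext i
  refine Fin.cases ?_ (fun k => ?_) i
  · simp [consCast]
  · rw [Function.update_of_ne (Fin.succ_ne_zero k)]
    rfl

end Blocks

/-! ### A scalar product on the dual space -/

section Riesz

/-- Positivity makes the map from B to its dual injective, hence bijective; c is the preimage of the
restriction of β u. -/
theorem exists_orthogonal_projection {K : Type*} [Field K] [LinearOrder K] {U : Type*}
    [AddCommGroup U] [Module K U] [FiniteDimensional K U] (β : U →ₗ[K] U →ₗ[K] K)
    (hβ : ∀ u, u ≠ 0 → 0 < β u u) (B : Submodule K U) (u : U) :
    ∃ c ∈ B, ∀ v ∈ B, β (u - c) v = 0 := by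
  let T : B →ₗ[K] Dual K B := β.compl₁₂ B.subtype B.subtype
  have hT : Function.Injective T := by
    rw [← LinearMap.ker_eq_bot, LinearMap.ker_eq_bot']
    intro c hc
    by_contra h
    have h1 : (c : U) ≠ 0 := by simpa using h
    have h2 : β c c = 0 := LinearMap.congr_fun hc c
    exact (hβ _ h1).ne' h2
  have hT' : Function.Surjective T :=
    (LinearMap.injective_iff_surjective_of_finrank_eq_finrank
      (Subspace.dual_finrank_eq (K := K) (V := B)).symm).1 hT
  obtain ⟨c, hc⟩ := hT' (β u ∘ₗ B.subtype)
  refine ⟨c, c.2, fun v hv => ?_⟩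
  have h1 : β c v = β u v := LinearMap.congr_fun hc ⟨v, hv⟩
  rw [map_sub, LinearMap.sub_apply, h1, sub_self]

variable (K : Type*) [Field K] (V : Type*) [AddCommGroup V] [Module K V] [FiniteDimensional K V]

/-- The isomorphism between a space and its dual that is given by some scalar product. -/
noncomputable def riesz : Dual K V →ₗ[K] V :=
  ∑ i, (LinearMap.toSpanSingleton K V (finBasis K V i)) ∘ₗ Dual.eval K V (finBasis K V i)

variable {K V}

theorem apply_riesz (u v : Dual K V) :
    u (riesz K V v) = ∑ i, v (finBasis K V i) * u (finBasis K V i) := by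
  simp [riesz, map_sum]

theorem apply_riesz_comm (u v : Dual K V) : u (riesz K V v) = v (riesz K V u) := by
  simp only [apply_riesz, mul_comm]

variable [LinearOrder K] [IsStrictOrderedRing K]

theorem apply_riesz_self_pos {u : Dual K V} (hu : u ≠ 0) : 0 < u (riesz K V u) := by
  rw [apply_riesz]
  refine lt_of_le_of_ne (Finset.sum_nonneg fun i _ => mul_self_nonneg _) fun h => hu ?_
  rw [eq_comm, Finset.sum_eq_zero_iff_of_nonneg fun i _ => mul_self_nonneg _] at h
  refine (finBasis K V).ext fun i => ?_
  simpa using h i (Finset.mem_univ i)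

theorem riesz_injective : Function.Injective (riesz K V) := by
  rw [← LinearMap.ker_eq_bot, LinearMap.ker_eq_bot']
  intro u hu
  by_contra h
  have := apply_riesz_self_pos h
  rw [hu, map_zero] at this
  exact lt_irrefl _ this

theorem exists_riesz_projection (B : Submodule K (Dual K V)) (u : Dual K V) :
    ∃ c ∈ B, ∀ v ∈ B, v (riesz K V (u - c)) = 0 :=
  exists_orthogonal_projection
    (LinearMap.mk₂ K (fun u v : Dual K V => v (riesz K V u)) (by simp) (by simp) (by simp) (by simp))
    (fun _ hu => apply_riesz_self_pos hu) B u

end Riesz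

/-- The form is fixed for each pair of block sizes and not for each face. The zero form serves as
default for sizes that do not add up to the dimension. -/
theorem exists_volume {K : Type*} [Field K] (W : Type*) [AddCommGroup W] [Module K W] [FiniteDimensional K W] (j m : ℕ) :
    ∃ f : W [⋀^Fin j ⊕ Fin m]→ₗ[K] K, j + m = finrank K W → f ≠ 0 := by
  by_cases h : j + m = finrank K W
  · let b : Basis (Fin j ⊕ Fin m) K W := (finBasisOfFinrankEq K W h.symm).reindex finSumFinEquiv.symm
    exact ⟨b.det, fun _ => b.det_ne_zero⟩
  · exact ⟨0, fun h' => absurd h' h⟩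

/-! ### Comparison of the incidence numbers of the two fans -/

namespace Fan

variable {K : Type*} [Field K] [LinearOrder K] [IsStrictOrderedRing K]
variable {V : Type*} [AddCommGroup V] [Module K V] [FiniteDimensional K V]

/-- A basis of the span of a cone. -/
noncomputable def basis (σ : PointedCone K V) : Basis (Fin (coneDim σ)) K (coneSpan σ) :=
  finBasis K (coneSpan σ)

theorem form_basis_ne_zero (X : Fan K V) (o : X.Orientations) (σ : X.Cone) :
    X.form o σ (basis σ.1) ≠ 0 :=
  (AlternatingMap.map_basis_ne_zero_iff _ _).2 (X.form_ne_zero o σ)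

end Fan

namespace Polytope

variable {K : Type*} [Field K] [LinearOrder K] [IsStrictOrderedRing K]
variable {V : Type*} [AddCommGroup V] [Module K V] [FiniteDimensional K V]
variable {Δ : Polytope K V} (hΔ : affineSpan K Δ.carrier = ⊤)

/-- The volume forms of a face and of its normal cone, compared with a volume form of the space. -/
theorem exists_comparison (oN : (Δ.normalFan hΔ).Orientations) (oC : Δ.coneFan.Orientations)
    (ν : (Δ.normalFan hΔ).Cone)
    {G : (V × K) [⋀^Fin (coneDim (faceOfNormal hΔ ν).1) ⊕ Fin (coneDim ν.1)]→ₗ[K] K} (hG : G ≠ 0) :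
    ∃ c : K, c ≠ 0 ∧ ∀ (b : Fin (coneDim (faceOfNormal hΔ ν).1) → coneSpan (faceOfNormal hΔ ν).1)
      (v : Fin (coneDim ν.1) → coneSpan ν.1),
      G (Sum.elim (fun i => (b i : V × K)) fun i => (riesz K V (v i), 0)) =
        c * (Δ.coneFan.form oC (faceOfNormal hΔ ν) b * (Δ.normalFan hΔ).form oN ν v) := by
  -- The span of σ and the image of span ν under `riesz` meet in zero: v in span ν kills lin σ,
  -- whereas v is positive at its own image unless v = 0.
  refine AlternatingMap.exists_map_blocks_eq (LinearMap.inl K V K ∘ₗ riesz K V)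
    (LinearMap.inl_injective.comp riesz_injective) (Submodule.disjoint_def.2 ?_) rfl rfl ?_ hG
    (Δ.coneFan.form_ne_zero oC _) ((Δ.normalFan hΔ).form_ne_zero oN ν)
  · rintro _ hx ⟨v, hv, rfl⟩
    have hv' : v ∈ coneSpan ν.1 := hv
    rw [coneSpan_normal hΔ ν] at hv'
    have h0 : v (riesz K V v) = 0 := (Submodule.mem_dualAnnihilator v).1 hv' _ hx
    by_cases hv0 : v = 0
    · rw [hv0, map_zero]
    · exact absurd h0 (apply_riesz_self_pos hv0).ne'
  · exact (coneDim_faceOfNormal hΔ ν).trans (by rw [finrank_prod, finrank_self])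

theorem exists_sign (x : K) (hx : x ≠ 0) : ∃ s : K, (s = 1 ∨ s = -1) ∧ 0 < x * s := by
  rcases lt_or_gt_of_ne hx with h | h
  · exact ⟨-1, Or.inr rfl, by linarith⟩
  · exact ⟨1, Or.inl rfl, by linarith⟩

/-- The comparison constants of a face and a facet of it. -/
theorem comparison_facet {oN : (Δ.normalFan hΔ).Orientations} {oC : Δ.coneFan.Orientations}
    {ν₁ ν₂ : (Δ.normalFan hΔ).Cone} (hN : Fan.IsFacetOf ν₂.1 ν₁.1)
    (hC : Fan.IsFacetOf (faceOfNormal hΔ ν₁).1 (faceOfNormal hΔ ν₂).1)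
    {G₁ : (V × K) [⋀^Fin (coneDim (faceOfNormal hΔ ν₁).1) ⊕ Fin (coneDim ν₁.1)]→ₗ[K] K}
    {G₂ : (V × K) [⋀^Fin (coneDim (faceOfNormal hΔ ν₂).1) ⊕ Fin (coneDim ν₂.1)]→ₗ[K] K}
    {c₁ c₂ k : K}
    (h₁ : ∀ (b : Fin (coneDim (faceOfNormal hΔ ν₁).1) → coneSpan (faceOfNormal hΔ ν₁).1)
      (v : Fin (coneDim ν₁.1) → coneSpan ν₁.1),
      G₁ (Sum.elim (fun i => (b i : V × K)) fun i => (riesz K V (v i), 0)) =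
        c₁ * (Δ.coneFan.form oC (faceOfNormal hΔ ν₁) b * (Δ.normalFan hΔ).form oN ν₁ v))
    (h₂ : ∀ (b : Fin (coneDim (faceOfNormal hΔ ν₂).1) → coneSpan (faceOfNormal hΔ ν₂).1)
      (v : Fin (coneDim ν₂.1) → coneSpan ν₂.1),
      G₂ (Sum.elim (fun i => (b i : V × K)) fun i => (riesz K V (v i), 0)) =
        c₂ * (Δ.coneFan.form oC (faceOfNormal hΔ ν₂) b * (Δ.normalFan hΔ).form oN ν₂ v))
    (hk : ∀ (b : Fin (coneDim (faceOfNormal hΔ ν₁).1) → V × K) (y : V × K)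
      (x : Fin (coneDim ν₂.1) → V × K), G₁ (Sum.elim b (consCast hN.2 y x)) =
        k * G₂ (Sum.elim (consCast hC.2 y b) x)) :
    ∃ x y p q : K, (Δ.normalFan hΔ).incidence oN ν₂ ν₁ * x < 0 ∧
      Δ.coneFan.incidence oC (faceOfNormal hΔ ν₁) (faceOfNormal hΔ ν₂) * y < 0 ∧ 0 < p ∧ 0 < q ∧
      c₁ * x * p = k * c₂ * y * q := by
  obtain ⟨lN, hlN, hlN0, -, hsN⟩ := (Δ.normalFan hΔ).exists_incidence_eq oN hN
  obtain ⟨lC, hlC, -, -, hsC⟩ := Δ.coneFan.exists_incidence_eq oC hC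
  have hσ₁ := faceOfNormal_isFaceOf hΔ ν₁
  have hσ₂ := faceOfNormal_isFaceOf hΔ ν₂
  have hν₁ := faceOfNormal_isNormal hΔ ν₁
  have hν₂ := faceOfNormal_isNormal hΔ ν₂
  obtain ⟨w, hw, hw₁⟩ : ∃ w ∈ (faceOfNormal hΔ ν₂).1, w ∉ (faceOfNormal hΔ ν₁).1 := by
    by_contra! hcon
    have := PointedCone.coneDim_mono hcon
    have := hC.2
    omega
  obtain ⟨u, hu, hu₂⟩ : ∃ u ∈ ν₁.1, u ∉ ν₂.1 := by
    by_contra! hcon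
    have := PointedCone.coneDim_mono hcon
    have := hN.2
    omega
  obtain ⟨f, hfu, hf0, hf⟩ := (hν₁ u).1 hu
  have hfspan : ∀ z ∈ coneSpan (faceOfNormal hΔ ν₁).1, f z = 0 := fun z hz =>
    (Submodule.span_le.2 hf : coneSpan _ ≤ LinearMap.ker f) hz
  -- If f vanished at w, it would vanish on the whole span of the larger face, by codimension one,
  -- and u would belong to ν₂.
  have hfw : 0 < f w := by
    refine lt_of_le_of_ne (hf0 w (hσ₂.le hw)) fun h => hu₂ ((hν₂ u).2 ⟨f, hfu, hf0, ?_⟩)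
    have hlt : coneSpan (faceOfNormal hΔ ν₁).1 <
        LinearMap.ker f ⊓ coneSpan (faceOfNormal hΔ ν₂).1 := by
      refine lt_of_le_of_ne (le_inf hfspan (PointedCone.coneSpan_mono hC.1.le)) fun heq => hw₁ ?_
      refine hC.1.mem_of_mem_coneSpan hw ?_
      rw [heq]
      exact ⟨h.symm, PointedCone.mem_coneSpan hw⟩
    have h1 := Submodule.finrank_lt_finrank_of_lt hlt
    have h2 := hC.2
    unfold coneDim at h2
    have h3 := Submodule.eq_of_le_of_finrank_le
      (inf_le_right : LinearMap.ker f ⊓ coneSpan (faceOfNormal hΔ ν₂).1 ≤ _) (by omega)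
    intro z hz
    have hz' := PointedCone.mem_coneSpan hz
    rw [← h3] at hz'
    exact hz'.1
  -- make `u` orthogonal to the span of `ν₂`
  obtain ⟨c, hc, horth⟩ := exists_riesz_projection (coneSpan ν₂.1) u
  obtain ⟨fc, hfc, hfc0⟩ := exists_extension hσ₂ (faceOfNormal_ne_bot hΔ ν₂)
    (v := c) (by rw [← coneSpan_normal]; exact hc)
  have hcν₁ : c ∈ coneSpan ν₁.1 := PointedCone.coneSpan_mono hN.1.le hc
  have hu0 : u - c ≠ 0 := fun h => hu₂ (hN.1.mem_of_mem_coneSpan hu (by rw [sub_eq_zero.1 h]; exact hc))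
  -- The kernel of g contains the span of the smaller face and the image of span ν₂. Both w and the
  -- image of u - c are on its positive side.
  let g : Dual K (V × K) := f - fc
  have hg : ∀ y, g (y, 0) = (u - c) y := fun y => by simp [g, hfu, hfc]
  have hgσ : ∀ z ∈ coneSpan (faceOfNormal hΔ ν₁).1, g z = 0 := fun z hz => by
    simp [g, hfspan z hz, hfc0 z (PointedCone.coneSpan_mono hC.1.le hz)]
  have hgw : g w = f w := by simp [g, hfc0 w (PointedCone.mem_coneSpan hw)]
  have hgu : 0 < g (riesz K V (u - c), 0) := by
    rw [hg]
    exact apply_riesz_self_pos hu0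
  have hgN : ∀ v ∈ coneSpan ν₂.1, g (riesz K V v, 0) = 0 := fun v hv => by
    rw [hg, apply_riesz_comm]
    exact horth v hv
  let b : Basis (Fin (coneDim (faceOfNormal hΔ ν₁).1)) K (coneSpan (faceOfNormal hΔ ν₁).1) :=
    Fan.basis _
  let v : Basis (Fin (coneDim ν₂.1)) K (coneSpan ν₂.1) := Fan.basis _
  have hb : Δ.coneFan.form oC (faceOfNormal hΔ ν₁) b ≠ 0 :=
    Δ.coneFan.form_basis_ne_zero oC _
  have hv : (Δ.normalFan hΔ).form oN ν₂ v ≠ 0 :=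
    (Δ.normalFan hΔ).form_basis_ne_zero oN _
  obtain ⟨φ, hφ⟩ := exists_linear_consCast hN.2 G₁ (fun i => (b i : V × K))
    fun i => (riesz K V (v i), 0)
  have hu' : u - c ∈ coneSpan ν₁.1 := Submodule.sub_mem _ (PointedCone.mem_coneSpan hu) hcν₁
  -- φ inserts one vector between the two fixed blocks. It is expanded along the facet ν₂ of ν₁
  -- here, and in `e2`, after moving that vector to the first block, along the facet of the cone
  -- over the polytope.
  have e1 : φ (riesz K V (u - c), 0) = c₁ * lN ⟨u, PointedCone.mem_coneSpan hu⟩ *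
      (Δ.coneFan.form oC (faceOfNormal hΔ ν₁) b * (Δ.normalFan hΔ).form oN ν₂ v) := by
    have h3 := h₁ b (consCast hN.2 ⟨u - c, hu'⟩
      (Submodule.inclusion (PointedCone.coneSpan_mono hN.1.le) ∘ v))
    have h4 : (fun i => ((riesz K V ((consCast hN.2 (⟨u - c, hu'⟩ : coneSpan ν₁.1)
        (Submodule.inclusion (PointedCone.coneSpan_mono hN.1.le) ∘ v) i : coneSpan ν₁.1) : Dual K V),
        0) : V × K)) = consCast hN.2 (riesz K V (u - c), 0) fun i => (riesz K V (v i), 0) := by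
      refine eq_consCast hN.2 (fun j hj => ?_) fun i j hij => ?_
      · simp only [consCast_zero hN.2 _ _ j hj]
      · simp only [consCast_succ hN.2 _ _ i j hij]
        rfl
    rw [h4] at h3
    have h5 : lN ⟨u - c, hu'⟩ = lN ⟨u, PointedCone.mem_coneSpan hu⟩ :=
      hlN0 _ _ (by simpa using hc)
    rw [hφ, h3, hlN, h5]
    ring
  have e2 : φ w = k * c₂ * lC ⟨w, PointedCone.mem_coneSpan hw⟩ *
      (Δ.coneFan.form oC (faceOfNormal hΔ ν₁) b * (Δ.normalFan hΔ).form oN ν₂ v) := by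
    have h3 := h₂ (consCast hC.2 ⟨w, PointedCone.mem_coneSpan hw⟩
      (Submodule.inclusion (PointedCone.coneSpan_mono hC.1.le) ∘ b)) v
    have h4 : (fun i => ((consCast hC.2
        (⟨w, PointedCone.mem_coneSpan hw⟩ : coneSpan (faceOfNormal hΔ ν₂).1)
        (Submodule.inclusion (PointedCone.coneSpan_mono hC.1.le) ∘ b) i :
          coneSpan (faceOfNormal hΔ ν₂).1) : V × K)) = consCast hC.2 w fun i => (b i : V × K) := by
      refine eq_consCast hC.2 (fun j hj => ?_) fun i j hij => ?_
      · simp only [consCast_zero hC.2 _ _ j hj]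
      · simp only [consCast_succ hC.2 _ _ i j hij]
        rfl
    rw [h4] at h3
    rw [hφ, hk, h3, hlC]
    ring
  -- This combination lies in the kernel of g, as do all other arguments, so the volume form
  -- vanishes there. That links the two expansions.
  have hφ0 : φ (g w • (riesz K V (u - c), (0 : K)) - g (riesz K V (u - c), 0) • w) = 0 := by
    rw [hφ]
    have hcard : Fintype.card (Fin (coneDim (faceOfNormal hΔ ν₁).1) ⊕ Fin (coneDim ν₁.1)) =
        finrank K (V × K) := by
      rw [Fintype.card_sum, Fintype.card_fin, Fintype.card_fin, coneDim_faceOfNormal, finrank_prod,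
        finrank_self]
    refine AlternatingMap.eq_zero_of_ker hcard G₁ _ (l := g) (fun h => ?_) ?_
    · rw [h] at hgu
      exact lt_irrefl _ hgu
    · rintro (i | i)
      · exact hgσ _ (b i).2
      · rw [Sum.elim_inr]
        by_cases hi : i.val = 0
        · rw [consCast_zero hN.2 _ _ i hi, map_sub, map_smul, map_smul, smul_eq_mul, smul_eq_mul]
          ring
        · have hlt : i.val - 1 < coneDim ν₂.1 := by
            have := i.2
            have := hN.2
            omega
          rw [consCast_succ hN.2 _ _ ⟨i.val - 1, hlt⟩ i (by simp only; omega)]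
          exact hgN _ (v _).2
  rw [map_sub, map_smul, map_smul, e1, e2, hgw, smul_eq_mul, smul_eq_mul] at hφ0
  refine ⟨_, _, f w, g (riesz K V (u - c), 0), hsN u hu hu₂, hsC w hw hw₁, hfw, hgu, ?_⟩
  refine mul_right_cancel₀ (mul_ne_zero hb hv) ?_
  linear_combination hφ0

/-- Up to signs, the incidence numbers of the normal fan are those of the cone over the polytope. -/
theorem exists_signs (oN : (Δ.normalFan hΔ).Orientations) (oC : Δ.coneFan.Orientations) :
    ∃ s : (Δ.normalFan hΔ).Cone → K, (∀ ν, s ν ≠ 0) ∧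
      ∀ j : ℕ, ∃ k : K, k ≠ 0 ∧ ∀ ν₁ ν₂ : (Δ.normalFan hΔ).Cone, coneDim (faceOfNormal hΔ ν₁).1 = j →
        (Δ.normalFan hΔ).incidence oN ν₂ ν₁ * s ν₁ =
          k * (Δ.coneFan.incidence oC (faceOfNormal hΔ ν₁) (faceOfNormal hΔ ν₂) * s ν₂) := by
  have hD : finrank K (V × K) = finrank K V + 1 := by rw [finrank_prod, finrank_self]
  choose G hG using exists_volume (K := K) (V × K)
  have hcmp : ∀ ν : (Δ.normalFan hΔ).Cone, _ := fun ν =>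
    exists_comparison hΔ oN oC ν (hG (coneDim (faceOfNormal hΔ ν).1) (coneDim ν.1)
      (by rw [coneDim_faceOfNormal, hD]))
  choose c hc0 hc using hcmp
  choose s hs1 hs using fun ν => exists_sign (c ν) (hc0 ν)
  refine ⟨s, fun ν => by rcases hs1 ν with h | h <;> simp [h], fun j => ?_⟩
  -- If j + 1 exceeds the dimension of the space, no facet relation starts in dimension j and any
  -- factor works.
  by_cases hj : ∃ m, j + 1 + m = finrank K (V × K)
  swap
  · refine ⟨1, one_ne_zero, fun ν₁ ν₂ h1 => ?_⟩
    have hnot : ¬ Fan.IsFacetOf ν₂.1 ν₁.1 := by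
      intro h
      have := coneDim_faceOfNormal hΔ ν₁
      have := h.2
      exact hj ⟨coneDim ν₂.1, by omega⟩
    have hnot' := mt (isFacetOf_faceOfNormal_iff hΔ ν₁ ν₂).1 hnot
    rw [Fan.incidence, Fan.incidence, if_neg hnot, if_neg hnot']
    simp
  obtain ⟨m, hm⟩ := hj
  obtain ⟨j', hj'⟩ : ∃ j', j' = j + 1 := ⟨_, rfl⟩
  obtain ⟨m', hm'⟩ : ∃ m', m' = m + 1 := ⟨_, rfl⟩
  obtain ⟨k, hk0, hk⟩ := exists_blockShift hj' hm' (by omega) (hG j m' (by omega))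
    (hG j' m (by omega))
  obtain ⟨κ, hκ1, hκ⟩ := exists_sign k hk0
  refine ⟨κ, by rcases hκ1 with h | h <;> simp [h], fun ν₁ ν₂ h1 => ?_⟩
  by_cases hN : Fan.IsFacetOf ν₂.1 ν₁.1
  swap
  · have hnot' := mt (isFacetOf_faceOfNormal_iff hΔ ν₁ ν₂).1 hN
    rw [Fan.incidence, Fan.incidence, if_neg hN, if_neg hnot']
    simp
  have hC := (isFacetOf_faceOfNormal_iff hΔ ν₁ ν₂).2 hN
  have d1 := coneDim_faceOfNormal hΔ ν₁
  have d2 := coneDim_faceOfNormal hΔ ν₂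
  have d3 := hN.2
  have h2 : coneDim (faceOfNormal hΔ ν₂).1 = j' := by omega
  have h3 : coneDim ν₁.1 = m' := by omega
  have h4 : coneDim ν₂.1 = m := by omega
  subst h1 h2 h3 h4
  obtain ⟨x, y, p, q, hx, hy, hp, hq, heq⟩ := comparison_facet hΔ hN hC (hc ν₁) (hc ν₂) hk
  obtain ⟨-, -, -, heN, -⟩ := (Δ.normalFan hΔ).exists_incidence_eq oN hN
  obtain ⟨-, -, -, heC, -⟩ := Δ.coneFan.exists_incidence_eq oC hC
  -- Both sides of the claim are ±1, and both become negative after multiplication by the same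
  -- number; so they are equal.
  have n1 : c ν₁ * x * p * ((Δ.normalFan hΔ).incidence oN ν₂ ν₁ * s ν₁) < 0 := by
    have := mul_neg_of_pos_of_neg (mul_pos (hs ν₁) hp) hx
    convert this using 1
    ring
  have n2 : c ν₁ * x * p *
      (κ * (Δ.coneFan.incidence oC (faceOfNormal hΔ ν₁) (faceOfNormal hΔ ν₂) * s ν₂)) < 0 := by
    have := mul_neg_of_pos_of_neg (mul_pos (mul_pos hκ (hs ν₂)) hq) hy
    rw [heq]
    convert this using 1
    ring
  have hpm : ∀ a b : K, (a = 1 ∨ a = -1) → (b = 1 ∨ b = -1) → (a * b = 1 ∨ a * b = -1) := by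
    rintro a b (rfl | rfl) (rfl | rfl) <;> simp
  have hN1 : ((Δ.normalFan hΔ).incidence oN ν₂ ν₁ : K) = 1 ∨
      ((Δ.normalFan hΔ).incidence oN ν₂ ν₁ : K) = -1 := by
    rcases heN with h | h <;> simp [h]
  have hC1 : (Δ.coneFan.incidence oC (faceOfNormal hΔ ν₁) (faceOfNormal hΔ ν₂) : K) = 1 ∨
      (Δ.coneFan.incidence oC (faceOfNormal hΔ ν₁) (faceOfNormal hΔ ν₂) : K) = -1 := by
    rcases heC with h | h <;> simp [h]
  rcases hpm _ _ hN1 (hs1 ν₁) with h | h <;> rcases hpm _ _ hκ1 (hpm _ _ hC1 (hs1 ν₂)) with h' | h' <;>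
    rw [h] at n1 ⊢ <;> rw [h'] at n2 ⊢ <;> linarith

end Polytope


/-! ### Dual of a cohomology space -/

section LinearAlgebra

variable {K : Type*} [Field K]

/-- The dual of the cohomology of `A → B → C`, described by the linear forms on `B`. -/
theorem exists_toDual_cohomology {A B C T : Type*} [AddCommGroup A] [Module K A] [AddCommGroup B]
    [Module K B] [AddCommGroup C] [Module K C] [AddCommGroup T] [Module K T]
    (f : A →ₗ[K] B) (g : B →ₗ[K] C) (hgf : g ∘ₗ f = 0) (φ : T →ₗ[K] Dual K B)
    (hφ : ∀ t, φ t ∘ₗ f = 0) (hsurj : ∀ β : Dual K B, β ∘ₗ f = 0 → ∃ t, φ t = β) :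
    ∃ p : T →ₗ[K] Dual K (LinearMap.ker g ⧸ (LinearMap.range f).comap (LinearMap.ker g).subtype),
      Function.Surjective p ∧ ∀ t, p t = 0 ↔ ∃ γ : Dual K C, φ t = γ ∘ₗ g := by
  set R := (LinearMap.range f).comap (LinearMap.ker g).subtype with hR
  let ψ : T →ₗ[K] Dual K (LinearMap.ker g) := (LinearMap.ker g).subtype.dualMap ∘ₗ φ
  have hψ : ∀ t, ψ t ∈ R.dualAnnihilator := by
    intro t
    rw [Submodule.mem_dualAnnihilator]
    rintro ⟨b, hb⟩ ⟨a, ha⟩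
    change φ t b = 0
    change f a = b at ha
    rw [← ha]
    exact LinearMap.congr_fun (hφ t) a
  refine ⟨R.dualQuotEquivDualAnnihilator.symm.toLinearMap ∘ₗ LinearMap.codRestrict _ ψ hψ,
    fun δ => ?_, fun t => ?_⟩
  -- A form on the cohomology, pulled back to the cocycles, extends to B and kills the image of f.
  · obtain ⟨β, hβ⟩ := LinearMap.exists_extend (δ ∘ₗ R.mkQ)
    have hβf : β ∘ₗ f = 0 := by
      ext a
      have ha : f a ∈ LinearMap.ker g := LinearMap.congr_fun hgf a
      have h1 : β (f a) = δ (R.mkQ ⟨f a, ha⟩) := LinearMap.congr_fun hβ ⟨f a, ha⟩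
      have h2 : R.mkQ ⟨f a, ha⟩ = 0 := (Submodule.Quotient.mk_eq_zero _).2 ⟨a, rfl⟩
      rw [LinearMap.comp_apply, h1, h2, map_zero, LinearMap.zero_apply]
    obtain ⟨t, ht⟩ := hsurj β hβf
    refine ⟨t, ?_⟩
    rw [LinearMap.comp_apply, LinearEquiv.coe_coe, LinearEquiv.symm_apply_eq]
    refine Subtype.ext ?_
    change (LinearMap.ker g).subtype.dualMap (φ t) = R.dualQuotEquivDualAnnihilator δ
    rw [ht]
    ext b
    exact LinearMap.congr_fun hβ b
  · rw [LinearMap.comp_apply, LinearEquiv.coe_coe, LinearEquiv.map_eq_zero_iff]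
    have h1 : LinearMap.codRestrict _ ψ hψ t = 0 ↔ φ t ∈ (LinearMap.ker g).dualAnnihilator := by
      rw [Submodule.mem_dualAnnihilator, Subtype.ext_iff]
      change ψ t = 0 ↔ _
      constructor
      · intro h b hb
        exact LinearMap.congr_fun h ⟨b, hb⟩
      · intro h
        ext b
        exact h b b.2
    -- Forms that vanish on ker g are exactly those that factor through g.
    rw [h1, ← LinearMap.range_dualMap_eq_dualAnnihilator_ker]
    exact ⟨fun ⟨γ, hγ⟩ => ⟨γ, hγ.symm⟩, fun ⟨γ, hγ⟩ => ⟨γ, hγ.symm⟩⟩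

end LinearAlgebra

/-! ### Cochains represented by functions with values in one fixed space -/

namespace Fan

variable {K : Type*} [Field K] [LinearOrder K] [IsStrictOrderedRing K]
variable {V : Type*} [AddCommGroup V] [Module K V]

/-- The matrix of incidence numbers, with entries in the field. -/
noncomputable def matrix (X : Fan K V) (o : X.Orientations) (τ σ : X.Cone) : K := X.incidence o τ σ

/-- The functions on the cones that are supported in dimension `k`. -/
def degree (X : Fan K V) (E : Type*) [AddCommGroup E] [Module K E] (k : ℤ) :
    Submodule K (X.Cone → E) where
  carrier := {a | ∀ σ, (coneDim σ.1 : ℤ) ≠ k → a σ = 0}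
  zero_mem' _ _ := rfl
  add_mem' ha hb σ hσ := by rw [Pi.add_apply, ha σ hσ, hb σ hσ, add_zero]
  smul_mem' c a ha σ hσ := by rw [Pi.smul_apply, ha σ hσ, smul_zero]

variable {X : Fan K V} {o : X.Orientations} {E : Type*} [AddCommGroup E] [Module K E]

theorem coboundary_mem_degree {k l : ℤ} (hl : k + 1 = l) {a : X.Cone → E} (ha : a ∈ X.degree E k) :
    coboundary (X.matrix o) a ∈ X.degree E l := by
  intro σ hσ
  refine coboundary_eq_zero fun τ hτ => ha τ fun hτk => hσ ?_
  have := (isFacetOf_of_incidence_ne_zero (Int.cast_ne_zero.1 hτ)).2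
  omega

theorem dComponent_eq_zero {F : CohomologicalSystem X} {τ σ : X.Cone} (h : ¬ IsFacetOf τ.1 σ.1) :
    F.dComponent o τ σ = 0 := by
  rw [CohomologicalSystem.dComponent]
  split_ifs
  · rw [incidence, if_neg h, zero_smul]
  · rfl

theorem matrix_eq_zero {τ σ : X.Cone} (h : ¬ IsFacetOf τ.1 σ.1) : X.matrix o τ σ = 0 := by
  rw [matrix, incidence, if_neg h, Int.cast_zero]

theorem sum_degree_eq {k : ℤ} {M : Type*} [AddCommMonoid M] [Fintype {σ : X.Cone // (coneDim σ.1 : ℤ) = k}]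
    (f : X.Cone → M) (hf : ∀ σ, (coneDim σ.1 : ℤ) ≠ k → f σ = 0) :
    ∑ σ : {σ : X.Cone // (coneDim σ.1 : ℤ) = k}, f σ.1 = ∑ σ, f σ := by
  classical
  rw [← Finset.sum_subtype (Finset.univ.filter fun σ : X.Cone => (coneDim σ.1 : ℤ) = k) (by simp) f]
  refine Finset.sum_subset (Finset.filter_subset _ _) fun σ _ hσ => hf σ ?_
  simpa using hσ

/-- A system is presented if its spaces are quotients of one space, compatibly with face maps. -/
theorem d_presented {F : CohomologicalSystem X} (π : ∀ σ : X.Cone, E →ₗ[K] F.obj σ)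
    (hπ : ∀ {τ σ : X.Cone} (h : τ.1.IsFaceOf σ.1) (x : E), F.map h (π τ x) = π σ x) {k l : ℤ}
    {a : X.Cone → E} (ha : a ∈ X.degree E k) (σ : {σ : X.Cone // (coneDim σ.1 : ℤ) = l}) :
    F.d o k l (fun τ => π τ.1 (a τ.1)) σ = π σ.1 (coboundary (X.matrix o) a σ.1) := by
  have hcomp : ∀ τ x, F.dComponent o τ σ.1 (π τ x) = π σ.1 (X.matrix o τ σ.1 • x) := by
    intro τ x
    by_cases hf : IsFacetOf τ.1 σ.1.1
    · rw [CohomologicalSystem.dComponent, dif_pos hf.1, LinearMap.smul_apply, hπ, matrix, map_smul,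
        Int.cast_smul_eq_zsmul]
    · rw [dComponent_eq_zero hf, matrix_eq_zero hf, zero_smul, map_zero, LinearMap.zero_apply]
  rw [CohomologicalSystem.d, LinearMap.pi_apply, LinearMap.sum_apply, coboundary_apply, map_sum]
  simp only [LinearMap.comp_apply, LinearMap.proj_apply, hcomp]
  exact @sum_degree_eq _ _ _ _ _ _ _ X k _ _ (Fintype.ofFinite _)
    (fun τ => π σ.1 (X.matrix o τ σ.1 • a τ)) fun τ hτ => by rw [ha τ hτ, smul_zero, map_zero]

/-- The cochain of a presented system that is given by a function. -/
def presented (F : CohomologicalSystem X) (π : ∀ σ : X.Cone, E →ₗ[K] F.obj σ) (k : ℤ) :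
    (X.Cone → E) →ₗ[K] F.Cochain k :=
  LinearMap.pi fun σ => π σ.1 ∘ₗ LinearMap.proj σ.1

theorem presented_apply (F : CohomologicalSystem X) (π : ∀ σ : X.Cone, E →ₗ[K] F.obj σ) (k : ℤ)
    (a : X.Cone → E) (σ) : presented F π k a σ = π σ.1 (a σ.1) := rfl

theorem d_presented_eq {F : CohomologicalSystem X} {π : ∀ σ : X.Cone, E →ₗ[K] F.obj σ}
    (hπ : ∀ {τ σ : X.Cone} (h : τ.1.IsFaceOf σ.1) (x : E), F.map h (π τ x) = π σ x) {k l : ℤ}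
    {a : X.Cone → E} (ha : a ∈ X.degree E k) :
    F.d o k l (presented F π k a) = presented F π l (coboundary (X.matrix o) a) :=
  funext fun σ => d_presented π hπ ha σ

theorem exists_presented_eq {F : CohomologicalSystem X} {π : ∀ σ : X.Cone, E →ₗ[K] F.obj σ}
    (hπ : ∀ σ, Function.Surjective (π σ)) {k : ℤ} (b : F.Cochain k) :
    ∃ a ∈ X.degree E k, presented F π k a = b := by
  classical
  choose r hr using hπ
  refine ⟨fun σ => if h : (coneDim σ.1 : ℤ) = k then r σ (b ⟨σ, h⟩) else 0,
    fun σ hσ => dif_neg hσ, ?_⟩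
  funext σ
  rw [presented_apply, dif_pos σ.2, hr]

/-- The projection to the spaces of the quotient system. -/
def quotientProj (X : Fan K V) (σ : X.Cone) : V →ₗ[K] X.quotientSystem.obj σ :=
  (coneSpan σ.1).mkQ

theorem quotientProj_map {τ σ : X.Cone} (h : τ.1.IsFaceOf σ.1) (x : V) :
    X.quotientSystem.map h (X.quotientProj τ x) = X.quotientProj σ x := rfl

theorem quotientProj_surjective (σ : X.Cone) : Function.Surjective (X.quotientProj σ) :=
  Submodule.mkQ_surjective _

theorem quotientProj_eq_zero_iff {σ : X.Cone} {x : V} : X.quotientProj σ x = 0 ↔ x ∈ coneSpan σ.1 :=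
  Submodule.Quotient.mk_eq_zero _

/-- The projection to the first exterior powers of the quotient system. -/
noncomputable def extProj (X : Fan K V) (σ : X.Cone) :
    V →ₗ[K] (X.quotientSystem.exteriorPower 1).obj σ :=
  (exteriorPower.oneEquiv K (V ⧸ coneSpan σ.1)).symm.toLinearMap ∘ₗ (coneSpan σ.1).mkQ

theorem extProj_map {τ σ : X.Cone} (h : τ.1.IsFaceOf σ.1) (x : V) :
    (X.quotientSystem.exteriorPower 1).map h (X.extProj τ x) = X.extProj σ x := by
  have h1 := LinearMap.congr_fun (exteriorPower.oneEquiv_naturality (R := K)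
    (X.quotientSystem.map h)) (X.extProj τ x)
  refine (exteriorPower.oneEquiv K (V ⧸ coneSpan σ.1)).injective (h1.trans ?_)
  change X.quotientSystem.map h (exteriorPower.oneEquiv K (V ⧸ coneSpan τ.1)
    ((exteriorPower.oneEquiv K (V ⧸ coneSpan τ.1)).symm ((coneSpan τ.1).mkQ x))) =
    exteriorPower.oneEquiv K (V ⧸ coneSpan σ.1)
    ((exteriorPower.oneEquiv K (V ⧸ coneSpan σ.1)).symm ((coneSpan σ.1).mkQ x))
  rw [LinearEquiv.apply_symm_apply, LinearEquiv.apply_symm_apply]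
  rfl

theorem extProj_surjective (σ : X.Cone) : Function.Surjective (X.extProj σ) :=
  (exteriorPower.oneEquiv K (V ⧸ coneSpan σ.1)).symm.surjective.comp (Submodule.mkQ_surjective _)

theorem extProj_eq_zero_iff {σ : X.Cone} {x : V} : X.extProj σ x = 0 ↔ x ∈ coneSpan σ.1 := by
  change (exteriorPower.oneEquiv K (V ⧸ coneSpan σ.1)).symm ((coneSpan σ.1).mkQ x) = 0 ↔ _
  exact (LinearEquiv.map_eq_zero_iff _).trans (Submodule.Quotient.mk_eq_zero _)

end Fan


/-! ### Exactness of the constant complex and the rays of the cone -/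

namespace Polytope

theorem carrier_nonempty {K V : Type*} [Field K] [LinearOrder K] [AddCommGroup V] [Module K V]
    {Δ : Polytope K V} (hΔ : affineSpan K Δ.carrier = ⊤) : Δ.carrier.Nonempty := by
  rw [← affineSpan_nonempty (k := K), hΔ]
  exact ⟨0, trivial⟩

variable {K : Type*} [Field K] [LinearOrder K] [IsStrictOrderedRing K]
variable {V : Type*} [AddCommGroup V] [Module K V]

theorem exists_mem_cone_ne_zero {Δ : Polytope K V} (hΔ : affineSpan K Δ.carrier = ⊤)
    {h : Dual K (V × K)} (h0 : h ≠ 0) : ∃ x ∈ Δ.cone, h x ≠ 0 := by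
  by_contra! hcon
  have hall : ∀ y : V, h (y, 1) = 0 := by
    intro y
    have hy : y ∈ affineSpan K Δ.carrier := by rw [hΔ]; trivial
    refine affineSpan_induction hy (fun y hy => hcon _ (mem_cone hy)) fun c y z t hy hz ht => ?_
    rw [dual_prod_apply] at hy hz ht ⊢
    simp only [one_mul, vsub_eq_sub, vadd_eq_add] at *
    have h2 : h (c • (y - z) + t, 0) = c * (h (y, 0) - h (z, 0)) + h (t, 0) := by
      have : ((c • (y - z) + t, 0) : V × K) = c • ((y, 0) - (z, 0)) + (t, 0) := by ext <;> simp
      rw [this, map_add, map_smul, map_sub, smul_eq_mul]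
    rw [h2]
    linear_combination c * hy - c * hz + ht
  refine h0 (LinearMap.ext fun x => ?_)
  have h1 := hall 0
  have h2 := hall x.1
  rw [dual_prod_apply] at h2 ⊢
  rw [show h (0, 1) = 0 from h1] at *
  simp only [mul_zero, add_zero] at h2 ⊢
  exact h2

variable [FiniteDimensional K V] {E : Type*} [AddCommGroup E] [Module K E]

theorem coboundary_coboundary {Δ : Polytope K V} (o : Δ.coneFan.Orientations)
    (x : Δ.coneFan.Cone → E) :
    coboundary (Δ.coneFan.matrix o) (coboundary (Δ.coneFan.matrix o) x) = 0 :=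
  (Δ.isIncidenceMatrix o).coboundary_coboundary x

/-- The vertex of the cone over a polytope. -/
def vertex (Δ : Polytope K V) : Δ.coneFan.Cone :=
  ⟨⊥, PointedCone.IsFaceOf.of_mem_of_add_mem_left bot_le (by
    intro x y hx hy hxy
    by_contra hx0
    have h1 := snd_pos hx hx0
    have h2 : (x + y).2 = 0 := by rw [(Submodule.mem_bot _).1 hxy]; rfl
    have h3 : 0 ≤ y.2 := by
      by_cases hy0 : y = 0
      · rw [hy0]; exact le_rfl
      · exact (snd_pos hy hy0).le
    rw [Prod.snd_add] at h2
    linarith)⟩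

/-- The cone over a polytope, as a cone of its fan. -/
def top (Δ : Polytope K V) : Δ.coneFan.Cone := ⟨Δ.cone, PointedCone.IsFaceOf.refl _⟩

theorem coneDim_vertex (Δ : Polytope K V) : coneDim Δ.vertex.1 = 0 := by
  have : coneSpan Δ.vertex.1 = ⊥ := by
    refine Submodule.span_eq_bot.2 fun x hx => ?_
    exact (Submodule.mem_bot _).1 hx
  rw [coneDim, this, finrank_bot]

theorem coneSpan_vertex (Δ : Polytope K V) : coneSpan Δ.vertex.1 = ⊥ :=
  Submodule.finrank_eq_zero.1 Δ.coneDim_vertex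

theorem coneDim_eq_zero_iff {Δ : Polytope K V} {σ : Δ.coneFan.Cone} :
    coneDim σ.1 = 0 ↔ σ = Δ.vertex := by
  refine ⟨fun h => Subtype.ext ?_, fun h => h ▸ Δ.coneDim_vertex⟩
  have h1 : Δ.vertex.1.IsFaceOf σ.1 :=
    (Δ.vertex.2.isFaceOf_iff_le (show σ.1.IsFaceOf Δ.cone from σ.2)).2 (bot_le : (⊥ : PointedCone K (V × K)) ≤ σ.1)
  exact (h1.eq_of_coneDim_le (by omega)).symm

/-- Minus the height is negative on every nonzero vector of the cone, so `acyclicOn_neg` covers all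
faces at once. The primitive it provides is truncated to the right degree. -/
theorem exists_coboundary_eq {Δ : Polytope K V} (hne : Δ.carrier.Nonempty)
    (o : Δ.coneFan.Orientations) {k l : ℤ} (hl : l + 1 = k) {x : Δ.coneFan.Cone → E}
    (hx : x ∈ Δ.coneFan.degree E k) (hdx : coboundary (Δ.coneFan.matrix o) x = 0) :
    ∃ y ∈ Δ.coneFan.degree E l, coboundary (Δ.coneFan.matrix o) y = x := by
  classical
  obtain ⟨y₀, hy₀⟩ := hne
  obtain ⟨y, -, hy⟩ := (Δ.isIncidenceMatrix o).acyclicOn_neg (E := E) Δ.cone_fg Δ.vertex Δ.top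
    (-LinearMap.snd K V K) (bot_le : (⊥ : PointedCone K (V × K)) ≤ Δ.cone)
    (fun x hx => by rw [(Submodule.mem_bot _).1 hx, map_zero])
    ⟨(y₀, 1), mem_cone hy₀, by simp⟩ x
    (fun σ hσ => absurd ⟨(bot_le : (⊥ : PointedCone K (V × K)) ≤ σ.1), σ.2.le, fun z hz hz0 => by
      simpa using snd_pos (σ.2.le hz) fun h => hz0 (h ▸ Submodule.zero_mem _)⟩ hσ)
    fun σ _ => congrFun hdx σ
  refine ⟨fun σ => if (coneDim σ.1 : ℤ) = l then y σ else 0, fun σ hσ => if_neg hσ, ?_⟩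
  funext σ
  by_cases hσ : (coneDim σ.1 : ℤ) = k
  · rw [← hy σ ⟨(bot_le : (⊥ : PointedCone K (V × K)) ≤ σ.1), σ.2.le, fun z hz hz0 => by
      simpa using snd_pos (σ.2.le hz) fun h => hz0 (h ▸ Submodule.zero_mem _)⟩]
    refine coboundary_congr fun τ hτ => if_pos ?_
    have := (Δ.isIncidenceMatrix o).coneDim_eq τ σ hτ
    omega
  · rw [hx σ hσ]
    refine coboundary_eq_zero fun τ hτ => if_neg fun h => hσ ?_
    have := (Δ.isIncidenceMatrix o).coneDim_eq τ σ hτ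
    omega

/-- A linear form that is negative somewhere on the cone is negative on some ray. -/
theorem exists_ray_neg {Δ : Polytope K V} (o : Δ.coneFan.Orientations) {h : Dual K (V × K)}
    (hneg : ∃ x ∈ Δ.cone, h x < 0) :
    ∃ v : Δ.coneFan.Cone, coneDim v.1 = 1 ∧ ∀ x ∈ v.1, x ≠ 0 → h x < 0 := by
  classical
  have hac := (Δ.isIncidenceMatrix o).acyclicOn_neg (E := K) Δ.cone_fg Δ.vertex Δ.top h
    (bot_le : (⊥ : PointedCone K (V × K)) ≤ Δ.cone)
    (fun x hx => by rw [(Submodule.mem_bot _).1 hx, map_zero]) hneg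
  by_contra! hcon
  have hmem : Δ.vertex ∈ {F : {F : PointedCone K (V × K) // F.IsFaceOf Δ.cone} |
      Δ.vertex ≤ F ∧ F ≤ Δ.top ∧ ∀ x ∈ F.1, x ∉ Δ.vertex.1 → h x < 0} :=
    ⟨le_rfl, (bot_le : (⊥ : PointedCone K (V × K)) ≤ Δ.cone), fun x hx hx' => absurd hx hx'⟩
  -- Without such a ray, the indicator of the vertex would be closed on the acyclic set of faces
  -- where h is negative. It is not exact, as no incidence ends at the vertex.
  obtain ⟨y, -, hy⟩ := hac (fun σ => if coneDim σ.1 = 0 then 1 else 0)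
    (fun σ hσ => if_neg fun h => hσ (by rw [coneDim_eq_zero_iff.1 h]; exact hmem)) (by
      rintro σ ⟨-, -, hσ⟩
      refine coboundary_eq_zero fun τ hτ => if_neg fun h0 => ?_
      have h2 := (Δ.isIncidenceMatrix o).coneDim_eq τ σ hτ
      rw [h0, zero_add] at h2
      obtain ⟨x, hx, hx0, hhx⟩ := hcon σ h2
      exact absurd (hσ x hx fun h => hx0 ((Submodule.mem_bot _).1 h)) (not_lt.2 hhx))
  have h1 := hy Δ.vertex hmem
  rw [if_pos Δ.coneDim_vertex] at h1
  refine zero_ne_one ((coboundary_eq_zero fun τ hτ => ?_).symm.trans h1)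
  have h2 := (Δ.isIncidenceMatrix o).coneDim_eq τ Δ.vertex hτ
  rw [Δ.coneDim_vertex] at h2
  omega

/-- Since dim V ≥ 1, some nonzero form vanishes at w, and up to sign it is negative somewhere on the
cone, hence on a ray. The span of that ray cannot contain w. -/
theorem exists_ray_notMem {Δ : Polytope K V} (hΔ : affineSpan K Δ.carrier = ⊤)
    (o : Δ.coneFan.Orientations) (hV : 1 ≤ finrank K V) {w : V × K} (hw : w ≠ 0) :
    ∃ v : Δ.coneFan.Cone, coneDim v.1 = 1 ∧ w ∉ coneSpan v.1 := by
  obtain ⟨h, h0, hhw⟩ : ∃ h : Dual K (V × K), h ≠ 0 ∧ h w = 0 := by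
    have hlt : finrank K K < finrank K (Dual K (V × K)) := by
      rw [Subspace.dual_finrank_eq, finrank_prod, finrank_self]
      omega
    obtain ⟨h, hh, h0⟩ := (Submodule.ne_bot_iff _).1
      (LinearMap.ker_ne_bot_of_finrank_lt (f := Dual.eval K (V × K) w) hlt)
    exact ⟨h, h0, hh⟩
  obtain ⟨h, hhw, hneg⟩ : ∃ h : Dual K (V × K), h w = 0 ∧ ∃ x ∈ Δ.cone, h x < 0 := by
    obtain ⟨x, hx, hhx⟩ := exists_mem_cone_ne_zero hΔ h0
    rcases lt_or_gt_of_ne hhx with h1 | h1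
    · exact ⟨h, hhw, x, hx, h1⟩
    · exact ⟨-h, by simp [hhw], x, hx, by simpa using h1⟩
  obtain ⟨v, hv, hvneg⟩ := exists_ray_neg o hneg
  refine ⟨v, hv, fun hwv => ?_⟩
  have hne : v.1 ≠ ⊥ := by
    intro hb
    have : v = Δ.vertex := Subtype.ext hb
    rw [this, Δ.coneDim_vertex] at hv
    omega
  obtain ⟨r, hr, hr0⟩ := (Submodule.ne_bot_iff _).1 hne
  obtain ⟨c, hc⟩ := (finrank_eq_one_iff_of_nonzero' (⟨r, PointedCone.mem_coneSpan hr⟩ : coneSpan v.1)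
    (fun h => hr0 (Subtype.ext_iff.1 h))).1 hv ⟨w, hwv⟩
  have hc : c • r = w := Subtype.ext_iff.1 hc
  have h1 := hvneg r hr hr0
  rw [← hc, map_smul, smul_eq_mul] at hhw
  rcases mul_eq_zero.1 hhw with h2 | h2
  · rw [h2, zero_smul] at hc
    exact hw hc.symm
  · exact h1.ne h2

end Polytope


/-! ### Horizontal functions and their pairing with the normal fan -/

namespace Polytope

variable {K : Type*} [Field K] [LinearOrder K] [IsStrictOrderedRing K]
variable {V : Type*} [AddCommGroup V] [Module K V] [FiniteDimensional K V]

/-- The functions whose value at each cone is a vector of height zero in its span. -/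
def horizontal (Δ : Polytope K V) : Submodule K (Δ.coneFan.Cone → V × K) :=
  Submodule.pi Set.univ fun σ => coneSpan σ.1 ⊓ LinearMap.ker (LinearMap.snd K V K)

theorem mem_horizontal {Δ : Polytope K V} {x : Δ.coneFan.Cone → V × K} :
    x ∈ Δ.horizontal ↔ ∀ σ, x σ ∈ coneSpan σ.1 ∧ (x σ).2 = 0 :=
  ⟨fun h σ => h σ trivial, fun h σ _ => h σ⟩

theorem fst_mem_lin {Δ : Polytope K V} {x : Δ.coneFan.Cone → V × K} (hx : x ∈ Δ.horizontal)
    (σ : Δ.coneFan.Cone) : (x σ).1 ∈ lin σ.1 := by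
  have h : (((x σ).1, 0) : V × K) = x σ := Prod.ext rfl (mem_horizontal.1 hx σ).2.symm
  rw [mem_lin, h]
  exact (mem_horizontal.1 hx σ).1

theorem horizontal_vertex {Δ : Polytope K V} {x : Δ.coneFan.Cone → V × K} (hx : x ∈ Δ.horizontal) :
    x Δ.vertex = 0 := by
  have := (mem_horizontal.1 hx Δ.vertex).1
  rwa [coneSpan_vertex, Submodule.mem_bot] at this

theorem coboundary_mem_coneSpan {Δ : Polytope K V} (o : Δ.coneFan.Orientations)
    {x : Δ.coneFan.Cone → V × K} (hx : ∀ σ, x σ ∈ coneSpan σ.1) (σ : Δ.coneFan.Cone) :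
    coboundary (Δ.coneFan.matrix o) x σ ∈ coneSpan σ.1 := by
  rw [coboundary_apply]
  refine Submodule.sum_mem _ fun τ _ => ?_
  by_cases h : Δ.coneFan.matrix o τ σ = 0
  · rw [h, zero_smul]
    exact Submodule.zero_mem _
  · exact Submodule.smul_mem _ _
      (PointedCone.coneSpan_mono ((Δ.isIncidenceMatrix o).le τ σ h) (hx τ))

theorem coboundary_mem_horizontal {Δ : Polytope K V} (o : Δ.coneFan.Orientations)
    {x : Δ.coneFan.Cone → V × K} (hx : x ∈ Δ.horizontal) :
    coboundary (Δ.coneFan.matrix o) x ∈ Δ.horizontal := by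
  rw [mem_horizontal] at hx ⊢
  refine fun σ => ⟨coboundary_mem_coneSpan o (fun σ => (hx σ).1) σ, ?_⟩
  refine (coboundary_comp_map (Δ.coneFan.matrix o) (LinearMap.snd K V K) x σ).trans ?_
  exact coboundary_eq_zero fun τ _ => (hx τ).2

section Pairing

variable {Δ : Polytope K V} (hΔ : affineSpan K Δ.carrier = ⊤)

theorem coneSpan_normal_le_ker (ν : (Δ.normalFan hΔ).Cone) :
    coneSpan ν.1 ≤ LinearMap.ker (lin (faceOfNormal hΔ ν).1).dualRestrict := by
  rw [coneSpan_normal, Submodule.dualRestrict_ker_eq_dualAnnihilator]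

/-- The coefficients of the normal fan as linear forms on the directions of the faces. -/
noncomputable def evalNormal (ν : (Δ.normalFan hΔ).Cone) :
    ((Δ.normalFan hΔ).quotientSystem.exteriorPower 1).obj ν →ₗ[K]
      Dual K (lin (faceOfNormal hΔ ν).1) :=
  (coneSpan ν.1).liftQ (lin (faceOfNormal hΔ ν).1).dualRestrict (coneSpan_normal_le_ker hΔ ν) ∘ₗ
    (exteriorPower.oneEquiv K (Dual K V ⧸ coneSpan ν.1)).toLinearMap

theorem evalNormal_extProj (ν : (Δ.normalFan hΔ).Cone) (u : Dual K V)
    (x : lin (faceOfNormal hΔ ν).1) : evalNormal hΔ ν ((Δ.normalFan hΔ).extProj ν u) x = u x := by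
  exact LinearMap.congr_fun (congrArg ((coneSpan ν.1).liftQ (lin (faceOfNormal hΔ ν).1).dualRestrict
    (coneSpan_normal_le_ker hΔ ν)) (LinearEquiv.apply_symm_apply
      (exteriorPower.oneEquiv K (Dual K V ⧸ coneSpan ν.1)) ((coneSpan ν.1).mkQ u))) x

/-- The pairing of horizontal functions with the cochains of the normal fan. -/
noncomputable def pairing (s : (Δ.normalFan hΔ).Cone → K) (m : ℤ) : Δ.horizontal →ₗ[K]
    Dual K (((Δ.normalFan hΔ).quotientSystem.exteriorPower 1).Cochain m) :=
  letI := Fintype.ofFinite {ν : (Δ.normalFan hΔ).Cone // (coneDim ν.1 : ℤ) = m}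
  LinearMap.mk₂ K (fun x b => ∑ ν : {ν : (Δ.normalFan hΔ).Cone // (coneDim ν.1 : ℤ) = m},
      s ν.1 * evalNormal hΔ ν.1 (b ν) ⟨(x.1 (faceOfNormal hΔ ν.1)).1, fst_mem_lin x.2 _⟩)
    (fun x y b => by
      rw [← Finset.sum_add_distrib]
      refine Finset.sum_congr rfl fun ν _ => ?_
      rw [← mul_add, ← map_add]
      rfl)
    (fun c x b => by
      rw [smul_eq_mul, Finset.mul_sum]
      refine Finset.sum_congr rfl fun ν _ => ?_
      rw [mul_left_comm, ← smul_eq_mul (a := c) (b := evalNormal _ _ _ _), ← map_smul]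
      rfl)
    (fun x b c => by
      rw [← Finset.sum_add_distrib]
      refine Finset.sum_congr rfl fun ν _ => ?_
      rw [Pi.add_apply, map_add, LinearMap.add_apply, mul_add])
    (fun c x b => by
      rw [smul_eq_mul, Finset.mul_sum]
      refine Finset.sum_congr rfl fun ν _ => ?_
      rw [Pi.smul_apply, map_smul, LinearMap.smul_apply, smul_eq_mul, mul_left_comm])

theorem pairing_presented (s : (Δ.normalFan hΔ).Cone → K) {m : ℤ} (x : Δ.horizontal)
    {u : (Δ.normalFan hΔ).Cone → Dual K V} (hu : u ∈ (Δ.normalFan hΔ).degree (Dual K V) m) :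
    pairing hΔ s m x (Fan.presented _ (Δ.normalFan hΔ).extProj m u) =
      ∑ ν, s ν * u ν (x.1 (faceOfNormal hΔ ν)).1 := by
  let := Fintype.ofFinite {ν : (Δ.normalFan hΔ).Cone // (coneDim ν.1 : ℤ) = m}
  rw [← Fan.sum_degree_eq (k := m) (fun ν => s ν * u ν (x.1 (faceOfNormal hΔ ν)).1) fun ν hν => by
    rw [hu ν hν, LinearMap.zero_apply, mul_zero]]
  refine Finset.sum_congr rfl fun ν _ => ?_
  rw [Fan.presented_apply, evalNormal_extProj]

theorem single_mem_degree {K V E : Type*} [Field K] [LinearOrder K] [IsStrictOrderedRing K]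
    [AddCommGroup V] [Module K V] [AddCommGroup E] [Module K E] {X : Fan K V} [DecidableEq X.Cone]
    {k : ℤ} {σ : X.Cone} (hσ : (coneDim σ.1 : ℤ) = k) (a : E) : Pi.single σ a ∈ X.degree E k :=
  fun τ hτ => Pi.single_eq_of_ne (fun h => hτ (by rw [h]; exact hσ)) _

/-- Cochains concentrated at one cone detect the value at each nonzero face. The vertex corresponds
to no normal cone, but it carries no nonzero horizontal vector. -/
theorem eq_zero_of_pairing_eq_zero {s : (Δ.normalFan hΔ).Cone → K} (hs : ∀ ν, s ν ≠ 0) {j m : ℤ}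
    (hjm : j + m = finrank K V + 1) {x : Δ.horizontal}
    (hx : x.1 ∈ Δ.coneFan.degree (V × K) j) (h0 : pairing hΔ s m x = 0) : x = 0 := by
  classical
  refine Subtype.ext (funext fun σ => ?_)
  by_cases hσj : (coneDim σ.1 : ℤ) = j
  swap
  · exact hx σ hσj
  by_cases hσ : σ.1 = ⊥
  · rw [show σ = Δ.vertex from Subtype.ext hσ]
    exact horizontal_vertex x.2
  obtain ⟨ν, rfl⟩ := exists_faceOfNormal_eq hΔ σ hσ
  have hν : (coneDim ν.1 : ℤ) = m := by
    have := coneDim_faceOfNormal hΔ ν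
    omega
  refine Prod.ext ((forall_dual_apply_eq_zero_iff K _).1 fun f => ?_) (mem_horizontal.1 x.2 _).2
  have h1 := pairing_presented hΔ s x (single_mem_degree hν f)
  rw [h0, LinearMap.zero_apply, Finset.sum_eq_single ν, Pi.single_eq_same] at h1
  · exact (mul_eq_zero.1 h1.symm).resolve_left (hs ν)
  · intro ν' _ hne
    rw [Pi.single_eq_of_ne hne, LinearMap.zero_apply, mul_zero]
  · exact fun h => absurd (Finset.mem_univ _) h

/-- At each ν, β gives a functional on the dual of V that kills span ν, the annihilator of lin σ. By
biduality it is a vector of lin σ, which is then divided by s ν. -/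
theorem exists_pairing_eq {s : (Δ.normalFan hΔ).Cone → K} (hs : ∀ ν, s ν ≠ 0) {j m : ℤ}
    (hjm : j + m = finrank K V + 1)
    (β : Dual K (((Δ.normalFan hΔ).quotientSystem.exteriorPower 1).Cochain m)) :
    ∃ x : Δ.horizontal, x.1 ∈ Δ.coneFan.degree (V × K) j ∧ pairing hΔ s m x = β := by
  classical
  let B : (Δ.normalFan hΔ).Cone → Dual K (Dual K V) := fun ν =>
    β ∘ₗ Fan.presented _ (Δ.normalFan hΔ).extProj m ∘ₗ LinearMap.single K (fun _ => Dual K V) ν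
  have hB : ∀ ν u, u ∈ coneSpan ν.1 → B ν u = 0 := by
    intro ν u hu
    have : Fan.presented _ (Δ.normalFan hΔ).extProj m (Pi.single ν u) = 0 := by
      funext ν'
      rw [Fan.presented_apply]
      by_cases h : ν'.1 = ν
      · obtain ⟨_, hν'⟩ := ν'
        subst h
        rw [Pi.single_eq_same]
        exact Fan.extProj_eq_zero_iff.2 hu
      · rw [Pi.single_eq_of_ne h, map_zero]
        rfl
    change β (Fan.presented _ (Δ.normalFan hΔ).extProj m (Pi.single ν u)) = 0
    rw [this, map_zero]
  have hex : ∀ σ : Δ.coneFan.Cone, ∃ y : V × K, (y ∈ coneSpan σ.1 ∧ y.2 = 0) ∧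
      ((coneDim σ.1 : ℤ) ≠ j → y = 0) ∧
      ∀ ν, faceOfNormal hΔ ν = σ → (coneDim σ.1 : ℤ) = j → ∀ u : Dual K V, s ν * u y.1 = B ν u := by
    intro σ
    by_cases h : (coneDim σ.1 : ℤ) = j ∧ ∃ ν, faceOfNormal hΔ ν = σ
    · obtain ⟨hσ, ν, rfl⟩ := h
      obtain ⟨v, hv⟩ := (evalEquiv K V).surjective (B ν)
      have hv' : ∀ u : Dual K V, u v = B ν u := fun u => by rw [← hv]; rfl
      have hmem : v ∈ lin (faceOfNormal hΔ ν).1 := by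
        rw [← Subspace.dualAnnihilator_dualCoannihilator_eq (W := lin (faceOfNormal hΔ ν).1),
          ← coneSpan_normal, Submodule.mem_dualCoannihilator]
        intro u hu
        rw [hv', hB ν u hu]
      refine ⟨((s ν)⁻¹ • v, 0), ⟨mem_lin.1 (Submodule.smul_mem _ _ hmem), rfl⟩,
        fun h => absurd hσ h, fun ν' hν' _ u => ?_⟩
      rw [faceOfNormal_injective hΔ hν']
      change s ν * u ((s ν)⁻¹ • v) = _
      rw [map_smul, smul_eq_mul, mul_inv_cancel_left₀ (hs ν), hv']
    · exact ⟨0, ⟨Submodule.zero_mem _, rfl⟩, fun _ => rfl, fun ν hν hσ => absurd ⟨hσ, ν, hν⟩ h⟩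
  choose x hx1 hx2 hx3 using hex
  refine ⟨⟨x, mem_horizontal.2 hx1⟩, hx2, LinearMap.ext fun b => ?_⟩
  obtain ⟨u, hu, rfl⟩ := Fan.exists_presented_eq Fan.extProj_surjective b
  rw [pairing_presented hΔ s _ hu]
  conv_rhs => rw [← Finset.univ_sum_single u, map_sum, map_sum]
  refine Finset.sum_congr rfl fun ν _ => ?_
  by_cases hν : (coneDim ν.1 : ℤ) = m
  · refine hx3 _ ν rfl ?_ (u ν)
    have := coneDim_faceOfNormal hΔ ν
    omega
  · rw [hu ν hν, LinearMap.zero_apply, mul_zero, Pi.single_zero, map_zero, map_zero]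

theorem sum_faceOfNormal {M : Type*} [AddCommMonoid M] (f : Δ.coneFan.Cone → M)
    (h0 : f Δ.vertex = 0) : ∑ ν, f (faceOfNormal hΔ ν) = ∑ σ, f σ := by
  classical
  rw [← Finset.sum_image (f := f) (faceOfNormal_injective hΔ).injOn]
  refine Finset.sum_subset (Finset.subset_univ _) fun σ _ hσ => ?_
  by_cases h : σ.1 = ⊥
  · rw [show σ = Δ.vertex from Subtype.ext h, h0]
  · obtain ⟨ν, hν⟩ := exists_faceOfNormal_eq hΔ σ h
    exact absurd (Finset.mem_image.2 ⟨ν, Finset.mem_univ _, hν⟩) hσ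

end Pairing

end Polytope


/-! ### Adjoint differentials and the Hodge spaces -/

namespace Polytope

variable {K : Type*} [Field K] [LinearOrder K] [IsStrictOrderedRing K]
variable {V : Type*} [AddCommGroup V] [Module K V] [FiniteDimensional K V]
variable {Δ : Polytope K V} (hΔ : affineSpan K Δ.carrier = ⊤)

/-- The differential on horizontal functions. -/
noncomputable def horizontalCoboundary (o : Δ.coneFan.Orientations) :
    Δ.horizontal →ₗ[K] Δ.horizontal :=
  (coboundary (Δ.coneFan.matrix o)).restrict fun _ => coboundary_mem_horizontal o

theorem coe_horizontalCoboundary (o : Δ.coneFan.Orientations) (x : Δ.horizontal) :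
    (horizontalCoboundary o x).1 = coboundary (Δ.coneFan.matrix o) x.1 := rfl

theorem horizontalCoboundary_horizontalCoboundary (o : Δ.coneFan.Orientations)
    (x : Δ.horizontal) : horizontalCoboundary o (horizontalCoboundary o x) = 0 :=
  Subtype.ext (coboundary_coboundary o x.1)

/-- The differentials of the normal fan and of the cone are adjoint up to factors. -/
theorem exists_adjoint (oN : (Δ.normalFan hΔ).Orientations) (oC : Δ.coneFan.Orientations) :
    ∃ s : (Δ.normalFan hΔ).Cone → K, (∀ ν, s ν ≠ 0) ∧
      ∀ j : ℤ, ∃ c : K, c ≠ 0 ∧ ∀ m l : ℤ, m + 1 = l →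
        ∀ x : Δ.horizontal, x.1 ∈ Δ.coneFan.degree (V × K) j → ∀ b,
          pairing hΔ s l x (((Δ.normalFan hΔ).quotientSystem.exteriorPower 1).d oN m l b) =
            c * pairing hΔ s m (horizontalCoboundary oC x) b := by
  obtain ⟨s, hs, hsign⟩ := exists_signs hΔ oN oC
  refine ⟨s, hs, fun j => ?_⟩
  -- For negative j a function of degree j is zero, so the truncation is harmless.
  obtain ⟨c, hc, h⟩ := hsign j.toNat
  refine ⟨c, hc, fun m l hml x hx b => ?_⟩
  obtain ⟨u, hu, rfl⟩ := Fan.exists_presented_eq Fan.extProj_surjective b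
  rw [Fan.d_presented_eq Fan.extProj_map hu, pairing_presented hΔ s x (Fan.coboundary_mem_degree hml hu),
    pairing_presented hΔ s _ hu, Finset.mul_sum]
  have hleft : ∀ ν, s ν * coboundary ((Δ.normalFan hΔ).matrix oN) u ν (x.1 (faceOfNormal hΔ ν)).1 =
      ∑ ν', c * (Δ.coneFan.incidence oC (faceOfNormal hΔ ν) (faceOfNormal hΔ ν') * s ν') *
        u ν' (x.1 (faceOfNormal hΔ ν)).1 := by
    intro ν
    by_cases hν : (coneDim (faceOfNormal hΔ ν).1 : ℤ) = j
    · rw [coboundary_apply, LinearMap.sum_apply, Finset.mul_sum]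
      refine Finset.sum_congr rfl fun ν' _ => ?_
      rw [LinearMap.smul_apply, smul_eq_mul, Fan.matrix, ← h ν ν' (by omega)]
      ring
    · rw [hx _ hν, Prod.fst_zero, map_zero, mul_zero]
      exact (Finset.sum_eq_zero fun ν' _ => by rw [map_zero, mul_zero]).symm
  have hright : ∀ ν', c * (s ν' * u ν' ((horizontalCoboundary oC x).1 (faceOfNormal hΔ ν')).1) =
      ∑ ν, c * (Δ.coneFan.incidence oC (faceOfNormal hΔ ν) (faceOfNormal hΔ ν') * s ν') *
        u ν' (x.1 (faceOfNormal hΔ ν)).1 := by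
    intro ν'
    have h1 : u ν' ((horizontalCoboundary oC x).1 (faceOfNormal hΔ ν')).1 =
        ∑ τ, Δ.coneFan.matrix oC τ (faceOfNormal hΔ ν') * u ν' (x.1 τ).1 := by
      rw [coe_horizontalCoboundary]
      refine (coboundary_comp_map (Δ.coneFan.matrix oC) (u ν' ∘ₗ LinearMap.fst K V K) x.1 _).trans ?_
      rw [coboundary_apply]
      rfl
    rw [h1, ← sum_faceOfNormal hΔ _ (by
      rw [horizontal_vertex x.2, Prod.fst_zero, map_zero, mul_zero]), Finset.mul_sum,
      Finset.mul_sum]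
    refine Finset.sum_congr rfl fun ν _ => ?_
    rw [Fan.matrix]
    ring
  -- Both sides are the same double sum over pairs of normal cones.
  simp_rw [hleft, hright]
  rw [Finset.sum_comm]

/-- The functions of degree `k` with horizontal differential. -/
noncomputable def horizontalPrimitives (o : Δ.coneFan.Orientations) (k : ℤ) :
    Submodule K (Δ.coneFan.Cone → V × K) :=
  Δ.coneFan.degree (V × K) k ⊓ Δ.horizontal.comap (coboundary (Δ.coneFan.matrix o))

theorem exists_horizontalPrimitive (hne : Δ.carrier.Nonempty) (o : Δ.coneFan.Orientations) {k : ℤ}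
    {x : Δ.horizontal} (hx : x.1 ∈ Δ.coneFan.degree (V × K) (k + 1))
    (hdx : horizontalCoboundary o x = 0) :
    ∃ a ∈ horizontalPrimitives o k, coboundary (Δ.coneFan.matrix o) a = x.1 := by
  have h : coboundary (Δ.coneFan.matrix o) x.1 = 0 := Subtype.ext_iff.1 hdx
  obtain ⟨a, ha, hax⟩ := exists_coboundary_eq hne o (l := k) rfl hx h
  refine ⟨a, ⟨ha, ?_⟩, hax⟩
  change coboundary (Δ.coneFan.matrix o) a ∈ Δ.horizontal
  rw [hax]
  exact x.2

/-- Every form on cochains is a pairing with a horizontal function; moving both differentials across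
the pairing turns them into the square of the horizontal one. -/
theorem d_comp_d (oN : (Δ.normalFan hΔ).Orientations) (oC : Δ.coneFan.Orientations) {l m r : ℤ}
    (hlm : l + 1 = m) (hmr : m + 1 = r) :
    ((Δ.normalFan hΔ).quotientSystem.exteriorPower 1).d oN m r ∘ₗ
      ((Δ.normalFan hΔ).quotientSystem.exteriorPower 1).d oN l m = 0 := by
  obtain ⟨s, hs, hadj⟩ := exists_adjoint hΔ oN oC
  refine LinearMap.ext fun b => ?_
  refine (forall_dual_apply_eq_zero_iff K _).1 fun β => ?_
  obtain ⟨x, hx, rfl⟩ := exists_pairing_eq hΔ hs (j := finrank K V + 1 - r) (m := r) (by omega) β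
  obtain ⟨c, -, hc⟩ := hadj (finrank K V + 1 - r)
  obtain ⟨c', -, hc'⟩ := hadj (finrank K V + 1 - r + 1)
  rw [LinearMap.comp_apply, hc m r hmr x hx, hc' l m hlm _ (Fan.coboundary_mem_degree rfl hx),
    horizontalCoboundary_horizontalCoboundary, map_zero, LinearMap.zero_apply, mul_zero, mul_zero]

/-- φ pairs with da. Forms that kill the image of the previous differential come from horizontal
cocycles of degree k + 1, which are of the form da by exactness of the constant complex. Forms that
factor through the next differential come from coboundaries of horizontal functions of degree k. -/
theorem exists_toDualCochain (oN : (Δ.normalFan hΔ).Orientations)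
    (oC : Δ.coneFan.Orientations) {k l m r : ℤ} (hkm : k + m = finrank K V) (hlm : l + 1 = m)
    (hmr : m + 1 = r) :
    ∃ φ : horizontalPrimitives oC k →ₗ[K]
        Dual K (((Δ.normalFan hΔ).quotientSystem.exteriorPower 1).Cochain m),
      (∀ a, φ a ∘ₗ ((Δ.normalFan hΔ).quotientSystem.exteriorPower 1).d oN l m = 0) ∧
      (∀ β : Dual K (((Δ.normalFan hΔ).quotientSystem.exteriorPower 1).Cochain m),
        β ∘ₗ ((Δ.normalFan hΔ).quotientSystem.exteriorPower 1).d oN l m = 0 → ∃ a, φ a = β) ∧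
      ∀ a, (∃ γ : Dual K (((Δ.normalFan hΔ).quotientSystem.exteriorPower 1).Cochain r),
          φ a = γ ∘ₗ ((Δ.normalFan hΔ).quotientSystem.exteriorPower 1).d oN m r) ↔
        ∃ y ∈ Δ.horizontal, y ∈ Δ.coneFan.degree (V × K) k ∧
          coboundary (Δ.coneFan.matrix oC) a.1 = coboundary (Δ.coneFan.matrix oC) y := by
  obtain ⟨s, hs, hadj⟩ := exists_adjoint hΔ oN oC
  have hne := carrier_nonempty hΔ
  have hdeg : ∀ {j : ℤ} (x : Δ.horizontal), x.1 ∈ Δ.coneFan.degree (V × K) j →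
      (horizontalCoboundary oC x).1 ∈ Δ.coneFan.degree (V × K) (j + 1) :=
    fun x hx => Fan.coboundary_mem_degree rfl hx
  let D : horizontalPrimitives oC k →ₗ[K] Δ.horizontal :=
    (coboundary (Δ.coneFan.matrix oC)).restrict fun x hx => hx.2
  have hDdeg : ∀ a, (D a).1 ∈ Δ.coneFan.degree (V × K) (k + 1) :=
    fun a => Fan.coboundary_mem_degree rfl a.2.1
  obtain ⟨c, hc0, hc⟩ := hadj k
  obtain ⟨c', hc0', hc'⟩ := hadj (k + 1)
  refine ⟨pairing hΔ s m ∘ₗ D, fun a => ?_, fun β hβ => ?_,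
    fun a => ⟨fun ⟨γ, hγ⟩ => ?_, fun ⟨y, hy, hyk, hay⟩ => ?_⟩⟩
  · refine LinearMap.ext fun b => ?_
    have h1 : horizontalCoboundary oC (D a) = 0 := Subtype.ext (coboundary_coboundary oC a.1)
    rw [LinearMap.comp_apply, LinearMap.comp_apply, hc' l m hlm _ (hDdeg a), h1,
      map_zero, LinearMap.zero_apply, mul_zero]
  · obtain ⟨x, hx, rfl⟩ := exists_pairing_eq hΔ hs (j := k + 1) (m := m) (by omega) β
    have h1 : horizontalCoboundary oC x = 0 := by
      refine eq_zero_of_pairing_eq_zero hΔ hs (j := k + 1 + 1) (m := l) (by omega) (hdeg x hx) ?_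
      refine LinearMap.ext fun b => ?_
      have h2 := hc' l m hlm x hx b
      have h3 := (LinearMap.congr_fun hβ b).symm.trans h2
      exact (mul_eq_zero.1 h3.symm).resolve_left hc0'
    obtain ⟨a, ha, hax⟩ := exists_horizontalPrimitive hne oC hx h1
    exact ⟨⟨a, ha⟩, congrArg (pairing hΔ s m) (Subtype.ext hax)⟩
  · obtain ⟨y, hy, rfl⟩ := exists_pairing_eq hΔ hs (j := k) (m := r) (by omega) γ
    have h1 : D a - c • horizontalCoboundary oC y = 0 := by
      refine eq_zero_of_pairing_eq_zero hΔ hs (j := k + 1) (m := m) (by omega)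
        (Submodule.sub_mem _ (hDdeg a) (Submodule.smul_mem _ c (hdeg y hy))) ?_
      rw [map_sub, map_smul, sub_eq_zero]
      refine LinearMap.ext fun b => ?_
      exact (LinearMap.congr_fun hγ b).trans (hc m r hmr y hy b)
    refine ⟨c • y.1, Submodule.smul_mem _ c y.2, Submodule.smul_mem _ c hy, ?_⟩
    rw [map_smul]
    exact congrArg Subtype.val (sub_eq_zero.1 h1)
  · refine ⟨pairing hΔ s r (c⁻¹ • ⟨y, hy⟩), LinearMap.ext fun b => ?_⟩
    have h1 : D a = horizontalCoboundary oC ⟨y, hy⟩ := Subtype.ext hay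
    rw [LinearMap.comp_apply, LinearMap.comp_apply, h1,
      hc m r hmr _ (Submodule.smul_mem _ _ hyk), map_smul, map_smul, LinearMap.smul_apply,
      smul_eq_mul, mul_inv_cancel_left₀ hc0]

theorem exists_toHodgeSpace (oN : (Δ.normalFan hΔ).Orientations) (oC : Δ.coneFan.Orientations)
    (k : ℤ) :
    ∃ p : horizontalPrimitives oC k →ₗ[K] (Δ.normalFan hΔ).HodgeSpace oN k 1,
      Function.Surjective p ∧ ∀ a, p a = 0 ↔ ∃ y ∈ Δ.horizontal, y ∈ Δ.coneFan.degree (V × K) k ∧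
        coboundary (Δ.coneFan.matrix oC) a.1 = coboundary (Δ.coneFan.matrix oC) y :=
  have hk : k + ((finrank K (Dual K V) : ℤ) - k) = finrank K V := by
    rw [Subspace.dual_finrank_eq]
    omega
  (exists_toDualCochain hΔ oN oC hk (sub_add_cancel _ 1) rfl).elim fun φ h =>
    (exists_toDual_cohomology _ _ (d_comp_d hΔ oN oC (sub_add_cancel _ 1) rfl) φ h.1 h.2.1).imp
      fun _ hp => ⟨hp.1, fun a => (hp.2 a).trans (h.2.2 a)⟩

end Polytope


/-! ### Comparing two quotients of one space -/

section LinearAlgebra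

variable {K T H D : Type*} [Field K] [AddCommGroup T] [Module K T] [AddCommGroup H] [Module K H]
  [AddCommGroup D] [Module K D] {p : T →ₗ[K] H} {q : T →ₗ[K] D}

theorem nonempty_linearEquiv_of_ker_eq (hp : Function.Surjective p) (hq : Function.Surjective q)
    (h : ∀ a, p a = 0 ↔ q a = 0) : Nonempty (H ≃ₗ[K] D) :=
  ⟨(p.quotKerEquivOfSurjective hp).symm ≪≫ₗ
    Submodule.quotEquivOfEq (LinearMap.ker p) (LinearMap.ker q) (Submodule.ext h) ≪≫ₗ q.quotKerEquivOfSurjective hq⟩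

/-- The second map is q composed with a linear section of p; the choice does not matter, since r = 0
in the hypothesis gives ker p ⊆ ker q. -/
theorem exists_exact_of_surjective {R : Type*} [AddCommGroup R] [Module K R] (j : R →ₗ[K] T)
    (hp : Function.Surjective p) (hq : Function.Surjective q)
    (h : ∀ a, q a = 0 ↔ ∃ r, p a = p (j r)) (hj : ∀ r, p (j r) = 0 → r = 0) :
    ∃ (f : R →ₗ[K] H) (g : H →ₗ[K] D),
      Function.Injective f ∧ Function.Exact f g ∧ Function.Surjective g := by
  obtain ⟨i, hi⟩ := p.exists_rightInverse_of_surjective (LinearMap.range_eq_top.2 hp)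
  have hi : ∀ x, p (i x) = x := fun x => LinearMap.congr_fun hi x
  refine ⟨p ∘ₗ j, q ∘ₗ i, (injective_iff_map_eq_zero _).2 hj, fun x => ?_, fun y => ?_⟩
  · rw [LinearMap.comp_apply, h, hi]
    exact ⟨fun ⟨r, hr⟩ => ⟨r, hr.symm⟩, fun ⟨r, hr⟩ => ⟨r, hr.symm⟩⟩
  · obtain ⟨a, rfl⟩ := hq y
    refine ⟨p a, ?_⟩
    rw [LinearMap.comp_apply, ← sub_eq_zero, ← map_sub, h]
    exact ⟨0, by rw [map_sub, hi, sub_self, map_zero, map_zero]⟩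

end LinearAlgebra

/-! ### From functions with horizontal differential to the invariants D -/

namespace Polytope

variable {K : Type*} [Field K] [LinearOrder K] [IsStrictOrderedRing K]
variable {V : Type*} [AddCommGroup V] [Module K V] [FiniteDimensional K V]
variable {Δ : Polytope K V} {o : Δ.coneFan.Orientations}

theorem mem_horizontalPrimitives {k : ℤ} {a : Δ.coneFan.Cone → V × K} :
    a ∈ horizontalPrimitives o k ↔ a ∈ Δ.coneFan.degree (V × K) k ∧
      ∀ σ, coboundary (Δ.coneFan.matrix o) a σ ∈ coneSpan σ.1 ∧
        (coboundary (Δ.coneFan.matrix o) a σ).2 = 0 :=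
  and_congr Iff.rfl mem_horizontal

theorem coboundary_snd (a : Δ.coneFan.Cone → V × K) (σ : Δ.coneFan.Cone) :
    (coboundary (Δ.coneFan.matrix o) a σ).2 =
      coboundary (Δ.coneFan.matrix o) (fun τ => (a τ).2) σ :=
  coboundary_comp_map (Δ.coneFan.matrix o) (LinearMap.snd K V K) a σ

variable (o) in
/-- The class of a function with horizontal differential. -/
noncomputable def toD (k : ℤ) : horizontalPrimitives o k →ₗ[K] Δ.D o k :=
  Submodule.mkQ _ ∘ₗ LinearMap.codRestrict _
    (Fan.presented Δ.coneFan.quotientSystem Δ.coneFan.quotientProj k ∘ₗ Submodule.subtype _)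
    fun a => by
      refine (Fan.d_presented_eq (X := Δ.coneFan) Fan.quotientProj_map a.2.1).trans ?_
      funext σ
      exact Fan.quotientProj_eq_zero_iff.2 ((mem_horizontalPrimitives.1 a.2).2 σ.1).1

theorem toD_eq_zero_iff {k : ℤ} (a : horizontalPrimitives o k) :
    toD o k a = 0 ↔ ∃ c ∈ Δ.coneFan.degree (V × K) (k - 1),
      ∀ σ, a.1 σ - coboundary (Δ.coneFan.matrix o) c σ ∈ coneSpan σ.1 := by
  refine (Submodule.Quotient.mk_eq_zero _).trans ⟨fun ⟨b, hb⟩ => ?_, fun ⟨c, hc, h⟩ => ?_⟩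
  · obtain ⟨c, hc, rfl⟩ := Fan.exists_presented_eq (X := Δ.coneFan) Fan.quotientProj_surjective b
    refine ⟨c, hc, fun σ => ?_⟩
    have h1 :=
      (Fan.d_presented_eq (o := o) (l := k) (X := Δ.coneFan) Fan.quotientProj_map hc).symm.trans hb
    by_cases hσ : (coneDim σ.1 : ℤ) = k
    · rw [← Fan.quotientProj_eq_zero_iff (X := Δ.coneFan), map_sub, sub_eq_zero]
      exact (congrFun h1 ⟨σ, hσ⟩).symm
    · rw [a.2.1 σ hσ, Fan.coboundary_mem_degree (sub_add_cancel k 1) hc σ hσ, sub_zero]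
      exact Submodule.zero_mem _
  · refine ⟨Fan.presented Δ.coneFan.quotientSystem Δ.coneFan.quotientProj (k - 1) c, ?_⟩
    refine (Fan.d_presented_eq (X := Δ.coneFan) Fan.quotientProj_map hc).trans (funext fun σ => ?_)
    have h1 := Fan.quotientProj_eq_zero_iff.2 (h σ.1)
    rw [map_sub, sub_eq_zero] at h1
    exact h1.symm

/-- Such vectors split the height on the span of every nonzero face; the span of the vertex leaves
only zero. -/
theorem exists_heights (Δ : Polytope K V) :
    ∃ e : Δ.coneFan.Cone → V × K, (∀ σ, e σ ∈ coneSpan σ.1) ∧ ∀ σ, σ ≠ Δ.vertex → (e σ).2 = 1 := by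
  have h : ∀ σ : Δ.coneFan.Cone, ∃ x ∈ coneSpan σ.1, σ ≠ Δ.vertex → x.2 = 1 := by
    intro σ
    by_cases hσ : σ = Δ.vertex
    · exact ⟨0, Submodule.zero_mem _, fun h => absurd hσ h⟩
    · obtain ⟨x, hx, hx2⟩ := exists_mem_coneSpan_snd_eq_one
        (show σ.1.IsFaceOf Δ.cone from σ.2) fun h => hσ (Subtype.ext h)
      exact ⟨x, hx, fun _ => hx2⟩
  choose e he he2 using h
  exact ⟨e, he, he2⟩

/-- The function with values in the spans that lifts a function of heights. -/
def lift (e : Δ.coneFan.Cone → V × K) : (Δ.coneFan.Cone → K) →ₗ[K] (Δ.coneFan.Cone → V × K) :=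
  LinearMap.pi fun σ => LinearMap.toSpanSingleton K (V × K) (e σ) ∘ₗ LinearMap.proj σ

variable {e : Δ.coneFan.Cone → V × K}

theorem lift_apply (r : Δ.coneFan.Cone → K) (σ : Δ.coneFan.Cone) : lift e r σ = r σ • e σ := rfl

theorem lift_mem_degree {k : ℤ} {r : Δ.coneFan.Cone → K} (hr : r ∈ Δ.coneFan.degree K k) :
    lift e r ∈ Δ.coneFan.degree (V × K) k :=
  fun σ hσ => by rw [lift_apply, hr σ hσ, zero_smul]

theorem lift_mem_coneSpan (he : ∀ σ, e σ ∈ coneSpan σ.1) (r : Δ.coneFan.Cone → K)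
    (σ : Δ.coneFan.Cone) : lift e r σ ∈ coneSpan σ.1 := Submodule.smul_mem _ _ (he σ)

/-- The degree has to be positive because heights at the vertex are lost by the lift. -/
theorem lift_snd (he2 : ∀ σ, σ ≠ Δ.vertex → (e σ).2 = 1) {k : ℤ} (hk : 1 ≤ k)
    {r : Δ.coneFan.Cone → K} (hr : r ∈ Δ.coneFan.degree K k) (σ : Δ.coneFan.Cone) :
    (lift e r σ).2 = r σ := by
  by_cases hσ : σ = Δ.vertex
  · have h0 : r σ = 0 := hr σ (by rw [hσ, coneDim_vertex]; omega)
    rw [lift_apply, h0, zero_smul, Prod.snd_zero]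
  · rw [lift_apply, Prod.smul_snd, he2 σ hσ, smul_eq_mul, mul_one]

theorem lift_coboundary_mem (he : ∀ σ, e σ ∈ coneSpan σ.1)
    (he2 : ∀ σ, σ ≠ Δ.vertex → (e σ).2 = 1) {k : ℤ} (hk : 1 ≤ k)
    {r : Δ.coneFan.Cone → K} (hr : r ∈ Δ.coneFan.degree K (k - 1)) :
    lift e (coboundary (Δ.coneFan.matrix o) r) ∈ horizontalPrimitives o k := by
  have hdr := Fan.coboundary_mem_degree (o := o) (sub_add_cancel k 1) hr
  refine mem_horizontalPrimitives.2 ⟨lift_mem_degree hdr, fun σ =>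
    ⟨coboundary_mem_coneSpan o (lift_mem_coneSpan he _) σ, ?_⟩⟩
  rw [coboundary_snd]
  simp_rw [lift_snd he2 hk hdr]
  exact congrFun (coboundary_coboundary o r) σ

theorem coboundary_mem_coneSpan_of_mem_ker {k : ℤ} {a : Δ.coneFan.Cone → V × K}
    (ha : a ∈ Δ.coneFan.degree (V × K) k)
    (hz : Fan.presented Δ.coneFan.quotientSystem Δ.coneFan.quotientProj k a ∈
      LinearMap.ker (Δ.coneFan.quotientSystem.d o k (k + 1))) (σ : Δ.coneFan.Cone) :
    coboundary (Δ.coneFan.matrix o) a σ ∈ coneSpan σ.1 := by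
  have hda := (Fan.d_presented_eq (o := o) (l := k + 1) (X := Δ.coneFan) Fan.quotientProj_map
    ha).symm.trans hz
  by_cases hσ : (coneDim σ.1 : ℤ) = k + 1
  · exact Fan.quotientProj_eq_zero_iff.1 (congrFun hda ⟨σ, hσ⟩)
  · rw [Fan.coboundary_mem_degree rfl ha σ hσ]
    exact Submodule.zero_mem _

/-- Subtracting the lift of the heights of a changes a only by vectors of the spans, so its class
stays the same, while the differential becomes horizontal. -/
theorem toD_surjective (he : ∀ σ, e σ ∈ coneSpan σ.1)
    (he2 : ∀ σ, σ ≠ Δ.vertex → (e σ).2 = 1) {k : ℤ} (hk : 1 ≤ k) :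
    Function.Surjective (toD o k) := by
  intro z
  obtain ⟨⟨z, hz⟩, rfl⟩ := Submodule.mkQ_surjective _ z
  obtain ⟨a, ha, rfl⟩ := Fan.exists_presented_eq (X := Δ.coneFan) Fan.quotientProj_surjective z
  have hspan := coboundary_mem_coneSpan_of_mem_ker ha hz
  have ht : (fun σ => (a σ).2) ∈ Δ.coneFan.degree K k := fun σ hσ => congrArg Prod.snd (ha σ hσ)
  have hmem : a - lift e (fun σ => (a σ).2) ∈ horizontalPrimitives o k := by
    refine mem_horizontalPrimitives.2 ⟨Submodule.sub_mem _ ha (lift_mem_degree ht), fun σ => ⟨?_, ?_⟩⟩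
    · rw [map_sub]
      exact Submodule.sub_mem _ (hspan σ) (coboundary_mem_coneSpan o (lift_mem_coneSpan he _) σ)
    · rw [coboundary_snd]
      refine coboundary_eq_zero fun τ _ => ?_
      rw [Pi.sub_apply, Prod.snd_sub, lift_snd he2 hk ht, sub_self]
  refine ⟨⟨_, hmem⟩, congrArg (Submodule.mkQ _) (Subtype.ext (funext fun σ => ?_))⟩
  change Δ.coneFan.quotientProj σ.1 (a σ.1 - lift e (fun σ => (a σ).2) σ.1) =
    Δ.coneFan.quotientProj σ.1 (a σ.1)
  rw [map_sub, Fan.quotientProj_eq_zero_iff.2 (lift_mem_coneSpan he _ σ.1), sub_zero]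

/-- The vanishing of a class in `D` up to horizontal functions. -/
theorem toD_eq_zero_iff_exists (hne : Δ.carrier.Nonempty) (he : ∀ σ, e σ ∈ coneSpan σ.1)
    (he2 : ∀ σ, σ ≠ Δ.vertex → (e σ).2 = 1) {k : ℤ} (hk : 1 ≤ k) (a : horizontalPrimitives o k) :
    toD o k a = 0 ↔ ∃ r ∈ Δ.coneFan.degree K (k - 1), ∃ y ∈ Δ.horizontal,
      y ∈ Δ.coneFan.degree (V × K) k ∧ coboundary (Δ.coneFan.matrix o)
        (a.1 - lift e (coboundary (Δ.coneFan.matrix o) r)) = coboundary (Δ.coneFan.matrix o) y := by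
  rw [toD_eq_zero_iff]
  obtain ⟨ha, hda⟩ := mem_horizontalPrimitives.1 a.2
  constructor
  · rintro ⟨c, hc, h⟩
    have hdc := Fan.coboundary_mem_degree (o := o) (sub_add_cancel k 1) hc
    have hdd := coboundary_coboundary o c
    have ht : (fun σ => (a.1 σ - coboundary (Δ.coneFan.matrix o) c σ).2) ∈ Δ.coneFan.degree K k :=
      fun σ hσ => by
        beta_reduce
        rw [ha σ hσ, hdc σ hσ, sub_zero, Prod.snd_zero]
    -- The heights of a - dc form a cocycle, hence are some dr. Removing their lift leaves a
    -- horizontal function.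
    obtain ⟨r, hr, hrt⟩ := exists_coboundary_eq hne o (sub_add_cancel k 1) ht (by
      funext σ
      rw [← coboundary_snd (fun σ => a.1 σ - coboundary (Δ.coneFan.matrix o) c σ)]
      change (coboundary (Δ.coneFan.matrix o) (a.1 - coboundary (Δ.coneFan.matrix o) c) σ).2 = 0
      rw [map_sub, hdd, sub_zero, (hda σ).2])
    refine ⟨r, hr, a.1 - coboundary (Δ.coneFan.matrix o) c -
      lift e (coboundary (Δ.coneFan.matrix o) r), mem_horizontal.2 fun σ => ⟨?_, ?_⟩, ?_, ?_⟩
    · exact Submodule.sub_mem _ (h σ) (lift_mem_coneSpan he _ σ)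
    · rw [hrt, Pi.sub_apply, Prod.snd_sub, lift_snd he2 hk ht]
      exact sub_self _
    · rw [hrt]
      exact Submodule.sub_mem _ (Submodule.sub_mem _ ha hdc) (lift_mem_degree ht)
    · rw [map_sub, map_sub, map_sub, hdd, sub_zero]
  · rintro ⟨r, hr, y, hy, hyk, hay⟩
    have hdr := Fan.coboundary_mem_degree (o := o) (sub_add_cancel k 1) hr
    -- The function a minus lift and y is closed, hence equal to some dc; a - dc is then a sum of
    -- vectors of the spans.
    obtain ⟨c, hc, hca⟩ := exists_coboundary_eq hne o (sub_add_cancel k 1)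
      (x := a.1 - lift e (coboundary (Δ.coneFan.matrix o) r) - y)
      (Submodule.sub_mem _ (Submodule.sub_mem _ ha (lift_mem_degree hdr)) hyk)
      (by rw [map_sub, hay, sub_self])
    refine ⟨c, hc, fun σ => ?_⟩
    rw [hca]
    have h1 : a.1 σ - (a.1 - lift e (coboundary (Δ.coneFan.matrix o) r) - y) σ =
        lift e (coboundary (Δ.coneFan.matrix o) r) σ + y σ := by
      rw [Pi.sub_apply, Pi.sub_apply]
      abel
    rw [h1]
    exact Submodule.add_mem _ (lift_mem_coneSpan he _ σ) (mem_horizontal.1 hy σ).1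

/-- In degree at least two the heights can be corrected by a coboundary. -/
theorem exists_horizontal_of_two_le (he : ∀ σ, e σ ∈ coneSpan σ.1)
    (he2 : ∀ σ, σ ≠ Δ.vertex → (e σ).2 = 1) {k : ℤ} (hk : 2 ≤ k)
    {r : Δ.coneFan.Cone → K} (hr : r ∈ Δ.coneFan.degree K (k - 1)) :
    ∃ y ∈ Δ.horizontal, y ∈ Δ.coneFan.degree (V × K) k ∧
      coboundary (Δ.coneFan.matrix o) (lift e (coboundary (Δ.coneFan.matrix o) r)) =
        coboundary (Δ.coneFan.matrix o) y := by
  have hdr := Fan.coboundary_mem_degree (o := o) (sub_add_cancel k 1) hr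
  -- For k ≥ 2 the function r has positive degree, so lifting it preserves its heights. Both terms
  -- then have height dr and the second one is closed.
  refine ⟨lift e (coboundary (Δ.coneFan.matrix o) r) - coboundary (Δ.coneFan.matrix o) (lift e r),
    mem_horizontal.2 fun σ => ⟨Submodule.sub_mem _ (lift_mem_coneSpan he _ σ)
      (coboundary_mem_coneSpan o (lift_mem_coneSpan he _) σ), ?_⟩,
    Submodule.sub_mem _ (lift_mem_degree hdr)
      (Fan.coboundary_mem_degree (sub_add_cancel k 1) (lift_mem_degree hr)), ?_⟩
  · rw [Pi.sub_apply, Prod.snd_sub, lift_snd he2 (by omega) hdr, coboundary_snd]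
    simp_rw [lift_snd he2 (show 1 ≤ k - 1 by omega) hr]
    exact sub_self _
  · rw [map_sub, coboundary_coboundary, sub_zero]

theorem coboundary_of_degree_zero {E : Type*} [AddCommGroup E] [Module K E]
    {a : Δ.coneFan.Cone → E} (ha : a ∈ Δ.coneFan.degree E 0) (σ : Δ.coneFan.Cone) :
    coboundary (Δ.coneFan.matrix o) a σ = Δ.coneFan.matrix o Δ.vertex σ • a Δ.vertex := by
  rw [coboundary_apply]
  refine Finset.sum_eq_single _ (fun τ _ hτ => ?_) fun h => absurd (Finset.mem_univ _) h
  rw [ha τ fun h => hτ (coneDim_eq_zero_iff.1 (by omega)), smul_zero]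

theorem matrix_vertex_ne_zero {σ : Δ.coneFan.Cone} (hσ : coneDim σ.1 = 1) :
    Δ.coneFan.matrix o Δ.vertex σ ≠ 0 :=
  (Δ.isIncidenceMatrix o).ne_zero Δ.vertex σ (bot_le : (⊥ : PointedCone K (V × K)) ≤ σ.1)
    (by rw [hσ, coneDim_vertex])

/-- At a ray, da is a nonzero multiple of the value of a at the vertex. That value would therefore
lie in the spans of all rays. -/
theorem eq_zero_of_coboundary_mem_coneSpan (hΔ : affineSpan K Δ.carrier = ⊤)
    (hV : 1 ≤ finrank K V) {k : ℤ} (hk : k ≤ 0) {a : Δ.coneFan.Cone → V × K}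
    (ha : a ∈ Δ.coneFan.degree (V × K) k)
    (hda : ∀ σ, coboundary (Δ.coneFan.matrix o) a σ ∈ coneSpan σ.1) : a = 0 := by
  funext σ
  by_cases hσ : (coneDim σ.1 : ℤ) = k
  swap
  · exact ha σ hσ
  obtain rfl : k = 0 := by omega
  rw [coneDim_eq_zero_iff.1 (show coneDim σ.1 = 0 by omega)]
  by_contra h0
  obtain ⟨v, hv, hav⟩ := exists_ray_notMem hΔ o hV h0
  have h1 := hda v
  rw [coboundary_of_degree_zero ha, Submodule.smul_mem_iff _ (matrix_vertex_ne_zero hv)] at h1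
  exact hav h1

theorem horizontal_eq_zero_of_degree_one {y : Δ.coneFan.Cone → V × K} (hy : y ∈ Δ.horizontal)
    (hy1 : y ∈ Δ.coneFan.degree (V × K) 1) : y = 0 := by
  funext σ
  by_cases hσ : (coneDim σ.1 : ℤ) = 1
  swap
  · exact hy1 σ hσ
  have h1 := finrank_lin (show σ.1.IsFaceOf Δ.cone from σ.2) fun h => by
    rw [show σ = Δ.vertex from Subtype.ext h, coneDim_vertex] at hσ
    omega
  have h2 : lin σ.1 = ⊥ := Submodule.finrank_eq_zero.1 (by omega)
  have h3 := fst_mem_lin hy σ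
  rw [h2, Submodule.mem_bot] at h3
  exact Prod.ext h3 (mem_horizontal.1 hy σ).2

/-- Horizontal functions of degree one are zero, so the lift of dr is closed and equals dw with w
supported at the vertex. On each ray v this reads w = r e_v. No nonzero vector lies in the spans of
all rays, whence w = 0, and taking heights gives r = 0. -/
theorem eq_zero_of_lift_coboundary (hΔ : affineSpan K Δ.carrier = ⊤) (hV : 1 ≤ finrank K V)
    (he2 : ∀ σ, σ ≠ Δ.vertex → (e σ).2 = 1) {r : Δ.coneFan.Cone → K}
    (hr : r ∈ Δ.coneFan.degree K 0) (he : ∀ σ, e σ ∈ coneSpan σ.1)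
    {y : Δ.coneFan.Cone → V × K} (hy : y ∈ Δ.horizontal) (hy1 : y ∈ Δ.coneFan.degree (V × K) 1)
    (h : coboundary (Δ.coneFan.matrix o) (lift e (coboundary (Δ.coneFan.matrix o) r)) =
      coboundary (Δ.coneFan.matrix o) y) : r Δ.vertex = 0 := by
  have hne := carrier_nonempty hΔ
  rw [horizontal_eq_zero_of_degree_one hy hy1, map_zero] at h
  obtain ⟨w, hw, hwr⟩ := exists_coboundary_eq hne o (zero_add 1)
    (lift_mem_degree (Fan.coboundary_mem_degree (zero_add 1) hr)) h
  have hray : ∀ v : Δ.coneFan.Cone, coneDim v.1 = 1 → w Δ.vertex = r Δ.vertex • e v := by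
    intro v hv
    have h1 := congrFun hwr v
    rw [lift_apply, coboundary_of_degree_zero hw, coboundary_of_degree_zero hr, smul_assoc] at h1
    exact smul_right_injective _ (matrix_vertex_ne_zero hv) h1
  have hw0 : w Δ.vertex = 0 := by
    by_contra h0
    obtain ⟨v, hv, hwv⟩ := exists_ray_notMem hΔ o hV h0
    exact hwv (by rw [hray v hv]; exact Submodule.smul_mem _ _ (he v))
  obtain ⟨v, hv, -⟩ := exists_ray_notMem hΔ o hV (w := ((0, 1) : V × K))
    fun h => one_ne_zero (congrArg Prod.snd h)
  have h1 := hray v hv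
  have h2 : (e v).2 = 1 := he2 v fun h => by
    rw [h, coneDim_vertex] at hv
    omega
  rw [hw0] at h1
  have h3 := congrArg Prod.snd h1
  rw [Prod.smul_snd, h2, smul_eq_mul, mul_one] at h3
  exact h3.symm

end Polytope


/-! ### Conclusion: the isomorphisms and the exact sequence -/

namespace Polytope

variable {K : Type*} [Field K] [LinearOrder K] [IsStrictOrderedRing K]
variable {V : Type*} [AddCommGroup V] [Module K V] [FiniteDimensional K V]
variable {Δ : Polytope K V}

theorem subsingleton_horizontalPrimitives (hΔ : affineSpan K Δ.carrier = ⊤)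
    (hV : 1 ≤ finrank K V) (o : Δ.coneFan.Orientations) {k : ℤ} (hk : k ≤ 0) :
    Subsingleton (horizontalPrimitives o k) := by
  refine subsingleton_of_forall_eq 0 fun a => Subtype.ext ?_
  obtain ⟨ha, hda⟩ := mem_horizontalPrimitives.1 a.2
  exact eq_zero_of_coboundary_mem_coneSpan hΔ hV hk ha fun σ => (hda σ).1

theorem subsingleton_D (hΔ : affineSpan K Δ.carrier = ⊤)
    (hV : 1 ≤ finrank K V) (o : Δ.coneFan.Orientations) {k : ℤ} (hk : k ≤ 0) :
    Subsingleton (Δ.D o k) := by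
  refine subsingleton_of_forall_eq 0 fun z => ?_
  obtain ⟨⟨z, hz⟩, rfl⟩ := Submodule.mkQ_surjective _ z
  obtain ⟨a, ha, rfl⟩ := Fan.exists_presented_eq (X := Δ.coneFan) Fan.quotientProj_surjective z
  have hspan := coboundary_mem_coneSpan_of_mem_ker ha hz
  have h0 := eq_zero_of_coboundary_mem_coneSpan hΔ hV hk ha hspan
  subst h0
  refine (congrArg (Submodule.mkQ _) (Subtype.ext ?_)).trans (map_zero _)
  exact map_zero _

/-- The first Hodge spaces of the normal fan and the invariants `D` in degrees other than one. -/
theorem nonempty_hodgeSpace_equiv (hΔ : affineSpan K Δ.carrier = ⊤) (hV : 1 ≤ finrank K V)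
    (oN : (Δ.normalFan hΔ).Orientations) (oC : Δ.coneFan.Orientations) {k : ℤ} (hk : k ≠ 1) :
    Nonempty ((Δ.normalFan hΔ).HodgeSpace oN k 1 ≃ₗ[K] Δ.D oC k) := by
  refine (exists_toHodgeSpace hΔ oN oC k).elim fun p ⟨hp, hp0⟩ => ?_
  -- For k ≤ 0 both spaces vanish; for k ≥ 2 the two kernels agree.
  rcases le_or_gt k 0 with hk0 | hk0
  · have h1 := subsingleton_horizontalPrimitives hΔ hV oC hk0
    have h2 := hp.subsingleton
    have h3 := subsingleton_D hΔ hV oC hk0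
    exact ⟨LinearEquiv.ofBijective 0 ⟨fun _ _ _ => Subsingleton.elim _ _,
      fun _ => ⟨0, Subsingleton.elim _ _⟩⟩⟩
  · refine (exists_heights Δ).elim fun e ⟨he, he2⟩ => ?_
    refine nonempty_linearEquiv_of_ker_eq hp (toD_surjective (o := oC) he he2 hk0) fun a => ?_
    rw [hp0, toD_eq_zero_iff_exists (carrier_nonempty hΔ) he he2 hk0]
    constructor
    · rintro ⟨y, hy, hyk, h⟩
      exact ⟨0, Submodule.zero_mem _, y, hy, hyk, by rw [map_zero, map_zero, sub_zero, h]⟩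
    · rintro ⟨r, hr, y, hy, hyk, h⟩
      obtain ⟨y', hy', hyk', h'⟩ := exists_horizontal_of_two_le he he2
        (show 2 ≤ k by omega) hr
      refine ⟨y + y', Submodule.add_mem _ hy hy', Submodule.add_mem _ hyk hyk', ?_⟩
      rw [map_add, ← h, ← h', ← map_add, sub_add_cancel]

/-- The source of the copy of K in H^{1,1}: j c is the lift of the coboundary of the function with
value c at the vertex. It dies in D^1, but in degree one its differential is not that of a
horizontal function unless c = 0. -/
theorem exists_toHorizontalPrimitives (hΔ : affineSpan K Δ.carrier = ⊤) (hV : 1 ≤ finrank K V)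
    (o : Δ.coneFan.Orientations) :
    ∃ j : K →ₗ[K] horizontalPrimitives o 1,
      (∀ a, toD o 1 a = 0 ↔ ∃ c, ∃ y ∈ Δ.horizontal, y ∈ Δ.coneFan.degree (V × K) 1 ∧
        coboundary (Δ.coneFan.matrix o) (a - j c).1 = coboundary (Δ.coneFan.matrix o) y) ∧
      ∀ c, (∃ y ∈ Δ.horizontal, y ∈ Δ.coneFan.degree (V × K) 1 ∧
        coboundary (Δ.coneFan.matrix o) (j c).1 = coboundary (Δ.coneFan.matrix o) y) → c = 0 := by
  classical
  obtain ⟨e, he, he2⟩ := exists_heights Δ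
  have hdeg : ∀ c : K, Pi.single Δ.vertex c ∈ Δ.coneFan.degree K (1 - 1) := fun c =>
    single_mem_degree (by rw [coneDim_vertex]; rfl) c
  let j : K →ₗ[K] horizontalPrimitives o 1 := LinearMap.codRestrict _
    (lift e ∘ₗ coboundary (Δ.coneFan.matrix o) ∘ₗ LinearMap.single K (fun _ => K) Δ.vertex)
    fun c => lift_coboundary_mem he he2 le_rfl (hdeg c)
  have hj : ∀ c, (j c).1 = lift e (coboundary (Δ.coneFan.matrix o) (Pi.single Δ.vertex c)) :=
    fun _ => rfl
  refine ⟨j, fun a => ?_, fun c ⟨y, hy, hy1, h⟩ => ?_⟩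
  · rw [toD_eq_zero_iff_exists (carrier_nonempty hΔ) he he2 le_rfl]
    constructor
    · rintro ⟨r, hr, h⟩
      refine ⟨r Δ.vertex, ?_⟩
      have hrs : r = Pi.single Δ.vertex (r Δ.vertex) := by
        funext σ
        by_cases hσ : σ = Δ.vertex
        · rw [hσ, Pi.single_eq_same]
        · rw [Pi.single_eq_of_ne hσ]
          exact hr σ fun h => hσ (coneDim_eq_zero_iff.1 (by omega))
      rw [hrs, ← hj] at h
      exact h
    · exact fun ⟨c, hc⟩ => ⟨Pi.single Δ.vertex c, hdeg c, hc⟩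
  · rw [hj] at h
    have h1 := eq_zero_of_lift_coboundary hΔ hV he2 (hdeg c) he hy hy1 h
    rwa [Pi.single_eq_same] at h1

/-- The first Hodge space `H^{1,1}` of the normal fan is an extension of `D^1`. -/
theorem exists_exact_hodgeSpace (hΔ : affineSpan K Δ.carrier = ⊤) (hV : 1 ≤ finrank K V)
    (oN : (Δ.normalFan hΔ).Orientations) (oC : Δ.coneFan.Orientations) :
    ∃ (f : K →ₗ[K] (Δ.normalFan hΔ).HodgeSpace oN 1 1)
        (g : (Δ.normalFan hΔ).HodgeSpace oN 1 1 →ₗ[K] Δ.D oC 1),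
      Function.Injective f ∧ Function.Exact f g ∧ Function.Surjective g := by
  refine (exists_toHodgeSpace hΔ oN oC 1).elim fun p ⟨hp, hp0⟩ => ?_
  refine (exists_heights Δ).elim fun e ⟨he, he2⟩ => ?_
  refine (exists_toHorizontalPrimitives hΔ hV oC).elim fun j ⟨hj, hj0⟩ => ?_
  refine exists_exact_of_surjective j hp (toD_surjective (o := oC) he he2 le_rfl) (fun a => ?_)
    fun c hc => hj0 c ((hp0 _).1 hc)
  refine (hj a).trans (exists_congr fun c => ?_)
  rw [← sub_eq_zero (a := p a), ← map_sub]
  exact (hp0 _).symm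

end Polytope

theorem proposition3p3 (K : Subfield ℝ) (n : ℕ) (hn : 1 ≤ n)
    (Δ : Polytope K (Fin n → K)) (hΔ : affineSpan K Δ.carrier = ⊤)
    (oN : (Δ.normalFan hΔ).Orientations) (oC : Δ.coneFan.Orientations) :
    (∃ (f : K →ₗ[K] (Δ.normalFan hΔ).HodgeSpace oN 1 1)
        (g : (Δ.normalFan hΔ).HodgeSpace oN 1 1 →ₗ[K] Δ.D oC 1),
      Function.Injective f ∧ Function.Exact f g ∧ Function.Surjective g) ∧
    ∀ k : ℤ, k ≠ 1 →
      Nonempty ((Δ.normalFan hΔ).HodgeSpace oN k 1 ≃ₗ[K] Δ.D oC k) := by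
  have hV : 1 ≤ Module.finrank K (Fin n → K) := by rwa [Module.finrank_fin_fun]
  exact ⟨Polytope.exists_exact_hodgeSpace hΔ hV oN oC,
    fun k hk => Polytope.nonempty_hodgeSpace_equiv hΔ hV oN oC hk⟩

end
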